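/- Let $d\ge 1$, and let $(x,y)$ be a square-integrable random vector in $\mathbb{R}^d\times\mathbb{R}$. Put $L(\theta)=\frac12E((y-x^T\theta)^2)$ for $\theta\in\mathbb{R}^d$ and $H=E(xx^T)$. Assume that $H$ is positive-definite with smallest eigenvalue $\lambda_{\min}$, and let $\theta^*$ be the solution of $H\theta^*=E(yx)$. Assume that there are $\sigma,R>0$ such that the matrices $E((y-x^T\theta^*)^2xx^T)$ and $E(\|x\|^2xx^T)$ are finite and $$E((y-x^T\theta^*)^2xx^T)\preccurlyeq\sigma^2H,\qquad E(\|x\|^2xx^T)\preccurlyeq R^2H,$$ where $A\preccurlyeq B$ means that $B-A$ is positive semi-definite. Let $\theta_0\in\mathbb{R}^d$, $0<\gamma<2/R^2$, $0<\alpha\le 1/2$, $q\in(0,1]$, $\delta>1$, let $k\ge2$ and $M\ge2$ be integers, and let $s$ be $\alpha k$ rounded to an integer, i.e. $s=\lfloor\alpha k\rfloor$ or $s=\lceil\alpha k\rceil$. Set $$c=\frac{\sigma^2d}{(2-\gamma R^2)^2}+\frac{\|\theta_0-\theta^*\|^2}{\gamma(2-\gamma R^2)},\qquad \xi=\gamma(2-\gamma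 R^2)\lambda_{\min},\qquad p_l=\frac1{2^l(l+1)^\delta}-\frac1{2^{l+1}(l+2)^\delta}\quad(l\ge0).$$ Let $(x_t,y_t)$, $t\in\mathbb{Z}$, be independent copies of $(x,y)$. For $m\in\mathbb{Z}$ let $\theta_{m:m}=\theta_0$ and $\theta_{m:t+1}=\theta_{m:t}-\gamma(x_t^T\theta_{m:t}-y_t)x_t$ for $t\ge m$, and let $\bar\theta_k=\frac1{k-s}\sum_{t=s}^{k-1}\theta_{0:t}$. Let $\tau_0$ be uniform on $\{s,\dots,k-1\}$, let $\tau_l$ be uniform on $\{k(2^l-1),\dots,k(2^{l+1}-1)-1\}$ for $l\ge1$, and let $N\ge0$ be an integer-valued random variable with $\Pr(N=l)=p_l$ for $l\ge0$; the random variables $(x_t,y_t)$, $t\in\mathbb{Z}$, $\tau_l$, $l\ge0$, and $N$ are mutually independent. Set $$Z_k=\frac{\theta_{-\tau_{N+1}:0}-\theta_{-\tau_N:0}}{p_N},\qquad \hat f_k=\bar\theta_k+q^{-1}QZ'_k,$$ where $Q$ is a Bernoulli random variable with $\Pr(Q=1)=q$ independent of $\bar\theta_k$, and $Z'_k$ is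 a copy of $Z_k$ independent of $(\bar\theta_k,Q)$. Let $\hat f_k^{(1)},\dots,\hat f_k^{(M)}$ be independent copies of $\hat f_k$ and $\bar f_{k,M}=\frac1M\sum_{i=1}^M\hat f_k^{(i)}$. Then $L(\bar f_{k,M})$ is integrable and $$kM\bigl(E(L(\bar f_{k,M}))-L(\theta^*)\bigr)\le\frac1{2q}\left(\frac{27c}{\alpha}+6c\left(4\ln\left(\frac{4\delta+8}{\alpha\xi}\right)\right)^{\delta+1}\right).$$ -/

import Mathlib

open MeasureTheory ProbabilityTheory

namespace UnbiasedSGD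

/-- `d`-dimensional column vectors with the Euclidean norm. -/
abbrev Vec (d : ℕ) : Type := EuclideanSpace ℝ (Fin d)

section Regression

variable {d : ℕ} {Ω : Type*} [MeasurableSpace Ω]

/-- The least squares risk `L(θ) = (1/2) E((y - xᵀθ)²)`. -/
noncomputable def risk (P : Measure Ω) (x : Ω → Vec d) (y : Ω → ℝ) (θ : Vec d) : ℝ :=
  (1 / 2) * ∫ ω, (y ω - inner ℝ (x ω) θ) ^ 2 ∂P

/-- The weighted second moment matrix `E(w x xᵀ)`, computed entrywise. -/
noncomputable def weightedMoment (P : Measure Ω) (w : Ω → ℝ) (x : Ω → Vec d) :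
    Matrix (Fin d) (Fin d) ℝ :=
  Matrix.of fun i j => ∫ ω, w ω * (x ω i * x ω j) ∂P

/-- The Hessian matrix `H = E(x xᵀ)`. -/
noncomputable def hessian (P : Measure Ω) (x : Ω → Vec d) : Matrix (Fin d) (Fin d) ℝ :=
  weightedMoment P (fun _ => 1) x

/-- The normal equation `H θ = E(y x)`. -/
def NormalEq (P : Measure Ω) (x : Ω → Vec d) (y : Ω → ℝ) (θ : Vec d) : Prop :=
  Matrix.mulVec (hessian P x) (WithLp.ofLp θ) = fun i => ∫ ω, y ω * x ω i ∂P

/-- The matrix `E(w x xᵀ)` exists (all of its entries are finite) and `E(w x xᵀ) ≼ b H`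
in the order of symmetric matrices. -/
structure MomentBound (P : Measure Ω) (w : Ω → ℝ) (x : Ω → Vec d) (b : ℝ) : Prop where
  integrable : ∀ i j, Integrable (fun ω => w ω * (x ω i * x ω j)) P
  le : (b • hessian P x - weightedMoment P w x).PosSemidef

/-- The moment assumption with constants `σ` and `R`:
`E((y - xᵀθ*)² x xᵀ) ≼ σ² H` and `E(‖x‖² x xᵀ) ≼ R² H`. -/
structure MomentAssumption (P : Measure Ω) (x : Ω → Vec d) (y : Ω → ℝ) (θs : Vec d)
    (σ R : ℝ) : Prop where
  σ_pos : 0 < σ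
  R_pos : 0 < R
  noise : MomentBound P (fun ω => (y ω - inner ℝ (x ω) θs) ^ 2) x (σ ^ 2)
  fourth : MomentBound P (fun ω => ‖x ω‖ ^ 2) x (R ^ 2)

end Regression

/-- The smallest eigenvalue of a symmetric real matrix (of size at least `1`). -/
noncomputable def lambdaMin {d : ℕ} (A : Matrix (Fin d) (Fin d) ℝ) : ℝ :=
  sInf (spectrum ℝ A)

section Path

variable {d : ℕ}

/-- The state after `n` steps of the stochastic gradient recursion started at time `m` in `θ₀`,
that is `θ_{m:m+n}`, as a function of the sample path `(x_t, y_t)`, `t ∈ ℤ`. -/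
noncomputable def sgdSteps (γ : ℝ) (θ₀ : Vec d) (x : ℤ → Vec d) (y : ℤ → ℝ) (m : ℤ) :
    ℕ → Vec d
  | 0 => θ₀
  | n + 1 =>
      sgdSteps γ θ₀ x y m n
        - (γ * (inner ℝ (x (m + n)) (sgdSteps γ θ₀ x y m n) - y (m + n))) • x (m + n)

/-- The iterate `θ_{m:t}` for `m ≤ t`. -/
noncomputable def sgd (γ : ℝ) (θ₀ : Vec d) (x : ℤ → Vec d) (y : ℤ → ℝ) (m t : ℤ) : Vec d :=
  sgdSteps γ θ₀ x y m (t - m).toNat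

/-- The time-average estimator `(k - s)⁻¹ ∑_{t=s}^{k-1} θ_t`, where `θ_t = θ_{0:t}`. -/
noncomputable def timeAvg (γ : ℝ) (θ₀ : Vec d) (k s : ℕ) (x : ℤ → Vec d) (y : ℤ → ℝ) : Vec d :=
  ((k : ℝ) - (s : ℝ))⁻¹ • ∑ t ∈ Finset.Ico s k, sgd γ θ₀ x y 0 (t : ℤ)

/-- `p_l = 1 / (2^l (l+1)^δ) - 1 / (2^(l+1) (l+2)^δ)`. -/
noncomputable def levelProb (δ : ℝ) (l : ℕ) : ℝ :=
  1 / (2 ^ l * ((l : ℝ) + 1) ^ δ) - 1 / (2 ^ (l + 1) * ((l : ℝ) + 2) ^ δ)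

/-- The range of the random start at level `l`: `{s, …, k-1}` if `l = 0`, and
`{k(2^l - 1), …, k(2^(l+1) - 1) - 1}` if `l ≥ 1`. -/
def startRange (k s l : ℕ) : Set ℕ :=
  if l = 0 then Set.Ico s k else Set.Ico (k * (2 ^ l - 1)) (k * (2 ^ (l + 1) - 1))

/-- The single term estimator `Z = (f_{n+1} - f_n) / p_n` with `f_l = θ_{-τ_l:0}`, as a function of
the sample path, of the random starts `τ_l` and of the level `n`. -/
noncomputable def singleTerm (γ : ℝ) (θ₀ : Vec d) (δ : ℝ) (x : ℤ → Vec d) (y : ℤ → ℝ)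
    (τ : ℕ → ℕ) (n : ℕ) : Vec d :=
  (levelProb δ n)⁻¹ •
    (sgd γ θ₀ x y (-(τ (n + 1) : ℤ)) 0 - sgd γ θ₀ x y (-(τ n : ℤ)) 0)

end Path

section Estimator

variable {d : ℕ} {Ω₀ Ω : Type*} [MeasurableSpace Ω₀] [MeasurableSpace Ω]

/-- The random inputs of the single term estimator: independent copies `(x_t, y_t)`, `t ∈ ℤ`, of
`(x, y)`, uniform random starts `τ_l`, `l ≥ 0`, and a random level `N` with `Pr(N = l) = p_l`,
all of them being mutually independent. -/
structure IsInput (P₀ : Measure Ω₀) (x : Ω₀ → Vec d) (y : Ω₀ → ℝ) (P : Measure Ω)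
    (δ : ℝ) (k s : ℕ) (xs : ℤ → Ω → Vec d) (ys : ℤ → Ω → ℝ) (τ : ℕ → Ω → ℕ) (N : Ω → ℕ) :
    Prop where
  meas_xs : ∀ t, Measurable (xs t)
  meas_ys : ∀ t, Measurable (ys t)
  meas_τ : ∀ l, Measurable (τ l)
  meas_N : Measurable N
  copy : ∀ t, IdentDistrib (fun ω => (xs t ω, ys t ω)) (fun ω => (x ω, y ω)) P P₀
  law_τ : ∀ l, P.map (τ l) = uniformOn (startRange k s l)
  law_N : ∀ l, P.real {ω | N ω = l} = levelProb δ l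
  indep_xy : iIndepFun (fun t ω => (xs t ω, ys t ω)) P
  indep_τ : iIndepFun τ P
  indep_xy_τ : IndepFun (fun ω t => (xs t ω, ys t ω)) (fun ω l => τ l ω) P
  indep_N : IndepFun N (fun ω => ((fun t => (xs t ω, ys t ω)), (fun l => τ l ω))) P

/-- `F` is the estimator `f̂ = θ̄ + q⁻¹ Q Z'`, where `θ̄` is the time average estimator, `Q` is a
Bernoulli variable with parameter `q` independent of `θ̄`, and `Z'` is a copy of the single term
estimator independent of `(θ̄, Q)`. -/
def IsFHat (P₀ : Measure Ω₀) (x : Ω₀ → Vec d) (y : Ω₀ → ℝ) (P : Measure Ω)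
    (γ : ℝ) (θ₀ : Vec d) (δ q : ℝ) (k s : ℕ) (F : Ω → Vec d) : Prop :=
  ∃ (xs : ℤ → Ω → Vec d) (ys : ℤ → Ω → ℝ) (τ : ℕ → Ω → ℕ) (N Q : Ω → ℕ) (Z' : Ω → Vec d),
    IsInput P₀ x y P δ k s xs ys τ N ∧
    Measurable Q ∧ P.real {ω | Q ω = 1} = q ∧ P.real {ω | Q ω = 0} = 1 - q ∧
    IndepFun Q (fun ω => timeAvg γ θ₀ k s (fun t => xs t ω) (fun t => ys t ω)) P ∧
    Measurable Z' ∧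
    IdentDistrib Z'
      (fun ω => singleTerm γ θ₀ δ (fun t => xs t ω) (fun t => ys t ω) (fun l => τ l ω) (N ω))
      P P ∧
    IndepFun Z'
      (fun ω => (timeAvg γ θ₀ k s (fun t => xs t ω) (fun t => ys t ω), Q ω)) P ∧
    F = fun ω =>
      timeAvg γ θ₀ k s (fun t => xs t ω) (fun t => ys t ω) + (q⁻¹ * (Q ω : ℝ)) • Z' ω

end Estimator

/-- `c = σ²d / (2 - γR²)² + ‖θ₀ - θ*‖² / (γ (2 - γR²))`. -/
noncomputable def constC {d : ℕ} (σ R γ : ℝ) (θ₀ θs : Vec d) : ℝ :=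
  σ ^ 2 * d / (2 - γ * R ^ 2) ^ 2 + ‖θ₀ - θs‖ ^ 2 / (γ * (2 - γ * R ^ 2))

/-- `ξ = γ (2 - γR²) λ_min`, where `lam` is the smallest eigenvalue `λ_min` of `H`. -/
def constXi (R γ lam : ℝ) : ℝ :=
  γ * (2 - γ * R ^ 2) * lam

end UnbiasedSGD

/-! After subtracting `θ*`, a gradient step reads `D ↦ (I - γxxᵀ)D + γεx` with residual `ε`. The
normal equation says `E(εx) = 0`, and the excess risk is half of the Hessian form (`risk_eq`), so
everything is an estimate of `E⟨D, HD⟩`.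

Let `T(A) = E((I - γxxᵀ)A(I - γxxᵀ))` and `κ = γ(2 - γR²)`, so `ξ = κ λ_min`. The fourth moment
bound gives `T(I) ≼ I - κH` (`transfer_one_le`). Since `T` is monotone, iteration gives `Tⁿ(I) ≼ (1
- ξ)ⁿ I` and, by telescoping, `κ ∑ T^a(H) ≼ (1 - ξ)^s I` for the sum over `s ≤ a < n`
(`sum_iterate_transfer_hess_le`). The sum is bounded uniformly in its length, so averaging `T^a(H)`
over a range of starts gains the inverse length of the range.

The chain from `v = θ₀ - θ*` is a noise-free part, whose forms evolve by `T`, plus the chain from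
`0`. The latter is centred with second moment matrix at most `a I`, `a = γσ²/(2 - γR²)`
(`secondMoment_step`). Two chains ending at time `0` use the same samples after the later start, so
the difference of their zero-started parts also evolves without noise and contributes at most `a tr
T^n(H)`, with `n` the shorter length (`integral_form_level_le`). Averaging over the random starts
bounds the Hessian form of `f_{l+1} - f_l` by a multiple of `c (1 - ξ)^e / (k 2^l)`, with `e` the
first start of level `l`. Dividing by `p_l` costs at most `2^(l+1) (l+1)^δ`. The powers of two
cancel up to a factor, and `weight_sum` bounds the remaining series by cutting it at a logarithmic
level.

For the bias, the mean after `n` steps is `(I - γH)ⁿ v` whatever the starting time. The means of the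
level differences telescope, and the level means tend to `0`, so the single term has mean minus that
of level `0`. This is minus the mean of the centred time average, because `τ₀` is uniform on the
averaged times. Hence `f̂` is unbiased, and independence turns the cross term in its second moment
into a nonpositive number (`debiased_moments`). The time average itself is of order `1/k` by an
energy identity (`integral_form_sum_chain_le`), and averaging `M` independent centred copies divides
the second moment by `M`. -/

namespace UnbiasedSGD

/-! ### Rank-one operators and the gradient step -/

section Operators

variable {d : ℕ}

/-- The operator `z zᵀ`. -/
noncomputable def outer (z : Vec d) : Vec d →L[ℝ] Vec d := (innerSL ℝ z).smulRight z

/-- The operator `I - γ z zᵀ`. -/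
noncomputable def shrink (γ : ℝ) (z : Vec d) : Vec d →L[ℝ] Vec d := 1 - γ • outer z

lemma outer_apply (z v : Vec d) : outer z v = inner ℝ z v • z := by
  simp [outer]

lemma shrink_apply (γ : ℝ) (z v : Vec d) : shrink γ z v = v - (γ * inner ℝ z v) • z := by
  simp [shrink, outer_apply, mul_smul]

lemma inner_shrink (γ : ℝ) (z u v : Vec d) :
    inner ℝ (shrink γ z u) v = inner ℝ u (shrink γ z v) := by
  simp only [shrink_apply, inner_sub_left, inner_sub_right, inner_smul_left, inner_smul_right,
    real_inner_comm u z]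
  simp; ring

lemma continuous_outer : Continuous (outer : Vec d → Vec d →L[ℝ] Vec d) := by
  unfold outer; fun_prop

lemma continuous_shrink (γ : ℝ) : Continuous (shrink γ : Vec d → Vec d →L[ℝ] Vec d) := by
  have := continuous_outer (d := d)
  unfold shrink; fun_prop

lemma norm_outer_le (z : Vec d) : ‖outer z‖ ≤ ‖z‖ ^ 2 := by
  rw [outer, ContinuousLinearMap.norm_smulRight_apply, innerSL_apply_norm, sq]

lemma norm_shrink_le {γ : ℝ} (hγ : 0 ≤ γ) (z : Vec d) : ‖shrink γ z‖ ≤ 1 + γ * ‖z‖ ^ 2 := by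
  refine (norm_sub_le _ _).trans (add_le_add ContinuousLinearMap.norm_id_le ?_)
  rw [norm_smul, Real.norm_of_nonneg hγ]
  exact mul_le_mul_of_nonneg_left (norm_outer_le z) hγ

lemma norm_shrink_sq (γ : ℝ) (z v : Vec d) :
    ‖shrink γ z v‖ ^ 2
      = ‖v‖ ^ 2 - 2 * γ * inner ℝ z v ^ 2 + γ ^ 2 * (‖z‖ ^ 2 * inner ℝ z v ^ 2) := by
  rw [shrink_apply, norm_sub_sq_real, inner_smul_right, norm_smul, real_inner_comm, mul_pow,
    Real.norm_eq_abs, sq_abs]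
  ring

end Operators

/-- The law `ν` of a pair (regressor, residual): a centred linear model with finite moments, with
the noise and fourth moment bounds relative to the Hessian, and with Hessian at least `lam`. -/
structure NoiseModel {d : ℕ} (ν : Measure (Vec d × ℝ)) (σ R lam : ℝ) : Prop where
  prob : IsProbabilityMeasure ν
  fourth : Integrable (fun z => ‖z.1‖ ^ 4) ν
  noise : Integrable (fun z => z.2 ^ 2 * ‖z.1‖ ^ 2) ν
  fourth_le : ∀ v, ∫ z, ‖z.1‖ ^ 2 * inner ℝ z.1 v ^ 2 ∂ν ≤ R ^ 2 * ∫ z, inner ℝ z.1 v ^ 2 ∂ν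
  noise_le : ∀ v, ∫ z, z.2 ^ 2 * inner ℝ z.1 v ^ 2 ∂ν ≤ σ ^ 2 * ∫ z, inner ℝ z.1 v ^ 2 ∂ν
  orth : ∀ v, ∫ z, z.2 * inner ℝ z.1 v ∂ν = 0
  lam_pos : 0 < lam
  lam_le : ∀ v, lam * ‖v‖ ^ 2 ≤ ∫ z, inner ℝ z.1 v ^ 2 ∂ν
  R_pos : 0 < R

/-! ### The transfer operator on quadratic forms -/

section Transfer

variable {d : ℕ} {ν : Measure (Vec d × ℝ)} {σ R lam γ : ℝ}

/-- The Hessian operator `E(x xᵀ)`. -/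
noncomputable def hessOp (ν : Measure (Vec d × ℝ)) : Vec d →L[ℝ] Vec d := ∫ z, outer z.1 ∂ν

/-- The action `A ↦ E((I - γ x xᵀ) A (I - γ x xᵀ))` of one gradient step on quadratic forms. -/
noncomputable def transfer (ν : Measure (Vec d × ℝ)) (γ : ℝ) (A : Vec d →L[ℝ] Vec d) :
    Vec d →L[ℝ] Vec d :=
  ∫ z, (shrink γ z.1).comp (A.comp (shrink γ z.1)) ∂ν

namespace NoiseModel

lemma memLp_four (h : NoiseModel ν σ R lam) : MemLp (fun z : Vec d × ℝ => z.1) 4 ν := by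
  have := h.fourth
  have h4 := (integrable_norm_rpow_iff (μ := ν) (f := fun z : Vec d × ℝ => z.1) (p := 4)
    (by fun_prop) (by norm_num) (by norm_num)).1
  apply h4
  simpa using this

lemma integrable_sq (h : NoiseModel ν σ R lam) : Integrable (fun z => ‖z.1‖ ^ 2) ν := by
  have := h.prob
  have h2 : MemLp (fun z : Vec d × ℝ => z.1) 2 ν := h.memLp_four.mono_exponent (by norm_num)
  exact (memLp_two_iff_integrable_sq_norm (by fun_prop)).1 h2

lemma integrable_outer (h : NoiseModel ν σ R lam) : Integrable (fun z => outer z.1) ν := by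
  refine h.integrable_sq.mono' ?_ (Filter.Eventually.of_forall fun z => norm_outer_le _)
  exact (continuous_outer.comp continuous_fst).aestronglyMeasurable

lemma integrable_one_add_sq_sq (h : NoiseModel ν σ R lam) (γ : ℝ) :
    Integrable (fun z => (1 + γ * ‖z.1‖ ^ 2) ^ 2) ν := by
  have := h.prob
  have := ((integrable_const (1 : ℝ)).add (h.integrable_sq.const_mul (2 * γ))).add
    (h.fourth.const_mul (γ ^ 2))
  refine this.congr (Filter.Eventually.of_forall fun z => ?_)
  simp only [Pi.add_apply]; ring

lemma integrable_transfer (h : NoiseModel ν σ R lam) (hγ : 0 ≤ γ) (A : Vec d →L[ℝ] Vec d) :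
    Integrable (fun z => (shrink γ z.1).comp (A.comp (shrink γ z.1))) ν := by
  refine ((h.integrable_one_add_sq_sq γ).mul_const ‖A‖).mono' ?_
    (Filter.Eventually.of_forall fun z => ?_)
  · have hc : Continuous fun z : Vec d × ℝ => shrink γ z.1 :=
      (continuous_shrink γ).comp continuous_fst
    exact (hc.clm_comp (continuous_const.clm_comp hc)).aestronglyMeasurable
  · have h1 := norm_shrink_le hγ z.1
    calc _ ≤ ‖shrink γ z.1‖ * (‖A‖ * ‖shrink γ z.1‖) :=
          (ContinuousLinearMap.opNorm_comp_le _ _).trans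
            (mul_le_mul_of_nonneg_left (ContinuousLinearMap.opNorm_comp_le _ _) (norm_nonneg _))
      _ ≤ (1 + γ * ‖z.1‖ ^ 2) * (‖A‖ * (1 + γ * ‖z.1‖ ^ 2)) := by gcongr
      _ = _ := by ring

lemma hessOp_apply (h : NoiseModel ν σ R lam) (v : Vec d) :
    hessOp ν v = ∫ z, inner ℝ z.1 v • z.1 ∂ν := by
  rw [hessOp, ContinuousLinearMap.integral_apply h.integrable_outer]
  simp [outer_apply]

lemma integrable_inner_smul (h : NoiseModel ν σ R lam) (v : Vec d) :
    Integrable (fun z => inner ℝ z.1 v • z.1) ν := by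
  simpa [outer_apply] using h.integrable_outer.apply_continuousLinearMap v

lemma inner_hessOp (h : NoiseModel ν σ R lam) (u v : Vec d) :
    inner ℝ u (hessOp ν v) = ∫ z, inner ℝ z.1 u * inner ℝ z.1 v ∂ν := by
  rw [h.hessOp_apply, ← integral_inner (h.integrable_inner_smul v)]
  refine integral_congr_ae (Filter.Eventually.of_forall fun z => ?_)
  simp only [inner_smul_right, real_inner_comm u z.1]; ring

lemma inner_hessOp_self (h : NoiseModel ν σ R lam) (v : Vec d) :
    inner ℝ v (hessOp ν v) = ∫ z, inner ℝ z.1 v ^ 2 ∂ν := by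
  rw [h.inner_hessOp]; simp [sq]

lemma hessOp_symm (h : NoiseModel ν σ R lam) (u v : Vec d) :
    inner ℝ u (hessOp ν v) = inner ℝ v (hessOp ν u) := by
  rw [h.inner_hessOp, h.inner_hessOp]; simp [mul_comm]

lemma integrable_inner_sq (h : NoiseModel ν σ R lam) (v : Vec d) :
    Integrable (fun z => inner ℝ z.1 v ^ 2) ν := by
  refine (h.integrable_sq.mul_const (‖v‖ ^ 2)).mono' (by fun_prop)
    (Filter.Eventually.of_forall fun z => ?_)
  rw [Real.norm_of_nonneg (sq_nonneg _), ← mul_pow, ← sq_abs]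
  exact pow_le_pow_left₀ (abs_nonneg _) (abs_real_inner_le_norm _ _) 2

lemma integrable_sq_mul_inner_sq (h : NoiseModel ν σ R lam) (v : Vec d) :
    Integrable (fun z => ‖z.1‖ ^ 2 * inner ℝ z.1 v ^ 2) ν := by
  refine (h.fourth.mul_const (‖v‖ ^ 2)).mono' (by fun_prop)
    (Filter.Eventually.of_forall fun z => ?_)
  rw [Real.norm_of_nonneg (by positivity), show (4 : ℕ) = 2 + 2 from rfl, pow_add, mul_assoc]
  refine mul_le_mul_of_nonneg_left ?_ (by positivity)
  rw [← mul_pow, ← sq_abs]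
  exact pow_le_pow_left₀ (abs_nonneg _) (abs_real_inner_le_norm _ _) 2

lemma integrable_noise_inner_sq (h : NoiseModel ν σ R lam) (v : Vec d) :
    Integrable (fun z => z.2 ^ 2 * inner ℝ z.1 v ^ 2) ν := by
  refine (h.noise.mul_const (‖v‖ ^ 2)).mono' (by fun_prop)
    (Filter.Eventually.of_forall fun z => ?_)
  rw [Real.norm_of_nonneg (by positivity), mul_assoc]
  refine mul_le_mul_of_nonneg_left ?_ (by positivity)
  rw [← mul_pow, ← sq_abs]
  exact pow_le_pow_left₀ (abs_nonneg _) (abs_real_inner_le_norm _ _) 2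

lemma memLp_noise (h : NoiseModel ν σ R lam) : MemLp (fun z : Vec d × ℝ => z.2 • z.1) 2 ν := by
  rw [memLp_two_iff_integrable_sq_norm (by fun_prop)]
  simpa [norm_smul, mul_pow] using h.noise

lemma memLp_noise_inner (h : NoiseModel ν σ R lam) (v : Vec d) :
    MemLp (fun z : Vec d × ℝ => z.2 * inner ℝ z.1 v) 2 ν := by
  rw [memLp_two_iff_integrable_sq_norm (by fun_prop)]
  simpa [mul_pow] using h.integrable_noise_inner_sq v

lemma memLp_shrink (h : NoiseModel ν σ R lam) (hγ : 0 ≤ γ) (v : Vec d) :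
    MemLp (fun z : Vec d × ℝ => shrink γ z.1 v) 2 ν := by
  have hc : Continuous fun z : Vec d × ℝ => shrink γ z.1 v := by
    simp only [shrink_apply]; fun_prop
  rw [memLp_two_iff_integrable_sq_norm hc.aestronglyMeasurable]
  refine ((h.integrable_one_add_sq_sq γ).mul_const (‖v‖ ^ 2)).mono' (hc.norm.pow 2).aestronglyMeasurable
    (Filter.Eventually.of_forall fun z => ?_)
  rw [Real.norm_of_nonneg (by positivity), ← mul_pow]
  exact pow_le_pow_left₀ (norm_nonneg _) ((shrink γ z.1).le_of_opNorm_le (norm_shrink_le hγ _) v) 2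

lemma inner_transfer (h : NoiseModel ν σ R lam) (hγ : 0 ≤ γ) (A : Vec d →L[ℝ] Vec d)
    (u v : Vec d) :
    inner ℝ u (transfer ν γ A v) = ∫ z, inner ℝ (shrink γ z.1 u) (A (shrink γ z.1 v)) ∂ν := by
  have hi := h.integrable_transfer hγ A
  rw [transfer, ContinuousLinearMap.integral_apply hi,
    ← integral_inner (hi.apply_continuousLinearMap v)]
  simp [inner_shrink]

lemma integrable_inner_transfer (h : NoiseModel ν σ R lam) (hγ : 0 ≤ γ) (A : Vec d →L[ℝ] Vec d)
    (u v : Vec d) :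
    Integrable (fun z => inner ℝ (shrink γ z.1 u) (A (shrink γ z.1 v))) ν := by
  have hi := ((h.integrable_transfer hγ A).apply_continuousLinearMap v).const_inner (𝕜 := ℝ) u
  simpa [inner_shrink] using hi

/-- One gradient step contracts the identity form. -/
lemma transfer_one_le (h : NoiseModel ν σ R lam) (hγ : 0 ≤ γ) (v : Vec d) :
    inner ℝ v (transfer ν γ 1 v)
      ≤ inner ℝ v v - γ * (2 - γ * R ^ 2) * inner ℝ v (hessOp ν v) := by
  have := h.prob
  rw [h.inner_transfer hγ, h.inner_hessOp_self]
  have e : ∀ z : Vec d × ℝ, inner ℝ (shrink γ z.1 v) ((1 : Vec d →L[ℝ] Vec d) (shrink γ z.1 v))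
      = ‖v‖ ^ 2 - 2 * γ * inner ℝ z.1 v ^ 2 + γ ^ 2 * (‖z.1‖ ^ 2 * inner ℝ z.1 v ^ 2) := fun z => by
    rw [one_apply_eq_self, real_inner_self_eq_norm_sq, norm_shrink_sq]
  simp only [e]
  rw [integral_add, integral_sub, integral_const_mul, integral_const_mul, integral_const,
    real_inner_self_eq_norm_sq]
  · have := mul_le_mul_of_nonneg_left (h.fourth_le v) (sq_nonneg γ)
    simp only [probReal_univ, smul_eq_mul, one_mul]
    linarith
  · exact integrable_const _
  · exact (h.integrable_inner_sq v).const_mul _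
  · exact (integrable_const _).sub ((h.integrable_inner_sq v).const_mul _)
  · exact (h.integrable_sq_mul_inner_sq v).const_mul _

lemma integral_norm_shrink_sq_le (h : NoiseModel ν σ R lam) (hγ : 0 ≤ γ) (v : Vec d) :
    ∫ z, ‖shrink γ z.1 v‖ ^ 2 ∂ν
      ≤ ‖v‖ ^ 2 - γ * (2 - γ * R ^ 2) * inner ℝ v (hessOp ν v) := by
  have := h.transfer_one_le hγ v
  rw [h.inner_transfer hγ, real_inner_self_eq_norm_sq] at this
  simpa using this

/-- Averaging over congruences is linear and preserves the order of quadratic forms, so a one-step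
inequality propagates through all iterates. -/
lemma iterate_transfer_le (h : NoiseModel ν σ R lam) (hγ : 0 ≤ γ) {A B C : Vec d →L[ℝ] Vec d}
    {κ : ℝ} (hle : ∀ v, inner ℝ v (C v) ≤ inner ℝ v (A v) - κ * inner ℝ v (B v)) (n : ℕ) :
    ∀ v, inner ℝ v ((transfer ν γ)^[n] C v) ≤
      inner ℝ v ((transfer ν γ)^[n] A v) - κ * inner ℝ v ((transfer ν γ)^[n] B v) := by
  induction n with
  | zero => simpa using hle
  | succ n ih =>
    intro v
    simp only [Function.iterate_succ_apply', h.inner_transfer hγ]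
    rw [← integral_const_mul, ← integral_sub (h.integrable_inner_transfer hγ _ _ _)
      ((h.integrable_inner_transfer hγ _ _ _).const_mul _)]
    exact integral_mono (h.integrable_inner_transfer hγ _ _ _)
      ((h.integrable_inner_transfer hγ _ _ _).sub
        ((h.integrable_inner_transfer hγ _ _ _).const_mul _)) fun z => ih _

lemma iterate_transfer_nonneg (h : NoiseModel ν σ R lam) (hγ : 0 ≤ γ) {A : Vec d →L[ℝ] Vec d}
    (hA : ∀ v, 0 ≤ inner ℝ v (A v)) (n : ℕ) :
    ∀ v, 0 ≤ inner ℝ v ((transfer ν γ)^[n] A v) := by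
  induction n with
  | zero => simpa using hA
  | succ n ih =>
    intro v
    simp only [Function.iterate_succ_apply', h.inner_transfer hγ]
    exact integral_nonneg fun z => ih _

lemma iterate_transfer_symm (h : NoiseModel ν σ R lam) (hγ : 0 ≤ γ) {A : Vec d →L[ℝ] Vec d}
    (hA : ∀ u v, inner ℝ u (A v) = inner ℝ v (A u)) (n : ℕ) :
    ∀ u v, inner ℝ u ((transfer ν γ)^[n] A v) = inner ℝ v ((transfer ν γ)^[n] A u) := by
  induction n with
  | zero => simpa using hA
  | succ n ih =>
    intro u v
    simp only [Function.iterate_succ_apply', h.inner_transfer hγ]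
    simp only [ih]

lemma hessOp_nonneg (h : NoiseModel ν σ R lam) (v : Vec d) : 0 ≤ inner ℝ v (hessOp ν v) := by
  rw [h.inner_hessOp_self]
  exact integral_nonneg fun z => sq_nonneg _

lemma transfer_one_le_contract (h : NoiseModel ν σ R lam) (hγ : 0 ≤ γ)
    (hγR : 0 ≤ 2 - γ * R ^ 2) (v : Vec d) :
    inner ℝ v (transfer ν γ 1 v) ≤ inner ℝ v ((1 : Vec d →L[ℝ] Vec d) v)
      - γ * (2 - γ * R ^ 2) * lam * inner ℝ v ((1 : Vec d →L[ℝ] Vec d) v) := by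
  refine (h.transfer_one_le hγ v).trans ?_
  have h1 := h.lam_le v
  rw [← h.inner_hessOp_self] at h1
  have := mul_le_mul_of_nonneg_left h1 (mul_nonneg hγ hγR)
  rw [one_apply_eq_self, real_inner_self_eq_norm_sq]
  linarith

/-- `T(I)` is nonnegative and at most `(1 - ξ) I`; testing on a unit vector, which exists as `d ≥
1`, forces `ξ ≤ 1`. -/
lemma contraction_le_one (h : NoiseModel ν σ R lam) (hd : 1 ≤ d) (hγ : 0 ≤ γ)
    (hγR : 0 ≤ 2 - γ * R ^ 2) : γ * (2 - γ * R ^ 2) * lam ≤ 1 := by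
  have : NeZero d := ⟨by omega⟩
  let v : Vec d := EuclideanSpace.single 0 1
  have hv : inner ℝ v ((1 : Vec d →L[ℝ] Vec d) v) = 1 := by simp [v]
  have h1 := h.transfer_one_le_contract hγ hγR v
  have h2 := h.iterate_transfer_nonneg hγ (A := 1)
    (fun v => by simp) 1 v
  simp only [Function.iterate_one] at h2
  rw [hv] at h1
  linarith

lemma iterate_transfer_one_le (h : NoiseModel ν σ R lam) (hd : 1 ≤ d) (hγ : 0 ≤ γ)
    (hγR : 0 ≤ 2 - γ * R ^ 2) (n : ℕ) (v : Vec d) :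
    inner ℝ v ((transfer ν γ)^[n] 1 v)
      ≤ (1 - γ * (2 - γ * R ^ 2) * lam) ^ n * ‖v‖ ^ 2 := by
  induction n with
  | zero => simp
  | succ n ih =>
    have h1 := h.iterate_transfer_le hγ (h.transfer_one_le_contract hγ hγR) n v
    rw [← Function.iterate_succ_apply] at h1
    have h2 := mul_le_mul_of_nonneg_left ih
      (sub_nonneg.2 (h.contraction_le_one hd hγ hγR))
    rw [pow_succ']
    linarith

/-- Applying `T^a` to `κH ≼ I - T(I)` makes the sum telescope to at most `T^s(I) - T^n(I)`; the last
term is dropped by positivity. The bound does not grow with the length of the sum. -/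
lemma sum_iterate_transfer_hess_le (h : NoiseModel ν σ R lam) (hd : 1 ≤ d) (hγ : 0 ≤ γ)
    (hγR : 0 ≤ 2 - γ * R ^ 2) {s n : ℕ} (hsn : s ≤ n) (v : Vec d) :
    γ * (2 - γ * R ^ 2) * ∑ a ∈ Finset.Ico s n, inner ℝ v ((transfer ν γ)^[a] (hessOp ν) v)
      ≤ (1 - γ * (2 - γ * R ^ 2) * lam) ^ s * ‖v‖ ^ 2 := by
  have key : γ * (2 - γ * R ^ 2) *
      ∑ a ∈ Finset.Ico s n, inner ℝ v ((transfer ν γ)^[a] (hessOp ν) v)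
      ≤ inner ℝ v ((transfer ν γ)^[s] 1 v) - inner ℝ v ((transfer ν γ)^[n] 1 v) := by
    induction n, hsn using Nat.le_induction with
    | base => simp
    | succ n hn ih =>
      have h1 := h.iterate_transfer_le (A := 1) hγ (h.transfer_one_le hγ) n v
      rw [← Function.iterate_succ_apply] at h1
      rw [Finset.sum_Ico_succ_top hn, mul_add]
      linarith
  have h2 := h.iterate_transfer_nonneg hγ (A := 1) (fun v => by simp) n v
  linarith [h.iterate_transfer_one_le hd hγ hγR s v]

end NoiseModel

end Transfer

/-! ### Expected quadratic forms and traces -/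

section Trace

variable {d : ℕ} {Ω : Type*} [MeasurableSpace Ω] {P : Measure Ω}

/-- The trace of a quadratic form. -/
noncomputable def formTrace (A : Vec d →L[ℝ] Vec d) : ℝ :=
  ∑ i, inner ℝ (EuclideanSpace.basisFun (Fin d) ℝ i) (A (EuclideanSpace.basisFun (Fin d) ℝ i))

lemma integrable_inner_of_memLp {U V : Ω → Vec d} (hU : MemLp U 2 P) (hV : MemLp V 2 P) :
    Integrable (fun ω => inner ℝ (U ω) (V ω)) P := by
  refine (hU.norm.integrable_mul hV.norm).mono (hU.1.inner hV.1)
    (Filter.Eventually.of_forall fun ω => ?_)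
  simpa using abs_real_inner_le_norm (U ω) (V ω)

lemma integrable_inner_clm {U V : Ω → Vec d} (A : Vec d →L[ℝ] Vec d) (hU : MemLp U 2 P)
    (hV : MemLp V 2 P) : Integrable (fun ω => inner ℝ (U ω) (A (V ω))) P :=
  integrable_inner_of_memLp hU (A.comp_memLp' hV)

lemma integrable_inner_const_sq {W : Ω → Vec d} (hW : MemLp W 2 P) (u : Vec d) :
    Integrable (fun ω => inner ℝ u (W ω) ^ 2) P := by
  have := ((innerSL ℝ u).comp_memLp' hW).integrable_sq
  simpa using this

/-- If the second moment matrix of `W` is at most `a I`, then `E(Wᵀ A W) ≤ a tr A`. -/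
lemma integral_form_le_trace {A : Vec d →L[ℝ] Vec d} (hs : ∀ u v, inner ℝ u (A v) = inner ℝ v (A u))
    (hA : ∀ v, 0 ≤ inner ℝ v (A v)) {W : Ω → Vec d} (hW : MemLp W 2 P) {a : ℝ}
    (ha : ∀ u, ∫ ω, inner ℝ u (W ω) ^ 2 ∂P ≤ a * ‖u‖ ^ 2) :
    ∫ ω, inner ℝ (W ω) (A (W ω)) ∂P ≤ a * formTrace A := by
  have hT : (A : Vec d →ₗ[ℝ] Vec d).IsSymmetric := fun u v => by
    simp only [ContinuousLinearMap.coe_coe]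
    rw [real_inner_comm, hs]
  have hn : Module.finrank ℝ (Vec d) = d := by simp
  -- In an eigenbasis of `A` the form is a combination of squared coordinates with nonnegative
  -- weights, so the second moment bound applies to each coordinate separately.
  set b := hT.eigenvectorBasis hn
  set μ := hT.eigenvalues hn
  have hb : ∀ i, A (b i) = μ i • b i := fun i => hT.apply_eigenvectorBasis hn i
  have hμ : ∀ i, inner ℝ (b i) (A (b i)) = μ i := fun i => by
    rw [hb, inner_smul_right, real_inner_self_eq_norm_sq, b.norm_eq_one]; simp
  have e : ∀ w, inner ℝ w (A w) = ∑ i, μ i * inner ℝ (b i) w ^ 2 := fun w => by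
    rw [← b.sum_inner_mul_inner]
    refine Finset.sum_congr rfl fun i _ => ?_
    rw [hs, hb, inner_smul_right, real_inner_comm w]; ring
  have htr : formTrace A = ∑ i, μ i := by
    have h1 := LinearMap.trace_eq_sum_inner (A : Vec d →ₗ[ℝ] Vec d)
      (EuclideanSpace.basisFun (Fin d) ℝ)
    rw [LinearMap.trace_eq_sum_inner _ b] at h1
    simp only [ContinuousLinearMap.coe_coe, hμ] at h1
    exact h1.symm
  simp only [e]
  rw [integral_finsetSum _ fun i _ => (integrable_inner_const_sq hW _).const_mul _, htr,
    Finset.mul_sum]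
  refine Finset.sum_le_sum fun i _ => ?_
  rw [integral_const_mul, mul_comm a]
  refine mul_le_mul_of_nonneg_left ?_ (hμ i ▸ hA (b i))
  simpa [b.norm_eq_one] using ha (b i)

end Trace

/-! ### Integrating out one of two independent variables -/

section Independence

variable {Ω 𝒳 𝒴 : Type*} [MeasurableSpace Ω] [MeasurableSpace 𝒳] [MeasurableSpace 𝒴]
  {P : Measure Ω} [IsFiniteMeasure P]

lemma integral_indep_left {X : Ω → 𝒳} {Y : Ω → 𝒴} (hXY : IndepFun X Y P) (hX : Measurable X)
    (hY : Measurable Y) {f : 𝒳 × 𝒴 → ℝ} (hf : Measurable f)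
    (hi : Integrable (fun ω => f (X ω, Y ω)) P) :
    ∫ ω, f (X ω, Y ω) ∂P = ∫ ω, ∫ y, f (X ω, y) ∂(P.map Y) ∂P := by
  have hmap := (indepFun_iff_map_prod_eq_prod_map_map hX.aemeasurable hY.aemeasurable).1 hXY
  have hXYm : Measurable fun ω => (X ω, Y ω) := hX.prodMk hY
  have hi' : Integrable f ((P.map X).prod (P.map Y)) := by
    rw [← hmap, integrable_map_measure hf.aestronglyMeasurable hXYm.aemeasurable]
    exact hi
  rw [← integral_map hXYm.aemeasurable (f := f) hf.aestronglyMeasurable, hmap,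
    integral_prod _ hi', integral_map hX.aemeasurable]
  exact (hf.stronglyMeasurable.integral_prod_right' (ν := P.map Y)).aestronglyMeasurable

lemma integral_indep_right {X : Ω → 𝒳} {Y : Ω → 𝒴} (hXY : IndepFun X Y P) (hX : Measurable X)
    (hY : Measurable Y) {f : 𝒳 × 𝒴 → ℝ} (hf : Measurable f)
    (hi : Integrable (fun ω => f (X ω, Y ω)) P) :
    Integrable (fun y => ∫ ω, f (X ω, y) ∂P) (P.map Y) ∧
    ∫ ω, f (X ω, Y ω) ∂P = ∫ y, ∫ ω, f (X ω, y) ∂P ∂(P.map Y) := by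
  have hmap := (indepFun_iff_map_prod_eq_prod_map_map hX.aemeasurable hY.aemeasurable).1 hXY
  have hXYm : Measurable fun ω => (X ω, Y ω) := hX.prodMk hY
  have hi' : Integrable f ((P.map X).prod (P.map Y)) := by
    rw [← hmap, integrable_map_measure hf.aestronglyMeasurable hXYm.aemeasurable]
    exact hi
  have e : ∀ y, ∫ x, f (x, y) ∂(P.map X) = ∫ ω, f (X ω, y) ∂P := fun y =>
    integral_map hX.aemeasurable
      (hf.comp (measurable_id.prodMk measurable_const)).aestronglyMeasurable
  refine ⟨?_, ?_⟩
  · simpa only [e] using hi'.integral_prod_right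
  · rw [← integral_map hXYm.aemeasurable (f := f) hf.aestronglyMeasurable, hmap,
      integral_prod_symm _ hi']
    simp only [e]

end Independence

/-- Independent samples `u_t`, `t ∈ ℤ`, with common law `ν`. -/
structure IsSample {d : ℕ} {Ω : Type*} [MeasurableSpace Ω] (P : Measure Ω)
    (ν : Measure (Vec d × ℝ)) (u : ℤ → Ω → Vec d × ℝ) : Prop where
  meas : ∀ t, Measurable (u t)
  law : ∀ t, P.map (u t) = ν
  indep : iIndepFun u P

/-! ### The recursion driven by independent samples -/

section Chain

variable {d : ℕ} {Ω : Type*} [MeasurableSpace Ω] {P : Measure Ω}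
  {ν : Measure (Vec d × ℝ)} {u : ℤ → Ω → Vec d × ℝ} {σ R lam γ : ℝ}

/-- The σ-algebra generated by the samples before time `t`. -/
@[reducible]
def past (u : ℤ → Ω → Vec d × ℝ) (t : ℤ) : MeasurableSpace Ω :=
  ⨆ j ∈ Set.Iio t, MeasurableSpace.comap (u j) inferInstance

lemma past_mono {s t : ℤ} (hst : s ≤ t) : past u s ≤ past u t :=
  biSup_mono fun _ hj => lt_of_lt_of_le hj hst

lemma measurable_past_of_lt {s t : ℤ} (hst : s < t) : Measurable[past u t] (u s) := by
  have h : MeasurableSpace.comap (u s) inferInstance ≤ past u t :=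
    le_biSup (fun j => MeasurableSpace.comap (u j) inferInstance) (Set.mem_Iio.2 hst)
  exact (comap_measurable (u s)).mono h le_rfl

lemma IsSample.past_le (hu : IsSample P ν u) (t : ℤ) : past u t ≤ ‹MeasurableSpace Ω› :=
  iSup₂_le fun j _ => (hu.meas j).comap_le

lemma IsSample.indepFun_past (hu : IsSample P ν u) {t : ℤ} {𝒳 : Type*} [MeasurableSpace 𝒳]
    {Z : Ω → 𝒳} (hZ : Measurable[past u t] Z) : IndepFun Z (u t) P := by
  have h := indep_iSup_of_disjoint (fun i => (hu.meas i).comap_le) hu.indep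
    (S := Set.Iio t) (T := {t}) (by simp)
  rw [IndepFun_iff_Indep]
  refine indep_of_indep_of_le_right (indep_of_indep_of_le_left h hZ.comap_le) ?_
  simp

/-- A square integrable random vector that is a function of the samples before time `t`. -/
structure PastL2 (P : Measure Ω) (u : ℤ → Ω → Vec d × ℝ) (t : ℤ) (Z : Ω → Vec d) : Prop where
  meas : Measurable[past u t] Z
  memLp : MemLp Z 2 P

lemma PastL2.mono {s t : ℤ} {Z : Ω → Vec d} (h : PastL2 P u s Z) (hst : s ≤ t) : PastL2 P u t Z :=
  ⟨h.meas.mono (past_mono hst) le_rfl, h.memLp⟩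

lemma PastL2.add {t : ℤ} {Y Z : Ω → Vec d} (hY : PastL2 P u t Y) (hZ : PastL2 P u t Z) :
    PastL2 P u t (fun ω => Y ω + Z ω) :=
  ⟨hY.meas.add hZ.meas, hY.memLp.add hZ.memLp⟩

lemma PastL2.sub {t : ℤ} {Y Z : Ω → Vec d} (hY : PastL2 P u t Y) (hZ : PastL2 P u t Z) :
    PastL2 P u t (fun ω => Y ω - Z ω) :=
  ⟨hY.meas.sub hZ.meas, hY.memLp.sub hZ.memLp⟩

lemma PastL2.const [IsFiniteMeasure P] {t : ℤ} (v : Vec d) : PastL2 P u t fun _ => v :=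
  ⟨measurable_const, memLp_const v⟩

lemma measurable_shrink (γ : ℝ) :
    Measurable fun p : Vec d × (Vec d × ℝ) => shrink γ p.2.1 p.1 := by
  simp only [shrink_apply]; fun_prop

lemma measurable_shrink_comp {α : Type*} {mα : MeasurableSpace α} (γ : ℝ) {f : α → Vec d}
    {g : α → Vec d × ℝ} (hf : Measurable f) (hg : Measurable g) :
    Measurable fun a => shrink γ (g a).1 (f a) := by
  simp only [shrink_apply]; fun_prop

namespace IsSample

variable [IsProbabilityMeasure P]

lemma integral_past (hu : IsSample P ν u) {t : ℤ} {𝒳 : Type*} [MeasurableSpace 𝒳]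
    {Z : Ω → 𝒳} (hZ : Measurable[past u t] Z) {f : 𝒳 × (Vec d × ℝ) → ℝ} (hf : Measurable f)
    (hi : Integrable (fun ω => f (Z ω, u t ω)) P) :
    ∫ ω, f (Z ω, u t ω) ∂P = ∫ ω, ∫ z, f (Z ω, z) ∂ν ∂P := by
  rw [integral_indep_left (hu.indepFun_past hZ) (hZ.mono (hu.past_le t) le_rfl) (hu.meas t) hf hi,
    hu.law]

lemma comp_integrable (hu : IsSample P ν u) (t : ℤ) {f : Vec d × ℝ → ℝ} (hf : Integrable f ν) :
    Integrable (fun ω => f (u t ω)) P := by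
  rw [← hu.law t] at hf
  exact hf.comp_measurable (hu.meas t)

/-- Square integrability survives a step because the random operator norm, square integrable by the
fourth moment assumption, is independent of the current state. -/
lemma pastL2_shrink (hu : IsSample P ν u) (h : NoiseModel ν σ R lam) (hγ : 0 ≤ γ) {t : ℤ}
    {Z : Ω → Vec d} (hZ : PastL2 P u t Z) :
    PastL2 P u (t + 1) fun ω => shrink γ (u t ω).1 (Z ω) := by
  have hm : Measurable[past u (t + 1)] fun ω => shrink γ (u t ω).1 (Z ω) := by
    have h1 : Measurable[past u (t + 1)] Z := (hZ.mono (by omega : t ≤ t + 1)).meas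
    have h2 : Measurable[past u (t + 1)] (u t) := measurable_past_of_lt (by omega)
    exact measurable_shrink_comp γ h1 h2
  have hm' := (hm.mono (hu.past_le _) le_rfl).aestronglyMeasurable (μ := P)
  refine ⟨hm, (memLp_two_iff_integrable_sq_norm hm').2 ?_⟩
  have hind := (hu.indepFun_past hZ.meas).symm.comp
    (φ := fun z : Vec d × ℝ => (1 + γ * ‖z.1‖ ^ 2) ^ 2) (ψ := fun z : Vec d => ‖z‖ ^ 2)
    (by fun_prop) (by fun_prop)
  have hint := hind.integrable_mul (hu.comp_integrable t (h.integrable_one_add_sq_sq γ))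
    ((memLp_two_iff_integrable_sq_norm hZ.memLp.1).1 hZ.memLp)
  refine hint.mono' (hm'.norm.pow 2) (Filter.Eventually.of_forall fun ω => ?_)
  rw [Real.norm_of_nonneg (by positivity)]
  simp only [Pi.mul_apply, Function.comp_apply]
  rw [← mul_pow]
  exact pow_le_pow_left₀ (norm_nonneg _)
    ((shrink γ (u t ω).1).le_of_opNorm_le (norm_shrink_le hγ _) _) 2

lemma pastL2_noise (hu : IsSample P ν u) (h : NoiseModel ν σ R lam) (γ : ℝ) (t : ℤ) :
    PastL2 P u (t + 1) fun ω => γ • ((u t ω).2 • (u t ω).1) := by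
  have hm : Measurable[past u (t + 1)] (u t) := measurable_past_of_lt (by omega)
  have hc : Measurable fun z : Vec d × ℝ => γ • (z.2 • z.1) := by fun_prop
  refine ⟨hc.comp hm, ?_⟩
  have := h.memLp_noise
  rw [← hu.law t] at this
  exact (this.comp_of_map (hu.meas t).aemeasurable).const_smul γ

lemma pastL2_step (hu : IsSample P ν u) (h : NoiseModel ν σ R lam) (hγ : 0 ≤ γ) {t : ℤ}
    {Z : Ω → Vec d} (hZ : PastL2 P u t Z) :
    PastL2 P u (t + 1) fun ω => shrink γ (u t ω).1 (Z ω) + γ • ((u t ω).2 • (u t ω).1) :=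
  (hu.pastL2_shrink h hγ hZ).add (hu.pastL2_noise h γ t)

lemma integral_form_shrink (hu : IsSample P ν u) (h : NoiseModel ν σ R lam) (hγ : 0 ≤ γ) {t : ℤ}
    {Z : Ω → Vec d} (hZ : PastL2 P u t Z) (A : Vec d →L[ℝ] Vec d) :
    ∫ ω, inner ℝ (shrink γ (u t ω).1 (Z ω)) (A (shrink γ (u t ω).1 (Z ω))) ∂P
      = ∫ ω, inner ℝ (Z ω) (transfer ν γ A (Z ω)) ∂P := by
  have hs := hu.pastL2_shrink h hγ hZ
  simp only [h.inner_transfer hγ]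
  exact hu.integral_past hZ.meas
    (f := fun p => inner ℝ (shrink γ p.2.1 p.1) (A (shrink γ p.2.1 p.1)))
    ((measurable_shrink γ).inner (A.measurable.comp (measurable_shrink γ)))
    (integrable_inner_clm A hs.memLp hs.memLp)

/-- Both vectors depend on the past only, so the fresh sample may be averaged first: the noise drops
out by `orth`, and `xxᵀ` becomes the Hessian. Conditional centring of the residual given `x` is not
needed. -/
lemma integral_inner_step (hu : IsSample P ν u) (h : NoiseModel ν σ R lam) (hγ : 0 ≤ γ) {t : ℤ}
    {Y Z : Ω → Vec d} (hY : PastL2 P u t Y) (hZ : PastL2 P u t Z) :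
    ∫ ω, inner ℝ (Y ω) (shrink γ (u t ω).1 (Z ω) + γ • ((u t ω).2 • (u t ω).1)) ∂P
      = ∫ ω, inner ℝ (Y ω) (Z ω) ∂P - γ * ∫ ω, inner ℝ (Y ω) (hessOp ν (Z ω)) ∂P := by
  have := h.prob
  have hs := hu.pastL2_step h hγ hZ
  rw [hu.integral_past (Z := fun ω => (Y ω, Z ω)) (hY.meas.prodMk hZ.meas)
    (f := fun p => inner ℝ p.1.1 (shrink γ p.2.1 p.1.2 + γ • (p.2.2 • p.2.1))) (by
      have h1 : Measurable fun p : (Vec d × Vec d) × (Vec d × ℝ) => shrink γ p.2.1 p.1.2 := by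
        simp only [shrink_apply]; fun_prop
      fun_prop)
    (integrable_inner_of_memLp hY.memLp hs.memLp), ← integral_const_mul,
    ← integral_sub (integrable_inner_of_memLp hY.memLp hZ.memLp)
      ((integrable_inner_clm _ hY.memLp hZ.memLp).const_mul γ)]
  refine integral_congr_ae (Filter.Eventually.of_forall fun ω => ?_)
  simp only
  have e : ∀ z : Vec d × ℝ, inner ℝ (Y ω) (shrink γ z.1 (Z ω) + γ • (z.2 • z.1))
      = inner ℝ (Y ω) (Z ω) - γ * inner ℝ (Y ω) (inner ℝ z.1 (Z ω) • z.1)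
        + γ * (z.2 * inner ℝ z.1 (Y ω)) := fun z => by
    simp only [shrink_apply, inner_add_right, inner_sub_right, inner_smul_right,
      real_inner_comm (Y ω) z.1]
    ring
  have hi := (h.integrable_inner_smul (Z ω)).const_inner (𝕜 := ℝ) (Y ω)
  simp only [e]
  rw [integral_add, integral_sub, integral_const_mul, integral_const_mul, h.orth,
    integral_inner (h.integrable_inner_smul (Z ω)), ← h.hessOp_apply]
  · simp
  · exact integrable_const _
  · exact hi.const_mul γ
  · exact (integrable_const _).sub (hi.const_mul γ)
  · exact ((h.memLp_noise_inner (Y ω)).integrable (by norm_num)).const_mul γ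

/-- Centred second moments stay below `γ σ² / (2 - γ R²) I` along the recursion. -/
lemma secondMoment_step (hu : IsSample P ν u) (h : NoiseModel ν σ R lam) (hγ : 0 < γ)
    (hγR : 0 < 2 - γ * R ^ 2) {t : ℤ} {W : Ω → Vec d} (hW : PastL2 P u t W)
    (h0 : ∀ v, ∫ ω, inner ℝ v (W ω) ∂P = 0)
    (ha : ∀ v, ∫ ω, inner ℝ v (W ω) ^ 2 ∂P ≤ γ * σ ^ 2 / (2 - γ * R ^ 2) * ‖v‖ ^ 2) (w : Vec d) :
    ∫ ω, inner ℝ w (shrink γ (u t ω).1 (W ω) + γ • ((u t ω).2 • (u t ω).1)) ^ 2 ∂P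
      ≤ γ * σ ^ 2 / (2 - γ * R ^ 2) * ‖w‖ ^ 2 := by
  have := h.prob
  set a := γ * σ ^ 2 / (2 - γ * R ^ 2) with hadef
  have hs := hu.pastL2_step h hγ.le hW
  -- The state is integrated out first, with the new sample frozen. The cross term then vanishes
  -- because `W` is centred, even though residual and regressor may be dependent.
  obtain ⟨hi, he⟩ := integral_indep_right (hu.indepFun_past hW.meas)
    (hW.meas.mono (hu.past_le t) le_rfl) (hu.meas t)
    (f := fun p => inner ℝ w (shrink γ p.2.1 p.1 + γ • (p.2.2 • p.2.1)) ^ 2) (by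
      have h1 := measurable_shrink (d := d) γ
      fun_prop) (integrable_inner_const_sq hs.memLp w)
  rw [hu.law] at hi he
  rw [he]
  have hWi : ∀ v, Integrable (fun ω => inner ℝ v (W ω)) P := fun v =>
    (hW.memLp.integrable (by norm_num)).const_inner v
  have hb : ∀ z : Vec d × ℝ,
      ∫ ω, inner ℝ w (shrink γ z.1 (W ω) + γ • (z.2 • z.1)) ^ 2 ∂P
        ≤ a * ‖shrink γ z.1 w‖ ^ 2 + γ ^ 2 * (z.2 ^ 2 * inner ℝ z.1 w ^ 2) := fun z => by
    have e : ∀ ω, inner ℝ w (shrink γ z.1 (W ω) + γ • (z.2 • z.1)) ^ 2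
        = inner ℝ (shrink γ z.1 w) (W ω) ^ 2
          + 2 * γ * z.2 * inner ℝ z.1 w * inner ℝ (shrink γ z.1 w) (W ω)
          + γ ^ 2 * (z.2 ^ 2 * inner ℝ z.1 w ^ 2) := fun ω => by
      rw [inner_add_right, ← inner_shrink, inner_smul_right, inner_smul_right,
        real_inner_comm z.1 w]
      ring
    simp only [e]
    rw [integral_add, integral_add, integral_const_mul, h0, integral_const]
    · simpa using ha (shrink γ z.1 w)
    · exact integrable_inner_const_sq hW.memLp _
    · exact (hWi _).const_mul _
    · exact (integrable_inner_const_sq hW.memLp _).add ((hWi _).const_mul _)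
    · exact integrable_const _
  have hsh := (memLp_two_iff_integrable_sq_norm (h.memLp_shrink hγ.le w).1).1
    (h.memLp_shrink hγ.le w)
  have hno := h.integrable_noise_inner_sq w
  refine (integral_mono hi ((hsh.const_mul a).add (hno.const_mul (γ ^ 2))) hb).trans ?_
  simp only [Pi.add_apply]
  rw [integral_add (hsh.const_mul a) (hno.const_mul (γ ^ 2)), integral_const_mul,
    integral_const_mul]
  have ha0 : 0 ≤ a := by positivity
  have h1 := mul_le_mul_of_nonneg_left (h.integral_norm_shrink_sq_le hγ.le w) ha0
  have h2 := mul_le_mul_of_nonneg_left (h.noise_le w) (sq_nonneg γ)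
  rw [← h.inner_hessOp_self] at h2
  -- The value of `a` is the one for which the contraction `a κ H` exactly pays for the injected
  -- noise `γ² σ² H`.
  have h3 : a * (γ * (2 - γ * R ^ 2)) = γ ^ 2 * σ ^ 2 := by
    rw [hadef]; field_simp
  have h4 : a * (γ * (2 - γ * R ^ 2) * inner ℝ w (hessOp ν w))
      = γ ^ 2 * (σ ^ 2 * inner ℝ w (hessOp ν w)) := by rw [← mul_assoc, h3]; ring
  linarith

end IsSample

/-- The state after `n` steps of the recursion started at time `m` in `v`. -/
noncomputable def chain (γ : ℝ) (u : ℤ → Ω → Vec d × ℝ) (v : Vec d) (m : ℤ) (n : ℕ) (ω : Ω) :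
    Vec d :=
  sgdSteps γ v (fun t => (u t ω).1) (fun t => (u t ω).2) m n

lemma chain_zero (v : Vec d) (m : ℤ) : chain γ u v m 0 = fun _ => v := rfl

lemma chain_succ (v : Vec d) (m : ℤ) (n : ℕ) :
    chain γ u v m (n + 1) = fun ω => shrink γ (u (m + n) ω).1 (chain γ u v m n ω)
      + γ • ((u (m + n) ω).2 • (u (m + n) ω).1) := by
  ext1 ω
  simp only [chain, sgdSteps, shrink_apply, mul_sub, sub_smul, smul_smul]
  abel

namespace IsSample

variable [IsProbabilityMeasure P]

lemma pastL2_chain (hu : IsSample P ν u) (h : NoiseModel ν σ R lam) (hγ : 0 ≤ γ) (v : Vec d)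
    (m : ℤ) (n : ℕ) : PastL2 P u (m + n) (chain γ u v m n) := by
  induction n with
  | zero => simpa [chain_zero] using PastL2.const (P := P) (u := u) (t := m) v
  | succ n ih =>
    rw [chain_succ]
    have := hu.pastL2_step h hγ ih
    rwa [add_assoc] at this

/-- The mean of the chain depends only on the number of steps. -/
lemma integral_inner_chain (hu : IsSample P ν u) (h : NoiseModel ν σ R lam) (hγ : 0 ≤ γ)
    (v : Vec d) (m : ℤ) (n : ℕ) (w : Vec d) :
    ∫ ω, inner ℝ w (chain γ u v m n ω) ∂P
      = inner ℝ w ((⇑(1 - γ • hessOp ν : Vec d →L[ℝ] Vec d))^[n] v) := by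
  induction n generalizing w with
  | zero => simp [chain_zero]
  | succ n ih =>
    have hZ := hu.pastL2_chain h hγ v m n
    have h1 := hu.integral_inner_step h hγ (PastL2.const (P := P) (u := u) w) hZ
    have e : ∀ c, inner ℝ w (hessOp ν c) = inner ℝ (hessOp ν w) c := fun c => by
      rw [h.hessOp_symm, real_inner_comm]
    rw [chain_succ, h1, Function.iterate_succ_apply', ih]
    simp only [e]
    rw [ih, ← e]
    simp [inner_sub_right, inner_smul_right]

/-- Starting in `0` isolates the noise: the mean stays `0`, which is the hypothesis that
`secondMoment_step` needs at every step. -/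
lemma integral_inner_chain_zero (hu : IsSample P ν u) (h : NoiseModel ν σ R lam) (hγ : 0 ≤ γ)
    (m : ℤ) (n : ℕ) (w : Vec d) : ∫ ω, inner ℝ w (chain γ u 0 m n ω) ∂P = 0 := by
  have h0 : ∀ n : ℕ, (⇑(1 - γ • hessOp ν : Vec d →L[ℝ] Vec d))^[n] 0 = 0 := fun n => by
    induction n with
    | zero => rfl
    | succ n ih => rw [Function.iterate_succ_apply', ih, map_zero]
  rw [hu.integral_inner_chain h hγ, h0, inner_zero_right]

lemma secondMoment_chain_zero (hu : IsSample P ν u) (h : NoiseModel ν σ R lam) (hγ : 0 < γ)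
    (hγR : 0 < 2 - γ * R ^ 2) (m : ℤ) (n : ℕ) (w : Vec d) :
    ∫ ω, inner ℝ w (chain γ u 0 m n ω) ^ 2 ∂P ≤ γ * σ ^ 2 / (2 - γ * R ^ 2) * ‖w‖ ^ 2 := by
  induction n generalizing w with
  | zero => simp only [chain_zero, inner_zero_right]; simp; positivity
  | succ n ih =>
    rw [chain_succ]
    exact hu.secondMoment_step h hγ hγR (hu.pastL2_chain h hγ.le 0 m n)
      (hu.integral_inner_chain_zero h hγ.le m n) ih w

/-- Products of gradient steps act on second moments through the iterated transfer operator. -/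
lemma integral_form_shrink_iterate (hu : IsSample P ν u) (h : NoiseModel ν σ R lam) (hγ : 0 ≤ γ)
    {m : ℤ} {D : ℕ → Ω → Vec d} (h0 : PastL2 P u m (D 0))
    (hD : ∀ n : ℕ, D (n + 1) = fun ω => shrink γ (u (m + n) ω).1 (D n ω)) (n : ℕ)
    (A : Vec d →L[ℝ] Vec d) :
    PastL2 P u (m + n) (D n) ∧ ∫ ω, inner ℝ (D n ω) (A (D n ω)) ∂P
      = ∫ ω, inner ℝ (D 0 ω) ((transfer ν γ)^[n] A (D 0 ω)) ∂P := by
  induction n generalizing A with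
  | zero => simpa using h0
  | succ n ih =>
    have hp := (ih 0).1
    rw [hD]
    refine ⟨by simpa [add_assoc] using hu.pastL2_shrink h hγ hp, ?_⟩
    rw [hu.integral_form_shrink h hγ hp, (ih _).2, Function.iterate_succ_apply]

end IsSample

end Chain

/-! ### Second moments of states, of differences of chains, and of sums of states -/

section Bounds

lemma integral_add_three {α : Type*} [MeasurableSpace α] {μ : Measure α} {f g k : α → ℝ}
    (hf : Integrable f μ) (hg : Integrable g μ) (hk : Integrable k μ) :
    ∫ a, (f a + g a + k a) ∂μ = ∫ a, f a ∂μ + ∫ a, g a ∂μ + ∫ a, k a ∂μ := by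
  have hfg : Integrable (fun a => f a + g a) μ := hf.add hg
  rw [integral_add hfg hk, integral_add hf hg]

variable {d : ℕ} {Ω : Type*} [MeasurableSpace Ω] {P : Measure Ω} [IsProbabilityMeasure P]
  {ν : Measure (Vec d × ℝ)} {u : ℤ → Ω → Vec d × ℝ} {σ R lam γ : ℝ}

lemma formTrace_one : formTrace (1 : Vec d →L[ℝ] Vec d) = d := by
  simp [formTrace]

namespace NoiseModel

lemma form_add_sub_le (h : NoiseModel ν σ R lam) (p q r : Vec d) :
    inner ℝ (p - q + r) (hessOp ν (p - q + r)) ≤ 3 * (inner ℝ p (hessOp ν p)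
      + inner ℝ q (hessOp ν q) + inner ℝ r (hessOp ν r)) := by
  simp only [h.inner_hessOp_self]
  rw [← integral_add_three (h.integrable_inner_sq p) (h.integrable_inner_sq q)
    (h.integrable_inner_sq r), ← integral_const_mul]
  refine integral_mono (h.integrable_inner_sq _)
    ((((h.integrable_inner_sq p).add (h.integrable_inner_sq q)).add
      (h.integrable_inner_sq r)).const_mul 3) fun z => ?_
  simp only [inner_add_right, inner_sub_right]
  nlinarith [sq_nonneg (inner ℝ z.1 p + inner ℝ z.1 q), sq_nonneg (inner ℝ z.1 p - inner ℝ z.1 r),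
    sq_nonneg (inner ℝ z.1 q + inner ℝ z.1 r)]

/-- Bound on the sum of traces of the propagated Hessian forms. -/
lemma sum_formTrace_le (h : NoiseModel ν σ R lam) (hd : 1 ≤ d) (hγ : 0 ≤ γ)
    (hγR : 0 ≤ 2 - γ * R ^ 2) {s n : ℕ} (hsn : s ≤ n) :
    γ * (2 - γ * R ^ 2) * ∑ a ∈ Finset.Ico s n, formTrace ((transfer ν γ)^[a] (hessOp ν))
      ≤ (1 - γ * (2 - γ * R ^ 2) * lam) ^ s * d := by
  simp only [formTrace]
  rw [Finset.sum_comm, Finset.mul_sum]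
  refine (Finset.sum_le_sum fun i _ => h.sum_iterate_transfer_hess_le hd hγ hγR hsn _).trans ?_
  simp [mul_comm]

end NoiseModel

namespace IsSample

/-- On common samples the noise terms cancel, so the difference of the two chains obeys the
noise-free recursion started in `v`. -/
lemma integral_form_chain_diff (hu : IsSample P ν u) (h : NoiseModel ν σ R lam) (hγ : 0 ≤ γ)
    (v : Vec d) (m : ℤ) (n : ℕ) (A : Vec d →L[ℝ] Vec d) :
    ∫ ω, inner ℝ (chain γ u v m n ω - chain γ u 0 m n ω)
        (A (chain γ u v m n ω - chain γ u 0 m n ω)) ∂P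
      = inner ℝ v ((transfer ν γ)^[n] A v) := by
  have := (hu.integral_form_shrink_iterate h hγ (m := m)
    (D := fun n ω => chain γ u v m n ω - chain γ u 0 m n ω)
    (by simpa [chain_zero] using PastL2.const (P := P) (u := u) (t := m) v)
    (fun n => by ext1 ω; simp only [chain_succ, map_sub]; abel) n A).2
  rw [this]
  simp [chain_zero]

lemma integral_norm_chain_sq_le (hu : IsSample P ν u) (h : NoiseModel ν σ R lam) (hd : 1 ≤ d)
    (hγ : 0 < γ) (hγR : 0 < 2 - γ * R ^ 2) (hlam : 0 ≤ lam) (v : Vec d) (m : ℤ) (n : ℕ) :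
    ∫ ω, ‖chain γ u v m n ω‖ ^ 2 ∂P
      ≤ 2 * (‖v‖ ^ 2 + γ * σ ^ 2 / (2 - γ * R ^ 2) * d) := by
  have hv := (hu.pastL2_chain h hγ.le v m n).memLp
  have h0 := (hu.pastL2_chain h hγ.le 0 m n).memLp
  have hD := hv.sub h0
  have h1 := hu.integral_form_chain_diff h hγ.le v m n 1
  have h2 := integral_form_le_trace (A := 1) (fun u v => real_inner_comm _ _) (fun v => by simp)
    h0 (hu.secondMoment_chain_zero h hγ hγR m n)
  have h3 := h.iterate_transfer_one_le hd hγ.le hγR.le n v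
  have hx := sub_nonneg.2 (h.contraction_le_one hd hγ.le hγR.le)
  have hy : 0 ≤ γ * (2 - γ * R ^ 2) * lam := by positivity
  have h4 := mul_le_mul_of_nonneg_right (pow_le_one₀ hx (by linarith) (n := n)) (sq_nonneg ‖v‖)
  simp only [one_apply_eq_self, real_inner_self_eq_norm_sq] at h1 h2
  rw [formTrace_one] at h2
  have i1 : Integrable (fun ω => ‖chain γ u v m n ω - chain γ u 0 m n ω‖ ^ 2) P :=
    (memLp_two_iff_integrable_sq_norm hD.1).1 hD
  have i2 := (memLp_two_iff_integrable_sq_norm h0.1).1 h0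
  have h5 : ∫ ω, ‖chain γ u v m n ω‖ ^ 2 ∂P
      ≤ ∫ ω, (2 * ‖chain γ u v m n ω - chain γ u 0 m n ω‖ ^ 2
        + 2 * ‖chain γ u 0 m n ω‖ ^ 2) ∂P := by
    refine integral_mono ((memLp_two_iff_integrable_sq_norm hv.1).1 hv)
      ((i1.const_mul 2).add (i2.const_mul 2)) fun ω => ?_
    have e := parallelogram_law_with_norm ℝ (chain γ u v m n ω - chain γ u 0 m n ω)
      (chain γ u 0 m n ω)
    simp only [sub_add_cancel] at e
    nlinarith [sq_nonneg ‖chain γ u v m n ω - chain γ u 0 m n ω - chain γ u 0 m n ω‖]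
  rw [integral_add (i1.const_mul 2) (i2.const_mul 2), integral_const_mul, integral_const_mul] at h5
  linarith

/-- The second moment of the difference of two chains run on the same samples up to time `0`. -/
lemma integral_form_level_le (hu : IsSample P ν u) (h : NoiseModel ν σ R lam)
    (hγ : 0 < γ) (hγR : 0 < 2 - γ * R ^ 2) (v : Vec d) {a b : ℕ} (hab : a ≤ b) :
    ∫ ω, inner ℝ (chain γ u v (-(b : ℤ)) b ω - chain γ u v (-(a : ℤ)) a ω)
        (hessOp ν (chain γ u v (-(b : ℤ)) b ω - chain γ u v (-(a : ℤ)) a ω)) ∂P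
      ≤ 3 * (inner ℝ v ((transfer ν γ)^[b] (hessOp ν) v)
        + inner ℝ v ((transfer ν γ)^[a] (hessOp ν) v)
        + γ * σ ^ 2 / (2 - γ * R ^ 2) * formTrace ((transfer ν γ)^[a] (hessOp ν))) := by
  have hm := fun w m n => (hu.pastL2_chain h hγ.le w m n).memLp
  -- `p` and `q` carry the influence of the initial value in the two chains, and `r` compares their
  -- pure noise parts; the difference of the chains is `p - q + r`.
  set p := fun ω => chain γ u v (-(b : ℤ)) b ω - chain γ u 0 (-(b : ℤ)) b ω with hp
  set q := fun ω => chain γ u v (-(a : ℤ)) a ω - chain γ u 0 (-(a : ℤ)) a ω with hq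
  set r := fun ω => chain γ u 0 (-(b : ℤ)) b ω - chain γ u 0 (-(a : ℤ)) a ω with hr
  have pm : MemLp p 2 P := (hm _ _ _).sub (hm _ _ _)
  have qm : MemLp q 2 P := (hm _ _ _).sub (hm _ _ _)
  have rm : MemLp r 2 P := (hm _ _ _).sub (hm _ _ _)
  have ip := integrable_inner_clm (hessOp ν) pm pm
  have iq := integrable_inner_clm (hessOp ν) qm qm
  have ir := integrable_inner_clm (hessOp ν) rm rm
  have ep : ∫ ω, inner ℝ (p ω) (hessOp ν (p ω)) ∂P = inner ℝ v ((transfer ν γ)^[b] (hessOp ν) v) :=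
    hu.integral_form_chain_diff h hγ.le v _ b _
  have eq : ∫ ω, inner ℝ (q ω) (hessOp ν (q ω)) ∂P = inner ℝ v ((transfer ν γ)^[a] (hessOp ν) v) :=
    hu.integral_form_chain_diff h hγ.le v _ a _
  have er : ∫ ω, inner ℝ (r ω) (hessOp ν (r ω)) ∂P
      ≤ γ * σ ^ 2 / (2 - γ * R ^ 2) * formTrace ((transfer ν γ)^[a] (hessOp ν)) := by
    -- After `j = b - a` steps the older chain has reached time `-a`, where the younger one starts
    -- in `0`. From then on the samples agree, so the difference evolves without noise for `a`
    -- steps, from a vector with second moment matrix at most `a₀ I`, where `a₀ = γσ²/(2 - γR²)`.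
    obtain ⟨j, rfl⟩ := Nat.exists_eq_add_of_le hab
    have ht : ∀ n : ℕ, (-((a + j : ℕ) : ℤ) + ((j + n : ℕ) : ℤ)) = -(a : ℤ) + n := fun n => by
      push_cast; ring
    have e := (hu.integral_form_shrink_iterate h hγ.le (m := -(a : ℤ))
      (D := fun n ω => chain γ u 0 (-((a + j : ℕ) : ℤ)) (j + n) ω - chain γ u 0 (-(a : ℤ)) n ω)
      (by
        have := (hu.pastL2_chain h hγ.le 0 (-((a + j : ℕ) : ℤ)) (j + 0)).sub
          ((PastL2.const (P := P) (u := u) 0))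
        rw [ht 0] at this
        simpa [chain_zero] using this)
      (fun n => by
        ext1 ω
        rw [← add_assoc j n 1]
        simp only [chain_succ, map_sub, ht]
        abel) a (hessOp ν)).2
    simp only [Nat.add_comm j a] at e
    rw [hr]
    simp only
    rw [e]
    simp only [add_zero, chain_zero, sub_zero]
    exact integral_form_le_trace (h.iterate_transfer_symm hγ.le h.hessOp_symm a)
      (h.iterate_transfer_nonneg hγ.le h.hessOp_nonneg a) (hm _ _ _)
      (hu.secondMoment_chain_zero h hγ hγR _ _)
  have e : ∀ ω, chain γ u v (-(b : ℤ)) b ω - chain γ u v (-(a : ℤ)) a ω = p ω - q ω + r ω := by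
    intro ω; simp only [hp, hq, hr]; abel
  simp only [e]
  have hmn : ∫ ω, inner ℝ (p ω - q ω + r ω) (hessOp ν (p ω - q ω + r ω)) ∂P
      ≤ ∫ ω, 3 * (inner ℝ (p ω) (hessOp ν (p ω)) + inner ℝ (q ω) (hessOp ν (q ω))
        + inner ℝ (r ω) (hessOp ν (r ω))) ∂P :=
    integral_mono (integrable_inner_clm _ ((pm.sub qm).add rm) ((pm.sub qm).add rm))
      (((ip.add iq).add ir).const_mul 3) fun ω => h.form_add_sub_le _ _ _
  rw [integral_const_mul, integral_add_three ip iq ir, ep, eq] at hmn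
  linarith

lemma pastL2_sum_chain (hu : IsSample P ν u) (h : NoiseModel ν σ R lam) (hγ : 0 ≤ γ) (v : Vec d)
    (s n : ℕ) :
    PastL2 P u ((s + n : ℕ) : ℤ) fun ω => ∑ t ∈ Finset.Ico s (s + n), chain γ u v 0 t ω := by
  induction n with
  | zero => simpa using PastL2.const (P := P) (u := u) (t := (s : ℤ)) (0 : Vec d)
  | succ n ih =>
    rw [← add_assoc]
    simp only [Finset.sum_Ico_succ_top (Nat.le_add_right s n)]
    have hc := hu.pastL2_chain h hγ v 0 (s + n)
    rw [zero_add] at hc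
    exact (ih.add hc).mono (by push_cast; omega)

/-- Each summand contributes at least `-S`, by `⟨a, b⟩ ≥ -(‖a‖² + ‖b‖²)/2`. -/
lemma integral_inner_sum_chain_ge (hu : IsSample P ν u) (h : NoiseModel ν σ R lam) (hγ : 0 ≤ γ)
    (v : Vec d) {S : ℝ} (hS : ∀ n, ∫ ω, ‖chain γ u v 0 n ω‖ ^ 2 ∂P ≤ S) {Y : Ω → Vec d}
    (hY : MemLp Y 2 P) (hYS : ∫ ω, ‖Y ω‖ ^ 2 ∂P ≤ S) (s n : ℕ) :
    -(n * S) ≤ ∫ ω, inner ℝ (∑ t ∈ Finset.Ico s (s + n), chain γ u v 0 t ω) (Y ω) ∂P := by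
  induction n with
  | zero => simp
  | succ n ih =>
    rw [← add_assoc]
    simp only [Finset.sum_Ico_succ_top (Nat.le_add_right s n), inner_add_left]
    have hc := (hu.pastL2_chain h hγ v 0 (s + n)).memLp
    have i1 := (memLp_two_iff_integrable_sq_norm hc.1).1 hc
    have i2 := (memLp_two_iff_integrable_sq_norm hY.1).1 hY
    rw [integral_add (integrable_inner_of_memLp (hu.pastL2_sum_chain h hγ v s n).memLp hY)
      (integrable_inner_of_memLp hc hY)]
    have h1 : ∫ ω, -((1 / 2) * (‖chain γ u v 0 (s + n) ω‖ ^ 2 + ‖Y ω‖ ^ 2)) ∂P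
        ≤ ∫ ω, inner ℝ (chain γ u v 0 (s + n) ω) (Y ω) ∂P := by
      refine integral_mono ((i1.add i2).const_mul (1 / 2)).neg (integrable_inner_of_memLp hc hY)
        fun ω => ?_
      have := norm_add_sq_real (chain γ u v 0 (s + n) ω) (Y ω)
      simp only
      nlinarith [sq_nonneg ‖chain γ u v 0 (s + n) ω + Y ω‖]
    rw [integral_neg, integral_const_mul, integral_add i1 i2] at h1
    push_cast
    linarith [hS (s + n)]

/-- The sum of `n` consecutive states has second moment of order `n` in the Hessian norm. -/
lemma integral_form_sum_chain_le (hu : IsSample P ν u) (h : NoiseModel ν σ R lam) (hγ : 0 ≤ γ)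
    (v : Vec d) {S : ℝ} (hS : ∀ n, ∫ ω, ‖chain γ u v 0 n ω‖ ^ 2 ∂P ≤ S) (s n : ℕ) :
    γ * ∫ ω, inner ℝ (∑ t ∈ Finset.Ico s (s + n), chain γ u v 0 t ω)
        (hessOp ν (∑ t ∈ Finset.Ico s (s + n), chain γ u v 0 t ω)) ∂P ≤ 4 * n * S := by
  set A : ℕ → Ω → Vec d := fun n ω => ∑ t ∈ Finset.Ico s (s + n), chain γ u v 0 t ω with hA
  have hAm : ∀ n, PastL2 P u ((s + n : ℕ) : ℤ) (A n) := hu.pastL2_sum_chain h hγ v s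
  have hcm : ∀ n : ℕ, PastL2 P u (n : ℤ) (chain γ u v 0 n) := fun n => by
    simpa using hu.pastL2_chain h hγ v 0 n
  -- With the correlation of the sum with the next state included, the quantity grows by at most
  -- `2S` per step: the terms `2γ⟨A, Hβ⟩` from the square and from the mean step cancel, leaving
  -- `2‖β‖² - γ⟨β, Hβ⟩` in expectation.
  have key : ∀ n : ℕ, γ * ∫ ω, inner ℝ (A n ω) (hessOp ν (A n ω)) ∂P
      + 2 * ∫ ω, inner ℝ (A n ω) (chain γ u v 0 (s + n) ω) ∂P ≤ 2 * n * S := by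
    intro n
    induction n with
    | zero => simp [hA]
    | succ n ih =>
      have eA : A (n + 1) = fun ω => A n ω + chain γ u v 0 (s + n) ω := by
        ext1 ω
        simp only [hA]
        rw [← add_assoc, Finset.sum_Ico_succ_top (Nat.le_add_right s n)]
      set β := chain γ u v 0 (s + n) with hβ
      have a2 := (hAm n).memLp
      have b2 := (hcm (s + n)).memLp
      have e1 := hu.integral_inner_step h hγ ((hAm n).add (hcm (s + n))) (hcm (s + n))
      have e2 : ∫ ω, inner ℝ (A (n + 1) ω) (chain γ u v 0 (s + (n + 1)) ω) ∂P
          = ∫ ω, inner ℝ (A n ω + β ω) (β ω) ∂P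
            - γ * ∫ ω, inner ℝ (A n ω + β ω) (hessOp ν (β ω)) ∂P := by
        rw [← e1, eA, ← add_assoc, chain_succ]
        simp only [zero_add, hβ]
      rw [e2, eA]
      have i1 := integrable_inner_clm (hessOp ν) a2 a2
      have i2 := integrable_inner_clm (hessOp ν) a2 b2
      have i3 := integrable_inner_clm (hessOp ν) b2 b2
      have i4 := integrable_inner_of_memLp a2 b2
      have i5 := integrable_inner_of_memLp b2 b2
      have f1 : ∫ ω, inner ℝ (A n ω + β ω) (β ω) ∂P
          = ∫ ω, inner ℝ (A n ω) (β ω) ∂P + ∫ ω, inner ℝ (β ω) (β ω) ∂P := by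
        simp only [inner_add_left]
        exact integral_add i4 i5
      have f2 : ∫ ω, inner ℝ (A n ω + β ω) (hessOp ν (β ω)) ∂P
          = ∫ ω, inner ℝ (A n ω) (hessOp ν (β ω)) ∂P
            + ∫ ω, inner ℝ (β ω) (hessOp ν (β ω)) ∂P := by
        simp only [inner_add_left]
        exact integral_add i2 i3
      have f3 : ∫ ω, inner ℝ (A n ω + β ω) (hessOp ν (A n ω + β ω)) ∂P
          = ∫ ω, inner ℝ (A n ω) (hessOp ν (A n ω)) ∂P
            + 2 * ∫ ω, inner ℝ (A n ω) (hessOp ν (β ω)) ∂P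
            + ∫ ω, inner ℝ (β ω) (hessOp ν (β ω)) ∂P := by
        rw [← integral_const_mul, ← integral_add_three i1 (i2.const_mul 2) i3]
        refine integral_congr_ae (Filter.Eventually.of_forall fun ω => ?_)
        simp only [map_add, inner_add_left, inner_add_right]
        rw [h.hessOp_symm (β ω) (A n ω)]
        ring
      have f4 : 0 ≤ γ * ∫ ω, inner ℝ (β ω) (hessOp ν (β ω)) ∂P :=
        mul_nonneg hγ (integral_nonneg fun ω => h.hessOp_nonneg _)
      have f5 := hS (s + n)
      simp only [← real_inner_self_eq_norm_sq] at f5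
      rw [f1, f2, f3]
      push_cast
      linarith
  -- Removing the correlation costs another `2nS`, whence the constant `4`.
  have h1 := hu.integral_inner_sum_chain_ge h hγ v hS (hcm (s + n)).memLp (hS (s + n)) s n
  have h2 := key n
  linarith

end IsSample

end Bounds

/-! ### Expectations given an independent discrete variable -/

section Mixture

variable {Ω ι 𝒴 : Type*} [MeasurableSpace Ω] [MeasurableSpace ι] [MeasurableSpace 𝒴]
  [Countable ι] [MeasurableSingletonClass ι] {P : Measure Ω} [IsProbabilityMeasure P]
  {X : Ω → ι} {Y : Ω → 𝒴}

lemma setIntegral_fiber_indep (hXY : IndepFun X Y P) (hX : Measurable X)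
    (hY : Measurable Y) {φ : 𝒴 → ℝ} (hφ : Measurable φ) (i : ι) :
    ∫ ω in X ⁻¹' {i}, φ (Y ω) ∂P = P.real (X ⁻¹' {i}) * ∫ ω, φ (Y ω) ∂P := by
  have hm : MeasurableSet (X ⁻¹' {i}) := hX (measurableSet_singleton i)
  have h1 : IndepFun (fun ω => Set.indicator {i} (fun _ => (1 : ℝ)) (X ω)) (fun ω => φ (Y ω)) P :=
    hXY.comp (measurable_const.indicator (measurableSet_singleton i)) hφ
  have h2 := h1.integral_fun_mul_eq_mul_integral
    ((measurable_const.indicator (measurableSet_singleton i)).comp hX).aestronglyMeasurable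
    (hφ.comp hY).aestronglyMeasurable
  have e1 : ∀ ω, Set.indicator {i} (fun _ => (1 : ℝ)) (X ω)
      = Set.indicator (X ⁻¹' {i}) (fun _ => (1 : ℝ)) ω := fun ω => rfl
  have e2 : ∀ ω, Set.indicator (X ⁻¹' {i}) (fun _ => (1 : ℝ)) ω * φ (Y ω)
      = Set.indicator (X ⁻¹' {i}) (fun ω => φ (Y ω)) ω := fun ω => by
    simp [Set.indicator]
  simp only [e1, e2] at h2
  rw [integral_indicator hm, integral_indicator hm] at h2
  simpa using h2

/-- Expectation of a function whose first argument is discrete and independent of the second. -/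
lemma mixture_integral (hXY : IndepFun X Y P) (hX : Measurable X) (hY : Measurable Y)
    {g : ι → 𝒴 → ℝ} (hg : ∀ i, Measurable (g i)) (hi : ∀ i, Integrable (fun ω => g i (Y ω)) P)
    (hs : Summable fun i => P.real (X ⁻¹' {i}) * ∫ ω, |g i (Y ω)| ∂P) :
    Integrable (fun ω => g (X ω) (Y ω)) P ∧
    HasSum (fun i => P.real (X ⁻¹' {i}) * ∫ ω, g i (Y ω) ∂P) (∫ ω, g (X ω) (Y ω) ∂P) := by
  have hm : ∀ i, MeasurableSet (X ⁻¹' {i}) := fun i => hX (measurableSet_singleton i)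
  have hu : ⋃ i, X ⁻¹' {i} = Set.univ := by
    rw [← Set.preimage_iUnion, Set.iUnion_of_singleton, Set.preimage_univ]
  have hdis : Pairwise (Function.onFun Disjoint fun i => X ⁻¹' {i}) := fun i j hij =>
    Disjoint.preimage X (by simpa using hij)
  have hcongr : ∀ i, ∀ ω ∈ X ⁻¹' {i}, g (X ω) (Y ω) = g i (Y ω) := fun i ω hω => by
    rw [Set.mem_preimage, Set.mem_singleton_iff] at hω; rw [hω]
  have hint : IntegrableOn (fun ω => g (X ω) (Y ω)) (⋃ i, X ⁻¹' {i}) P := by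
    refine integrableOn_iUnion_of_summable_integral_norm (fun i => ?_) ?_
    · exact (hi i).integrableOn.congr_fun (fun ω hω => (hcongr i ω hω).symm) (hm i)
    · refine hs.congr fun i => ?_
      rw [← setIntegral_fiber_indep hXY hX hY (φ := fun y => |g i y|) (hg i).abs]
      refine setIntegral_congr_fun (hm i) fun ω hω => ?_
      simp only [hcongr i ω hω, Real.norm_eq_abs]
  have hsum := hasSum_integral_iUnion hm hdis hint
  rw [hu] at hint hsum
  rw [integrableOn_univ] at hint
  refine ⟨hint, ?_⟩
  rw [setIntegral_univ] at hsum
  have e : ∀ i, ∫ ω in X ⁻¹' {i}, g (X ω) (Y ω) ∂P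
      = P.real (X ⁻¹' {i}) * ∫ ω, g i (Y ω) ∂P := fun i =>
    (setIntegral_congr_fun (hm i) (hcongr i)).trans (setIntegral_fiber_indep hXY hX hY (hg i) i)
  simpa only [e] using hsum

lemma mixture_integral_finite (hXY : IndepFun X Y P) (hX : Measurable X) (hY : Measurable Y)
    {g : ι → 𝒴 → ℝ} (hg : ∀ i, Measurable (g i)) (hi : ∀ i, Integrable (fun ω => g i (Y ω)) P)
    {I : Finset ι} (hI : ∀ i ∉ I, P.real (X ⁻¹' {i}) = 0) :
    Integrable (fun ω => g (X ω) (Y ω)) P ∧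
    ∫ ω, g (X ω) (Y ω) ∂P = ∑ i ∈ I, P.real (X ⁻¹' {i}) * ∫ ω, g i (Y ω) ∂P := by
  obtain ⟨h1, h2⟩ := mixture_integral hXY hX hY hg hi
    (summable_of_ne_finset_zero (s := I) fun i hiI => by rw [hI i hiI, zero_mul])
  exact ⟨h1, h2.unique (hasSum_sum_of_ne_finset_zero fun i hiI => by rw [hI i hiI, zero_mul])⟩

end Mixture

/-! ### The ranges of the random starts -/

section StartRange

/-- First admissible start at level `l`. -/
def startLo (k s l : ℕ) : ℕ := if l = 0 then s else k * (2 ^ l - 1)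

/-- The range of the random start at level `l` as a finite set. -/
def startFinset (k s l : ℕ) : Finset ℕ := Finset.Ico (startLo k s l) (k * (2 ^ (l + 1) - 1))

lemma coe_startFinset (k s l : ℕ) : (startFinset k s l : Set ℕ) = startRange k s l := by
  unfold startFinset startRange startLo
  split_ifs with h
  · subst h; simp
  · simp

lemma startLo_succ (k s l : ℕ) : startLo k s (l + 1) = k * (2 ^ (l + 1) - 1) := by
  simp [startLo]

lemma le_startLo {k s l : ℕ} (hk : 2 ≤ k) (hl : 1 ≤ l) : 2 ^ l ≤ startLo k s l := by
  have h2 : 2 ≤ 2 ^ l := by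
    calc 2 = 2 ^ 1 := rfl
      _ ≤ 2 ^ l := Nat.pow_le_pow_right (by norm_num) hl
  rw [startLo, if_neg (by omega)]
  calc 2 ^ l ≤ 2 * (2 ^ l - 1) := by omega
    _ ≤ k * (2 ^ l - 1) := Nat.mul_le_mul_right _ hk

lemma startLo_le_succ {k s : ℕ} (hs : s ≤ k) (l : ℕ) : startLo k s l ≤ startLo k s (l + 1) := by
  rw [startLo_succ, startLo]
  split_ifs with h
  · subst h; simpa using hs
  · exact Nat.mul_le_mul_left _ (Nat.sub_le_sub_right
      (Nat.pow_le_pow_right (by norm_num) (by omega)) 1)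

/-- Only level `0`, shortened by the burn-in, needs the factor `1/3`; the other ranges have exactly
`k 2^l` elements. -/
lemma le_card_startFinset {k s : ℕ} (hs : s ≤ k) (hks : (k : ℝ) / 3 ≤ (k : ℝ) - s) (l : ℕ) :
    (k : ℝ) * 2 ^ l / 3 ≤ (startFinset k s l).card := by
  have hk : (0 : ℝ) ≤ k := k.cast_nonneg
  rw [startFinset, Nat.card_Ico, startLo]
  split_ifs with h
  · subst h
    simp only [zero_add, pow_one, pow_zero, mul_one]
    rw [show k * (2 - 1) = k by omega, Nat.cast_sub hs]
    exact hks
  · have h1 : k * (2 ^ (l + 1) - 1) - k * (2 ^ l - 1) = k * 2 ^ l := by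
      rw [← Nat.mul_sub]
      congr 1
      have : 1 ≤ 2 ^ l := Nat.one_le_two_pow
      rw [pow_succ]; omega
    rw [h1]; push_cast
    have : (0 : ℝ) ≤ k * 2 ^ l := by positivity
    linarith

lemma card_startFinset_succ (k s l : ℕ) : (startFinset k s (l + 1)).card = k * 2 ^ (l + 1) := by
  rw [startFinset, Nat.card_Ico, startLo_succ, ← Nat.mul_sub]
  congr 1
  have : 1 ≤ 2 ^ l := Nat.one_le_two_pow
  rw [pow_succ, pow_succ]; omega

end StartRange

/-- Random starts and level that are independent of the samples `u`. -/
structure IsLevelInput {d : ℕ} {Ω : Type*} [MeasurableSpace Ω] (P : Measure Ω)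
    (u : ℤ → Ω → Vec d × ℝ) (δ : ℝ) (k s : ℕ) (τ : ℕ → Ω → ℕ) (N : Ω → ℕ) : Prop where
  meas_τ : ∀ l, Measurable (τ l)
  meas_N : Measurable N
  law_τ : ∀ l, P.map (τ l) = uniformOn (startRange k s l)
  law_N : ∀ l, P.real {ω | N ω = l} = levelProb δ l
  indep_τ : iIndepFun τ P
  indep_u_τ : IndepFun (fun ω t => u t ω) (fun ω l => τ l ω) P
  indep_N : IndepFun N (fun ω => ((fun t => u t ω), (fun l => τ l ω))) P

/-! ### Level differences at random starts -/

section Levels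

variable {d : ℕ} {Ω : Type*} [MeasurableSpace Ω] {P : Measure Ω} [IsProbabilityMeasure P]
  {ν : Measure (Vec d × ℝ)} {u : ℤ → Ω → Vec d × ℝ} {σ R lam γ δ : ℝ} {k s : ℕ}
  {τ : ℕ → Ω → ℕ} {N : Ω → ℕ}

lemma measurable_chain {α : Type*} {mα : MeasurableSpace α} {u : ℤ → α → Vec d × ℝ}
    (hu : ∀ t, Measurable (u t)) (γ : ℝ) (v : Vec d) (m : ℤ) (n : ℕ) :
    Measurable (chain γ u v m n) := by
  induction n with
  | zero => exact measurable_const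
  | succ n ih =>
    rw [chain_succ]
    have h1 := hu (m + n)
    have h2 := measurable_shrink_comp γ ih h1
    fun_prop

/-- The difference `f_{l+1} - f_l`. -/
noncomputable def levelDiff (γ : ℝ) (u : ℤ → Ω → Vec d × ℝ) (v : Vec d) (τ : ℕ → Ω → ℕ) (l : ℕ)
    (ω : Ω) : Vec d :=
  chain γ u v (-(τ (l + 1) ω : ℤ)) (τ (l + 1) ω) ω - chain γ u v (-(τ l ω : ℤ)) (τ l ω) ω

namespace IsLevelInput

lemma real_τ (hi : IsLevelInput P u δ k s τ N) (l a : ℕ) :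
    P.real (τ l ⁻¹' {a})
      = if a ∈ startFinset k s l then ((startFinset k s l).card : ℝ)⁻¹ else 0 := by
  have h1 : P (τ l ⁻¹' {a}) = uniformOn (startFinset k s l : Set ℕ) ({a} : Finset ℕ) := by
    rw [coe_startFinset, ← hi.law_τ l, Measure.map_apply (hi.meas_τ l) (by simp)]
    simp
  rw [measureReal_def, h1, uniformOn_apply_finset]
  split_ifs with h
  · rw [Finset.inter_singleton_of_mem h]; simp
  · rw [Finset.inter_singleton_of_notMem h]; simp

lemma real_pair (hi : IsLevelInput P u δ k s τ N) (l a b : ℕ) :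
    P.real ((fun ω => (τ l ω, τ (l + 1) ω)) ⁻¹' {(a, b)})
      = P.real (τ l ⁻¹' {a}) * P.real (τ (l + 1) ⁻¹' {b}) := by
  have h := (hi.indep_τ.indepFun (show l ≠ l + 1 by omega)).measure_inter_preimage_eq_mul
    {a} {b} (measurableSet_singleton _) (measurableSet_singleton _)
  have e : (fun ω => (τ l ω, τ (l + 1) ω)) ⁻¹' {(a, b)} = τ l ⁻¹' {a} ∩ τ (l + 1) ⁻¹' {b} := by
    ext ω; simp
  rw [e, measureReal_def, h, ENNReal.toReal_mul]; rfl

lemma indep_pair (hi : IsLevelInput P u δ k s τ N) (l : ℕ) :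
    IndepFun (fun ω => (τ l ω, τ (l + 1) ω)) (fun ω t => u t ω) P :=
  (hi.indep_u_τ.comp (φ := id) (ψ := fun y : ℕ → ℕ => (y l, y (l + 1))) measurable_id
    (by fun_prop)).symm

lemma indep_single (hi : IsLevelInput P u δ k s τ N) (l : ℕ) :
    IndepFun (τ l) (fun ω t => u t ω) P :=
  (hi.indep_u_τ.comp (φ := id) (ψ := fun y : ℕ → ℕ => y l) measurable_id (by fun_prop)).symm

end IsLevelInput

/-- On the space of sample paths and starts the level difference is a fixed function of the input,
as conditioning on the independent level `N` requires. Measurability holds because there are only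
countably many starts. -/
lemma measurable_levelDiff_path (γ : ℝ) (v : Vec d) (l : ℕ) :
    Measurable fun p : (ℤ → Vec d × ℝ) × (ℕ → ℕ) =>
      levelDiff γ (fun t (p : (ℤ → Vec d × ℝ) × (ℕ → ℕ)) => p.1 t) v (fun l p => p.2 l) l p := by
  have h : ∀ l, Measurable fun p : (ℤ → Vec d × ℝ) × (ℕ → ℕ) =>
      chain γ (fun t (p : (ℤ → Vec d × ℝ) × (ℕ → ℕ)) => p.1 t) v (-(p.2 l : ℤ)) (p.2 l) p := by
    intro l
    have h1 : Measurable (Function.uncurry fun (a : ℕ) (p : (ℤ → Vec d × ℝ) × (ℕ → ℕ)) =>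
        chain γ (fun t (p : (ℤ → Vec d × ℝ) × (ℕ → ℕ)) => p.1 t) v (-(a : ℤ)) a p) :=
      measurable_from_prod_countable_right fun a => measurable_chain
        (u := fun t (p : (ℤ → Vec d × ℝ) × (ℕ → ℕ)) => p.1 t) (fun t => by fun_prop) γ v (-(a : ℤ)) a
    have h2 : Measurable fun p : (ℤ → Vec d × ℝ) × (ℕ → ℕ) => (p.2 l, p) := by fun_prop
    exact h1.comp h2
  exact (h (l + 1)).sub (h l)

/-- The mean of `f_l` is the average of the means of the chain over the range of starts. -/
lemma IsLevelInput.integral_inner_start (hi : IsLevelInput P u δ k s τ N) (hu : IsSample P ν u)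
    (h : NoiseModel ν σ R lam) (hγ : 0 ≤ γ) (v w : Vec d) (l : ℕ) :
    Integrable (fun ω => inner ℝ w (chain γ u v (-(τ l ω : ℤ)) (τ l ω) ω)) P ∧
    ∫ ω, inner ℝ w (chain γ u v (-(τ l ω : ℤ)) (τ l ω) ω) ∂P
      = ((startFinset k s l).card : ℝ)⁻¹ * ∑ a ∈ startFinset k s l,
        inner ℝ w ((⇑(1 - γ • hessOp ν : Vec d →L[ℝ] Vec d))^[a] v) := by
  have hum : Measurable fun ω t => u t ω := measurable_pi_lambda _ hu.meas
  obtain ⟨h1, h2⟩ := mixture_integral_finite (hi.indep_single l) (hi.meas_τ l) hum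
    (g := fun a y => inner ℝ w (chain γ (fun t (y : ℤ → Vec d × ℝ) => y t) v (-(a : ℤ)) a y))
    (fun a => measurable_const.inner (measurable_chain (fun t => by fun_prop) γ v _ _))
    (fun a => ((hu.pastL2_chain h hγ v _ _).memLp.integrable (by norm_num)).const_inner w)
    (I := startFinset k s l) (fun a ha => by rw [hi.real_τ, if_neg ha])
  refine ⟨h1, h2.trans ?_⟩
  rw [Finset.mul_sum]
  refine Finset.sum_congr rfl fun a ha => ?_
  rw [hi.real_τ, if_pos ha]
  congr 1
  exact hu.integral_inner_chain h hγ v (-(a : ℤ)) a w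

lemma IsLevelInput.integral_form_levelDiff (hi : IsLevelInput P u δ k s τ N) (hu : IsSample P ν u)
    (h : NoiseModel ν σ R lam) (hγ : 0 ≤ γ) (v : Vec d) (l : ℕ) :
    Integrable (fun ω => inner ℝ (levelDiff γ u v τ l ω) (hessOp ν (levelDiff γ u v τ l ω))) P ∧
    ∫ ω, inner ℝ (levelDiff γ u v τ l ω) (hessOp ν (levelDiff γ u v τ l ω)) ∂P
      = ∑ a ∈ startFinset k s l, ∑ b ∈ startFinset k s (l + 1),
        ((startFinset k s l).card : ℝ)⁻¹ * ((startFinset k s (l + 1)).card : ℝ)⁻¹ *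
        ∫ ω, inner ℝ (chain γ u v (-(b : ℤ)) b ω - chain γ u v (-(a : ℤ)) a ω)
          (hessOp ν (chain γ u v (-(b : ℤ)) b ω - chain γ u v (-(a : ℤ)) a ω)) ∂P := by
  have hum : Measurable fun ω t => u t ω := measurable_pi_lambda _ hu.meas
  have hm : ∀ a : ℕ, Measurable (chain γ (fun t (y : ℤ → Vec d × ℝ) => y t) v (-(a : ℤ)) a) :=
    fun a => measurable_chain (fun t => by fun_prop) γ v _ _
  have hL : ∀ a : ℕ, MemLp (chain γ u v (-(a : ℤ)) a) 2 P := fun a =>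
    (hu.pastL2_chain h hγ v _ _).memLp
  obtain ⟨h1, h2⟩ := mixture_integral_finite (hi.indep_pair l)
    ((hi.meas_τ l).prodMk (hi.meas_τ (l + 1))) hum
    (g := fun p y => inner ℝ (chain γ (fun t (y : ℤ → Vec d × ℝ) => y t) v (-(p.2 : ℤ)) p.2 y
        - chain γ (fun t (y : ℤ → Vec d × ℝ) => y t) v (-(p.1 : ℤ)) p.1 y)
      (hessOp ν (chain γ (fun t (y : ℤ → Vec d × ℝ) => y t) v (-(p.2 : ℤ)) p.2 y
        - chain γ (fun t (y : ℤ → Vec d × ℝ) => y t) v (-(p.1 : ℤ)) p.1 y)))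
    (fun p => ((hm _).sub (hm _)).inner ((hessOp ν).measurable.comp ((hm _).sub (hm _))))
    (fun p => integrable_inner_clm (hessOp ν) ((hL p.2).sub (hL p.1)) ((hL p.2).sub (hL p.1)))
    (I := startFinset k s l ×ˢ startFinset k s (l + 1)) (by
      rintro ⟨a, b⟩ hab
      rw [hi.real_pair, hi.real_τ, hi.real_τ]
      rw [Finset.mem_product, not_and_or] at hab
      rcases hab with hab | hab
      · rw [if_neg hab, zero_mul]
      · rw [if_neg hab, mul_zero])
  refine ⟨h1, h2.trans ?_⟩
  rw [Finset.sum_product]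
  refine Finset.sum_congr rfl fun a ha => Finset.sum_congr rfl fun b hb => ?_
  rw [hi.real_pair, hi.real_τ, hi.real_τ, if_pos ha, if_pos hb]
  rfl

end Levels

/-! ### The level probabilities and the weighted series -/

section Weights

lemma two_le_log_ratio {δ α ξ : ℝ} (hδ : 1 < δ) (hα : 0 < α) (hα' : α ≤ 1 / 2) (hξ : 0 < ξ)
    (hξ' : ξ ≤ 1) : 2 ≤ Real.log ((4 * δ + 8) / (α * ξ)) := by
  have h1 : α * ξ ≤ 1 / 2 := by nlinarith
  have h2 : (24 : ℝ) ≤ (4 * δ + 8) / (α * ξ) := by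
    rw [le_div_iff₀ (by positivity)]; linarith
  rw [Real.le_log_iff_exp_le (by linarith)]
  have h3 : Real.exp 2 = Real.exp 1 * Real.exp 1 := by rw [← Real.exp_add]; norm_num
  have h4 := Real.exp_one_lt_d9
  have h5 := Real.exp_pos 1
  rw [h3]
  nlinarith

/-- Beyond the level `2 ln ((4δ + 8) / (αξ))` the weights decay geometrically. -/
lemma weight_tail {δ α ξ : ℝ} (hδ : 1 < δ) (hα : 0 < α) (hα' : α ≤ 1 / 2) (hξ : 0 < ξ)
    (hξ' : ξ ≤ 1) {l e : ℕ} (hle : 2 ^ l ≤ e)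
    (hl : 2 * Real.log ((4 * δ + 8) / (α * ξ)) < (l : ℝ) + 1) :
    ((l : ℝ) + 1) ^ δ * (1 - ξ) ^ e ≤ (1 / 2) ^ (l + 1) := by
  have hm : (0 : ℝ) < (l : ℝ) + 1 := by positivity
  set m : ℝ := (l : ℝ) + 1 with hmdef
  have h1 : (1 - ξ) ^ e ≤ Real.exp (-(ξ * 2 ^ l)) := by
    calc (1 - ξ) ^ e ≤ (1 - ξ) ^ (2 ^ l) := pow_le_pow_of_le_one (by linarith) (by linarith) hle
      _ ≤ Real.exp (-ξ) ^ (2 ^ l) :=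
          pow_le_pow_left₀ (by linarith) (by linarith [Real.add_one_le_exp (-ξ)]) _
      _ = _ := by rw [← Real.exp_nat_mul]; push_cast; ring_nf
  -- Half of the exponent of `2^l` is spent on beating `1/ξ`; the other part, with rate `ln 2 - 1/2
  -- > 0.19`, beats the polynomial weight and the factor `2^(l+1)`.
  have hX : (4 * δ + 8) / (α * ξ) < Real.exp (m / 2) :=
    (Real.log_lt_iff_lt_exp (by positivity)).1 (by linarith)
  have h2 : (8 * δ + 16) ≤ ξ * Real.exp (m / 2) := by
    rw [div_lt_iff₀ (by positivity)] at hX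
    have : α * (ξ * Real.exp (m / 2)) ≤ 1 / 2 * (ξ * Real.exp (m / 2)) :=
      mul_le_mul_of_nonneg_right hα' (by positivity)
    linarith
  have hl2 := Real.log_two_gt_d9
  have hl2' := Real.log_two_lt_d9
  have h2m : (2 : ℝ) ^ l = Real.exp (m * Real.log 2) / 2 := by
    rw [mul_comm, Real.exp_mul, Real.exp_log two_pos, hmdef, Real.rpow_add_one two_ne_zero,
      Real.rpow_natCast]
    ring
  have h3 : (4 * δ + 8) * (1 + 0.19 * m) ≤ ξ * 2 ^ l := by
    have e1 : Real.exp (m * Real.log 2) = Real.exp (m / 2) * Real.exp (m * (Real.log 2 - 1 / 2)) := by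
      rw [← Real.exp_add]; ring_nf
    have e2 : 1 + 0.19 * m ≤ Real.exp (m * (Real.log 2 - 1 / 2)) := by
      have := Real.add_one_le_exp (m * (Real.log 2 - 1 / 2))
      nlinarith
    rw [h2m, e1]
    calc (4 * δ + 8) * (1 + 0.19 * m) = (8 * δ + 16) * (1 + 0.19 * m) / 2 := by ring
      _ ≤ (ξ * Real.exp (m / 2)) * Real.exp (m * (Real.log 2 - 1 / 2)) / 2 := by gcongr
      _ = _ := by ring
  have h4 : Real.log m ≤ m / 2 := by
    have := Real.log_le_sub_one_of_pos (show 0 < m / 2 by positivity)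
    rw [Real.log_div hm.ne' two_ne_zero] at this
    linarith
  -- It suffices that `0.19 (4δ + 8) ≥ δ/2 + ln 2`.
  have h5 : δ * Real.log m + m * Real.log 2 ≤ ξ * 2 ^ l := by
    have a1 : δ * Real.log m ≤ δ * (m / 2) := mul_le_mul_of_nonneg_left h4 (by linarith)
    nlinarith
  calc m ^ δ * (1 - ξ) ^ e ≤ m ^ δ * Real.exp (-(ξ * 2 ^ l)) := by gcongr
    _ = Real.exp (δ * Real.log m + -(ξ * 2 ^ l)) := by
        rw [Real.exp_add, Real.rpow_def_of_pos hm, mul_comm δ]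
    _ ≤ Real.exp (-(m * Real.log 2)) := Real.exp_le_exp.2 (by linarith)
    _ = (1 / 2) ^ (l + 1) := by
        rw [Real.exp_neg, mul_comm, Real.exp_mul, Real.exp_log two_pos, hmdef, one_div, inv_pow]
        congr 1
        exact_mod_cast Real.rpow_natCast 2 (l + 1)

/-- Below the cutoff `A = 2 ln((4δ+8)/(αξ))` there are at most `A` terms, each at most `A^δ`; beyond
it the terms are dominated by a geometric series of sum `1`. -/
lemma weight_sum {δ α ξ : ℝ} (hδ : 1 < δ) (hα : 0 < α) (hα' : α ≤ 1 / 2) (hξ : 0 < ξ)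
    (hξ' : ξ ≤ 1) {e : ℕ → ℕ} (he : ∀ l, 1 ≤ l → 2 ^ l ≤ e l) :
    Summable (fun l : ℕ => ((l : ℝ) + 1) ^ δ * (1 - ξ) ^ e l) ∧
    ∑' l : ℕ, ((l : ℝ) + 1) ^ δ * (1 - ξ) ^ e l
      ≤ (2 * Real.log ((4 * δ + 8) / (α * ξ))) ^ (δ + 1) + 1 := by
  have hlog := two_le_log_ratio hδ hα hα' hξ hξ'
  set A := 2 * Real.log ((4 * δ + 8) / (α * ξ)) with hA
  have hA4 : 4 ≤ A := by linarith
  set n := ⌊A⌋₊ with hn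
  have hnA : (n : ℝ) ≤ A := Nat.floor_le (by linarith)
  set f : ℕ → ℝ := fun l => if l ∈ Finset.range n then A ^ δ else 0 with hf
  have hfs : HasSum f (n * A ^ δ) := by
    have : HasSum f (∑ l ∈ Finset.range n, f l) :=
      hasSum_sum_of_ne_finset_zero fun l hl => if_neg hl
    have e1 : ∑ l ∈ Finset.range n, f l = n * A ^ δ := by
      rw [Finset.sum_congr rfl fun l hl => if_pos hl]; simp
    rwa [e1] at this
  have hgs : HasSum (fun l : ℕ => (1 / 2 : ℝ) ^ (l + 1)) 1 := by
    have := hasSum_geometric_two.mul_left (1 / 2 : ℝ)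
    simpa [pow_succ, mul_comm] using this
  have hw0 : ∀ l : ℕ, 0 ≤ ((l : ℝ) + 1) ^ δ * (1 - ξ) ^ e l := fun l =>
    mul_nonneg (by positivity) (pow_nonneg (by linarith) _)
  have hle : ∀ l : ℕ, ((l : ℝ) + 1) ^ δ * (1 - ξ) ^ e l ≤ f l + (1 / 2) ^ (l + 1) := by
    intro l
    by_cases hl : l ∈ Finset.range n
    · simp only [hf, if_pos hl]
      have h1 : ((l : ℝ) + 1) ≤ A := by
        have : l + 1 ≤ n := Finset.mem_range.1 hl
        have : ((l + 1 : ℕ) : ℝ) ≤ n := by exact_mod_cast this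
        push_cast at this; linarith
      have h2 : ((l : ℝ) + 1) ^ δ * (1 - ξ) ^ e l ≤ A ^ δ * 1 := by
        gcongr
        exact pow_le_one₀ (by linarith) (by linarith)
      have : (0 : ℝ) ≤ (1 / 2) ^ (l + 1) := by positivity
      linarith
    · simp only [hf, if_neg hl, zero_add]
      rw [Finset.mem_range, not_lt] at hl
      have hAl : A < (l : ℝ) + 1 := by
        have h1 : A < n + 1 := Nat.lt_floor_add_one A
        have h2 : (n : ℝ) ≤ l := by exact_mod_cast hl
        linarith
      -- Level `0` lies below the cutoff as `A ≥ 4`, so no lower bound on its exponent `e 0` is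
      -- needed.
      have hl1 : 1 ≤ l := by
        by_contra h0
        have : l = 0 := by omega
        subst this
        simp at hAl; linarith
      exact weight_tail hδ hα hα' hξ hξ' (he l hl1) hAl
  have hsum := hfs.add hgs
  have hws := Summable.of_nonneg_of_le hw0 hle hsum.summable
  refine ⟨hws, (hws.tsum_le_tsum hle hsum.summable).trans ?_⟩
  rw [hsum.tsum_eq, Real.rpow_add_one (by linarith)]
  have : 0 ≤ A ^ δ := by positivity
  nlinarith

/-- With `Y = (2Λ)^(δ+1)`, the bounds `1/α ≥ 2` and `(4Λ)^(δ+1) ≥ 4Y` reduce the claim to `69c +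
21cY ≤ 54c + 24cY`, and `Y ≥ 16` is more than enough. -/
lemma final_constant_bound {δ α ξ c : ℝ} (hδ : 1 < δ) (hα : 0 < α) (hα' : α ≤ 1 / 2) (hξ : 0 < ξ)
    (hξ' : ξ ≤ 1) (hc : 0 ≤ c) :
    48 * c + 21 * c * ((2 * Real.log ((4 * δ + 8) / (α * ξ))) ^ (δ + 1) + 1)
      ≤ 27 * c / α + 6 * c * (4 * Real.log ((4 * δ + 8) / (α * ξ))) ^ (δ + 1) := by
  have hlog := two_le_log_ratio hδ hα hα' hξ hξ'
  set Λ := Real.log ((4 * δ + 8) / (α * ξ))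
  have h1 : (4 * Λ) ^ (δ + 1) = 2 ^ (δ + 1) * (2 * Λ) ^ (δ + 1) := by
    rw [← Real.mul_rpow (by norm_num) (by linarith)]; ring_nf
  have h2 : (4 : ℝ) ≤ 2 ^ (δ + 1) := by
    calc (4 : ℝ) = 2 ^ (2 : ℝ) := by norm_num
      _ ≤ 2 ^ (δ + 1) := Real.rpow_le_rpow_of_exponent_le (by norm_num) (by linarith)
  have h3 : (16 : ℝ) ≤ (2 * Λ) ^ (δ + 1) := by
    calc (16 : ℝ) = 4 ^ (2 : ℝ) := by norm_num
      _ ≤ (2 * Λ) ^ (2 : ℝ) := Real.rpow_le_rpow (by norm_num) (by linarith) (by norm_num)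
      _ ≤ (2 * Λ) ^ (δ + 1) := Real.rpow_le_rpow_of_exponent_le (by linarith) (by linarith)
  set Y := (2 * Λ) ^ (δ + 1)
  have h4 : 4 * Y ≤ (4 * Λ) ^ (δ + 1) := by
    rw [h1]; exact mul_le_mul_of_nonneg_right h2 (by linarith)
  have h5 : 54 * c ≤ 27 * c / α := by
    rw [le_div_iff₀ hα]; nlinarith
  nlinarith [mul_le_mul_of_nonneg_left h4 hc, mul_le_mul_of_nonneg_left h3 hc]

/-- The subtracted term of `p_l` is at most half of the first one, since `(l+2)^δ ≥ (l+1)^δ`. -/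
lemma levelProb_ge {δ : ℝ} (hδ : 1 < δ) (l : ℕ) :
    (2 ^ (l + 1) * ((l : ℝ) + 1) ^ δ)⁻¹ ≤ levelProb δ l := by
  have hl : (0 : ℝ) < (l : ℝ) + 1 := by positivity
  have hp : (0 : ℝ) < ((l : ℝ) + 1) ^ δ := by positivity
  have h1 : 1 / (2 ^ (l + 1) * ((l : ℝ) + 2) ^ δ) ≤ 1 / (2 ^ (l + 1) * ((l : ℝ) + 1) ^ δ) := by
    gcongr; norm_num
  have h2 : 1 / (2 ^ l * ((l : ℝ) + 1) ^ δ) = 2 * (1 / (2 ^ (l + 1) * ((l : ℝ) + 1) ^ δ)) := by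
    rw [pow_succ]; field_simp
  rw [levelProb, ← one_div]
  linarith

lemma levelProb_pos {δ : ℝ} (hδ : 1 < δ) (l : ℕ) : 0 < levelProb δ l :=
  lt_of_lt_of_le (by positivity) (levelProb_ge hδ l)

lemma inv_levelProb_le {δ : ℝ} (hδ : 1 < δ) (l : ℕ) :
    (levelProb δ l)⁻¹ ≤ 2 ^ (l + 1) * ((l : ℝ) + 1) ^ δ := by
  have := inv_anti₀ (by positivity) (levelProb_ge hδ l)
  simpa using this

end Weights

/-! ### Second moments of the level differences -/

section Levels

variable {d : ℕ} {Ω : Type*} [MeasurableSpace Ω] {P : Measure Ω} [IsProbabilityMeasure P]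
  {ν : Measure (Vec d × ℝ)} {u : ℤ → Ω → Vec d × ℝ} {σ R lam γ δ : ℝ} {k s : ℕ}
  {τ : ℕ → Ω → ℕ} {N : Ω → ℕ}

lemma IsLevelInput.integral_form_levelDiff_le (hi : IsLevelInput P u δ k s τ N)
    (hu : IsSample P ν u) (h : NoiseModel ν σ R lam) (hd : 1 ≤ d) (hγ : 0 < γ)
    (hγR : 0 < 2 - γ * R ^ 2) (hk : 2 ≤ k) (hs : s ≤ k) (hks : (k : ℝ) / 3 ≤ (k : ℝ) - s)
    (v : Vec d) (l : ℕ) :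
    ∫ ω, inner ℝ (levelDiff γ u v τ l ω) (hessOp ν (levelDiff γ u v τ l ω)) ∂P
      ≤ 21 / 2 * ((‖v‖ ^ 2 + γ * σ ^ 2 / (2 - γ * R ^ 2) * d) / (γ * (2 - γ * R ^ 2)))
        * (1 - γ * (2 - γ * R ^ 2) * lam) ^ startLo k s l / (k * 2 ^ l) := by
  rw [(hi.integral_form_levelDiff hu h hγ.le v l).2]
  have hk0 : (0 : ℝ) < k := by exact_mod_cast (by omega : 0 < k)
  have hlam := h.lam_pos
  have hρ := sub_nonneg.2 (h.contraction_le_one hd hγ.le hγR.le)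
  have hρ1 : 1 - γ * (2 - γ * R ^ 2) * lam ≤ 1 := by
    have : 0 < γ * (2 - γ * R ^ 2) * lam := by positivity
    linarith
  set κ := γ * (2 - γ * R ^ 2) with hκ
  have hκ0 : 0 < κ := by positivity
  set ρ := 1 - κ * lam
  set a₀ := γ * σ ^ 2 / (2 - γ * R ^ 2) with ha₀
  have ha0 : 0 ≤ a₀ := by positivity
  set I := startFinset k s l with hI
  set J := startFinset k s (l + 1) with hJ
  have hIc := le_card_startFinset hs hks l
  have hJc : (J.card : ℝ) = k * 2 ^ (l + 1) := by
    rw [hJ, card_startFinset_succ]; push_cast; ring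
  rw [← hI] at hIc
  have hI0 : (0 : ℝ) < I.card := lt_of_lt_of_le (by positivity) hIc
  have hJ0 : (0 : ℝ) < J.card := by rw [hJc]; positivity
  set gb : ℕ → ℝ := fun b => inner ℝ v ((transfer ν γ)^[b] (hessOp ν) v) with hgb
  set ga : ℕ → ℝ := fun a => gb a + a₀ * formTrace ((transfer ν γ)^[a] (hessOp ν)) with hga
  have hgb0 : ∀ b, 0 ≤ gb b := fun b => h.iterate_transfer_nonneg hγ.le h.hessOp_nonneg b v
  have step1 : ∀ a ∈ I, ∀ b ∈ J, (I.card : ℝ)⁻¹ * (J.card : ℝ)⁻¹ *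
        ∫ ω, inner ℝ (chain γ u v (-(b : ℤ)) b ω - chain γ u v (-(a : ℤ)) a ω)
          (hessOp ν (chain γ u v (-(b : ℤ)) b ω - chain γ u v (-(a : ℤ)) a ω)) ∂P
      ≤ (I.card : ℝ)⁻¹ * (J.card : ℝ)⁻¹ * (3 * (gb b + ga a)) := by
    intro a ha b hb
    refine mul_le_mul_of_nonneg_left ?_ (by positivity)
    -- The ranges of consecutive levels are adjacent intervals, so the start of the higher level is
    -- always the earlier time.
    have hab : a ≤ b := by
      rw [hI, startFinset, Finset.mem_Ico] at ha
      rw [hJ, startFinset, Finset.mem_Ico, startLo_succ] at hb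
      omega
    have := hu.integral_form_level_le h hγ hγR v hab
    simp only [hga, hgb]
    linarith
  refine (Finset.sum_le_sum fun a ha => Finset.sum_le_sum fun b hb => step1 a ha b hb).trans ?_
  have e : ∑ a ∈ I, ∑ b ∈ J, (I.card : ℝ)⁻¹ * (J.card : ℝ)⁻¹ * (3 * (gb b + ga a))
      = 3 * ((J.card : ℝ)⁻¹ * ∑ b ∈ J, gb b + (I.card : ℝ)⁻¹ * ∑ a ∈ I, ga a) := by
    simp only [← Finset.mul_sum, Finset.sum_add_distrib, Finset.sum_const, nsmul_eq_mul]
    field_simp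
  rw [e]
  have hlo : startLo k s l ≤ startLo k s (l + 1) := startLo_le_succ hs l
  have hIle : startLo k s l ≤ k * (2 ^ (l + 1) - 1) := by rwa [startLo_succ] at hlo
  have hJle : startLo k s (l + 1) ≤ k * (2 ^ (l + 1 + 1) - 1) := by
    have := startLo_le_succ hs (l + 1); rwa [startLo_succ _ _ (l + 1)] at this
  have hρlo : ρ ^ startLo k s (l + 1) ≤ ρ ^ startLo k s l := pow_le_pow_of_le_one hρ hρ1 hlo
  have hρp : 0 ≤ ρ ^ startLo k s l := pow_nonneg hρ _
  have hB0 : 0 ≤ a₀ * d := by positivity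
  have b1 : ∑ b ∈ J, gb b ≤ (‖v‖ ^ 2 + a₀ * d) / κ * ρ ^ startLo k s l := by
    have := h.sum_iterate_transfer_hess_le hd hγ.le hγR.le hJle v
    rw [div_mul_eq_mul_div, le_div_iff₀ hκ0, mul_comm]
    refine this.trans ?_
    have h3 := mul_le_mul_of_nonneg_right hρlo (sq_nonneg ‖v‖)
    nlinarith
  have b2 : ∑ a ∈ I, ga a ≤ (‖v‖ ^ 2 + a₀ * d) / κ * ρ ^ startLo k s l := by
    have h1 := h.sum_iterate_transfer_hess_le hd hγ.le hγR.le hIle v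
    have h2 := mul_le_mul_of_nonneg_left (h.sum_formTrace_le hd hγ.le hγR.le hIle) ha0
    rw [div_mul_eq_mul_div, le_div_iff₀ hκ0, mul_comm]
    simp only [hga, Finset.sum_add_distrib, ← Finset.mul_sum, mul_add]
    simp only [hI, startFinset, hgb]
    linarith
  set K := (‖v‖ ^ 2 + a₀ * d) / κ
  have hK : 0 ≤ K := by positivity
  -- The range `I` has length at least `k 2^l / 3` and `J` has length `2k 2^l`, so the total
  -- constant is `3 (1/2 + 3) = 21/2`.
  have c1 : (I.card : ℝ)⁻¹ ≤ 3 / (k * 2 ^ l) := by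
    rw [inv_le_comm₀ hI0 (by positivity), inv_div]; exact hIc
  have c2 : (J.card : ℝ)⁻¹ = 1 / 2 / (k * 2 ^ l) := by
    rw [hJc, pow_succ]; field_simp
  have hKρ : 0 ≤ K * ρ ^ startLo k s l := mul_nonneg hK hρp
  have d1 : (J.card : ℝ)⁻¹ * ∑ b ∈ J, gb b ≤ 1 / 2 / (k * 2 ^ l) * (K * ρ ^ startLo k s l) := by
    rw [c2]; exact mul_le_mul_of_nonneg_left b1 (by positivity)
  have d2 : (I.card : ℝ)⁻¹ * ∑ a ∈ I, ga a ≤ 3 / (k * 2 ^ l) * (K * ρ ^ startLo k s l) :=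
    (mul_le_mul_of_nonneg_left b2 (by positivity)).trans (mul_le_mul_of_nonneg_right c1 hKρ)
  calc _ ≤ 3 * (1 / 2 / (k * 2 ^ l) * (K * ρ ^ startLo k s l)
        + 3 / (k * 2 ^ l) * (K * ρ ^ startLo k s l)) := by linarith
    _ = _ := by ring

end Levels

/-! ### Mean and second moment of the single term estimator -/

section Single

open Filter Topology

variable {d : ℕ} {Ω : Type*} [MeasurableSpace Ω] {P : Measure Ω} [IsProbabilityMeasure P]
  {ν : Measure (Vec d × ℝ)} {u : ℤ → Ω → Vec d × ℝ} {σ R lam γ δ : ℝ} {k s : ℕ}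
  {τ : ℕ → Ω → ℕ} {N : Ω → ℕ}

/-- One mean gradient step is a contraction, by Jensen's inequality. -/
lemma NoiseModel.norm_mean_step_sq_le (h : NoiseModel ν σ R lam) (hγ : 0 ≤ γ)
    (hγR : 0 ≤ 2 - γ * R ^ 2) (v : Vec d) :
    ‖(1 - γ • hessOp ν : Vec d →L[ℝ] Vec d) v‖ ^ 2
      ≤ (1 - γ * (2 - γ * R ^ 2) * lam) * ‖v‖ ^ 2 := by
  have := h.prob
  set g := (1 - γ • hessOp ν : Vec d →L[ℝ] Vec d) v with hg
  have hm := h.memLp_shrink hγ v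
  have hi := hm.integrable (by norm_num)
  have hsq := (memLp_two_iff_integrable_sq_norm hm.1).1 hm
  have hmean : ∫ z, shrink γ z.1 v ∂ν = g := by
    simp only [shrink_apply, mul_smul]
    have hi' : Integrable (fun z : Vec d × ℝ => γ • inner ℝ z.1 v • z.1) ν :=
      (h.integrable_inner_smul v).smul γ
    rw [integral_sub (integrable_const _) hi', integral_smul, ← h.hessOp_apply]
    simp [hg]
  have h1 : ‖g‖ ^ 2 ≤ ∫ z, (1 / 2 * ‖g‖ ^ 2 + 1 / 2 * ‖shrink γ z.1 v‖ ^ 2) ∂ν := by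
    calc ‖g‖ ^ 2 = ∫ z, inner ℝ g (shrink γ z.1 v) ∂ν := by
          rw [integral_inner hi, hmean, real_inner_self_eq_norm_sq]
      _ ≤ _ := by
          refine integral_mono (hi.const_inner g)
            ((integrable_const _).add (hsq.const_mul _)) fun z => ?_
          have := norm_sub_sq_real g (shrink γ z.1 v)
          simp only
          nlinarith [sq_nonneg ‖g - shrink γ z.1 v‖]
  rw [integral_add (integrable_const _) (hsq.const_mul _), integral_const,
    integral_const_mul] at h1
  have h2 := h.integral_norm_shrink_sq_le hγ v
  have h3 := mul_le_mul_of_nonneg_left (h.lam_le v) (mul_nonneg hγ hγR)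
  rw [← h.inner_hessOp_self] at h3
  simp at h1
  linarith

lemma NoiseModel.norm_mean_iterate_le (h : NoiseModel ν σ R lam) (hγ : 0 ≤ γ)
    (hγR : 0 ≤ 2 - γ * R ^ 2) (v : Vec d) (n : ℕ) :
    ‖(⇑(1 - γ • hessOp ν : Vec d →L[ℝ] Vec d))^[n] v‖
      ≤ √(1 - γ * (2 - γ * R ^ 2) * lam) ^ n * ‖v‖ := by
  induction n with
  | zero => simp
  | succ n ih =>
    rw [Function.iterate_succ_apply', pow_succ', mul_assoc]
    set w := (⇑(1 - γ • hessOp ν : Vec d →L[ℝ] Vec d))^[n] v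
    refine le_trans ?_ (mul_le_mul_of_nonneg_left ih (Real.sqrt_nonneg _))
    have := Real.sqrt_le_sqrt (h.norm_mean_step_sq_le hγ hγR w)
    rwa [Real.sqrt_sq (norm_nonneg _), Real.sqrt_mul' _ (sq_nonneg _),
      Real.sqrt_sq (norm_nonneg _)] at this

/-- The average over the range of level `l` of the means of the chain. -/
noncomputable def levelMean (ν : Measure (Vec d × ℝ)) (γ : ℝ) (k s : ℕ) (v : Vec d) (l : ℕ)
    (w : Vec d) : ℝ :=
  ((startFinset k s l).card : ℝ)⁻¹ * ∑ a ∈ startFinset k s l,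
        inner ℝ w ((⇑(1 - γ • hessOp ν : Vec d →L[ℝ] Vec d))^[a] v)

/-- Every start of level `l ≥ 1` is at least `l`, and each mean step contracts the norm by `√(1 - ξ)
< 1`, so the level mean decays geometrically. -/
lemma NoiseModel.tendsto_levelMean (h : NoiseModel ν σ R lam) (hγ : 0 < γ)
    (hγR : 0 < 2 - γ * R ^ 2) (hk : 2 ≤ k) (v w : Vec d) :
    Tendsto (fun l => levelMean ν γ k s v l w) atTop (𝓝 0) := by
  have hlam := h.lam_pos
  have hκ : 0 < γ * (2 - γ * R ^ 2) * lam := by positivity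
  set r := √(1 - γ * (2 - γ * R ^ 2) * lam) with hr
  have hr0 : 0 ≤ r := Real.sqrt_nonneg _
  have hr1 : r < 1 := by
    rw [hr, Real.sqrt_lt' one_pos]; linarith
  have hlim : Tendsto (fun l : ℕ => ‖w‖ * ‖v‖ * r ^ l) atTop (𝓝 0) := by
    simpa using (tendsto_pow_atTop_nhds_zero_of_lt_one hr0 hr1).const_mul (‖w‖ * ‖v‖)
  refine squeeze_zero_norm' (eventually_atTop.2 ⟨1, fun l hl => ?_⟩) hlim
  have hb : ∀ a ∈ startFinset k s l,
      |inner ℝ w ((⇑(1 - γ • hessOp ν : Vec d →L[ℝ] Vec d))^[a] v)| ≤ ‖w‖ * ‖v‖ * r ^ l := by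
    intro a ha
    have hla : l ≤ a := by
      have h1 : startLo k s l ≤ a := (Finset.mem_Ico.1 ha).1
      have h2 := le_startLo (s := s) hk hl
      have h3 : l < 2 ^ l := Nat.lt_two_pow_self
      omega
    calc _ ≤ ‖w‖ * ‖(⇑(1 - γ • hessOp ν : Vec d →L[ℝ] Vec d))^[a] v‖ := abs_real_inner_le_norm _ _
      _ ≤ ‖w‖ * (r ^ a * ‖v‖) := by
          gcongr; exact h.norm_mean_iterate_le hγ.le hγR.le v a
      _ ≤ ‖w‖ * (r ^ l * ‖v‖) := by
          gcongr ‖w‖ * (?_ * ‖v‖); exact pow_le_pow_of_le_one hr0 hr1.le hla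
      _ = _ := by ring
  rw [levelMean, norm_mul, Real.norm_of_nonneg (by positivity)]
  calc _ ≤ ((startFinset k s l).card : ℝ)⁻¹ * ∑ a ∈ startFinset k s l, ‖w‖ * ‖v‖ * r ^ l := by
        gcongr
        exact (Finset.abs_sum_le_sum_abs _ _).trans (Finset.sum_le_sum hb)
    _ ≤ _ := by
        rw [Finset.sum_const, nsmul_eq_mul, ← mul_assoc]
        refine mul_le_of_le_one_left (by positivity) ?_
        exact inv_mul_le_one

/-- The single term estimator as a random variable. -/
noncomputable def randomTerm (γ δ : ℝ) (u : ℤ → Ω → Vec d × ℝ) (v : Vec d) (τ : ℕ → Ω → ℕ)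
    (N : Ω → ℕ) (ω : Ω) : Vec d :=
  (levelProb δ (N ω))⁻¹ • levelDiff γ u v τ (N ω) ω

namespace IsLevelInput

lemma measurable_input (hi : IsLevelInput P u δ k s τ N) (hu : IsSample P ν u) :
    Measurable fun ω => ((fun t => u t ω), (fun l => τ l ω)) :=
  (measurable_pi_lambda _ hu.meas).prodMk (measurable_pi_lambda _ hi.meas_τ)

lemma measurable_levelDiff (hi : IsLevelInput P u δ k s τ N) (hu : IsSample P ν u)
    (v : Vec d) (l : ℕ) : Measurable (levelDiff γ u v τ l) :=
  (measurable_levelDiff_path γ v l).comp (hi.measurable_input hu)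

lemma measurable_randomTerm (hi : IsLevelInput P u δ k s τ N) (hu : IsSample P ν u)
    (v : Vec d) : Measurable (randomTerm γ δ u v τ N) := by
  have h1 : Measurable fun q : ℕ × Ω => (levelProb δ q.1)⁻¹ • levelDiff γ u v τ q.1 q.2 :=
    measurable_from_prod_countable_right fun l =>
      (measurable_const_smul (levelProb δ l)⁻¹).comp (hi.measurable_levelDiff hu v l)
  have e : randomTerm γ δ u v τ N = (fun q : ℕ × Ω => (levelProb δ q.1)⁻¹ •
      levelDiff γ u v τ q.1 q.2) ∘ fun ω => (N ω, ω) := by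
    ext1 ω
    rw [randomTerm, Function.comp_apply]
  rw [e]
  exact h1.comp (hi.meas_N.prodMk measurable_id)

/-- The Hessian form dominates `lam ‖·‖²`, so its integrability already gives square integrability.
-/
lemma memLp_of_form (h : NoiseModel ν σ R lam) {Z : Ω → Vec d} (hZ : Measurable Z)
    (hi : Integrable (fun ω => inner ℝ (Z ω) (hessOp ν (Z ω))) P) : MemLp Z 2 P := by
  rw [memLp_two_iff_integrable_sq_norm hZ.aestronglyMeasurable]
  refine (hi.const_mul lam⁻¹).mono' (hZ.norm.pow_const 2).aestronglyMeasurable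
    (Eventually.of_forall fun ω => ?_)
  rw [Real.norm_of_nonneg (sq_nonneg _), ← div_eq_inv_mul, le_div_iff₀ h.lam_pos, mul_comm,
    h.inner_hessOp_self]
  exact h.lam_le _

/-- Second moment of the single term estimator. -/
lemma integral_form_randomTerm_le (hi : IsLevelInput P u δ k s τ N)
    (hu : IsSample P ν u) (h : NoiseModel ν σ R lam) (hd : 1 ≤ d) (hγ : 0 < γ)
    (hγR : 0 < 2 - γ * R ^ 2) (hδ : 1 < δ) (hk : 2 ≤ k) (hs : s ≤ k)
    (hks : (k : ℝ) / 3 ≤ (k : ℝ) - s) (v : Vec d)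
    (hw : Summable fun l : ℕ =>
      ((l : ℝ) + 1) ^ δ * (1 - γ * (2 - γ * R ^ 2) * lam) ^ startLo k s l) :
    (Summable fun l : ℕ => (levelProb δ l)⁻¹ *
      ∫ ω, inner ℝ (levelDiff γ u v τ l ω) (hessOp ν (levelDiff γ u v τ l ω)) ∂P) ∧
    Integrable (fun ω => inner ℝ (randomTerm γ δ u v τ N ω)
      (hessOp ν (randomTerm γ δ u v τ N ω))) P ∧
    k * ∫ ω, inner ℝ (randomTerm γ δ u v τ N ω) (hessOp ν (randomTerm γ δ u v τ N ω)) ∂P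
      ≤ 21 * ((‖v‖ ^ 2 + γ * σ ^ 2 / (2 - γ * R ^ 2) * d) / (γ * (2 - γ * R ^ 2)))
        * ∑' l : ℕ, ((l : ℝ) + 1) ^ δ * (1 - γ * (2 - γ * R ^ 2) * lam) ^ startLo k s l := by
  set w : ℕ → ℝ := fun l => ((l : ℝ) + 1) ^ δ * (1 - γ * (2 - γ * R ^ 2) * lam) ^ startLo k s l
    with hwdef
  set K := (‖v‖ ^ 2 + γ * σ ^ 2 / (2 - γ * R ^ 2) * d) / (γ * (2 - γ * R ^ 2)) with hK
  have hK0 : 0 ≤ K := by positivity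
  have hk0 : (0 : ℝ) < k := by exact_mod_cast (by omega : 0 < k)
  have hρ := sub_nonneg.2 (h.contraction_le_one hd hγ.le hγR.le)
  set E : ℕ → ℝ := fun l =>
    ∫ ω, inner ℝ (levelDiff γ u v τ l ω) (hessOp ν (levelDiff γ u v τ l ω)) ∂P with hE
  have hE0 : ∀ l, 0 ≤ E l := fun l => integral_nonneg fun ω => h.hessOp_nonneg _
  have hle : ∀ l, (levelProb δ l)⁻¹ * E l ≤ 21 * K / k * w l := fun l => by
    have h1 := hi.integral_form_levelDiff_le hu h hd hγ hγR hk hs hks v l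
    calc (levelProb δ l)⁻¹ * E l
        ≤ (2 ^ (l + 1) * ((l : ℝ) + 1) ^ δ) *
          (21 / 2 * K * (1 - γ * (2 - γ * R ^ 2) * lam) ^ startLo k s l / (k * 2 ^ l)) :=
          mul_le_mul (inv_levelProb_le hδ l) h1 (hE0 l) (by positivity)
      _ = _ := by
          simp only [hwdef]
          rw [pow_succ]
          field_simp
  have hsum : Summable fun l => (levelProb δ l)⁻¹ * E l :=
    Summable.of_nonneg_of_le (fun l => mul_nonneg (inv_nonneg.2 (levelProb_pos hδ l).le) (hE0 l))
      hle (hw.mul_left _)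
  have hmm := measurable_levelDiff_path (d := d) γ v
  have hg : ∀ l : ℕ, Measurable fun p : (ℤ → Vec d × ℝ) × (ℕ → ℕ) =>
      (levelProb δ l)⁻¹ •
        levelDiff γ (fun t (p : (ℤ → Vec d × ℝ) × (ℕ → ℕ)) => p.1 t) v (fun l p => p.2 l) l p :=
    fun l => (measurable_const_smul (levelProb δ l)⁻¹).comp (hmm l)
  have hterm : ∀ (l : ℕ) (ω : Ω), inner ℝ ((levelProb δ l)⁻¹ • levelDiff γ u v τ l ω)
      (hessOp ν ((levelProb δ l)⁻¹ • levelDiff γ u v τ l ω))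
      = (levelProb δ l)⁻¹ ^ 2 *
        inner ℝ (levelDiff γ u v τ l ω) (hessOp ν (levelDiff γ u v τ l ω)) := fun l ω => by
    rw [map_smul, inner_smul_left, inner_smul_right]
    simp only [conj_trivial]; ring
  have hprob : ∀ l, P.real (N ⁻¹' {l}) = levelProb δ l := fun l => hi.law_N l
  -- The square of the weight `1/p_l` meets the probability `p_l` of its level, leaving one factor
  -- `1/p_l`.
  have hcoef : ∀ l x, levelProb δ l * ((levelProb δ l)⁻¹ ^ 2 * x) = (levelProb δ l)⁻¹ * x :=
    fun l x => by have := (levelProb_pos hδ l).ne'; field_simp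
  have hEl : ∀ l, P.real (N ⁻¹' {l}) * ∫ ω, inner ℝ ((levelProb δ l)⁻¹ • levelDiff γ u v τ l ω)
      (hessOp ν ((levelProb δ l)⁻¹ • levelDiff γ u v τ l ω)) ∂P = (levelProb δ l)⁻¹ * E l :=
    fun l => by simp only [hterm]; rw [integral_const_mul, hprob, hcoef]
  obtain ⟨h1, h2⟩ := mixture_integral hi.indep_N hi.meas_N (hi.measurable_input hu)
    (g := fun l p => inner ℝ ((levelProb δ l)⁻¹ •
        levelDiff γ (fun t (p : (ℤ → Vec d × ℝ) × (ℕ → ℕ)) => p.1 t) v (fun l p => p.2 l) l p)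
      (hessOp ν ((levelProb δ l)⁻¹ •
        levelDiff γ (fun t (p : (ℤ → Vec d × ℝ) × (ℕ → ℕ)) => p.1 t) v (fun l p => p.2 l) l p)))
    (fun l => (hg l).inner ((hessOp ν).measurable.comp (hg l)))
    (fun l => ((hi.integral_form_levelDiff hu h hγ.le v l).1.const_mul
      ((levelProb δ l)⁻¹ ^ 2)).congr (Eventually.of_forall fun ω => (hterm l ω).symm))
    (by
      refine hsum.congr fun l => ?_
      rw [← hEl]
      congr 1
      exact integral_congr_ae (Eventually.of_forall fun ω => (abs_of_nonneg (h.hessOp_nonneg _)).symm))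
  refine ⟨hsum, h1, ?_⟩
  have h3 : HasSum (fun l => (levelProb δ l)⁻¹ * E l)
      (∫ ω, inner ℝ (randomTerm γ δ u v τ N ω) (hessOp ν (randomTerm γ δ u v τ N ω)) ∂P) := by
    rw [← funext hEl]
    exact h2
  have h4 := hsum.tsum_le_tsum hle (hw.mul_left _)
  rw [h3.tsum_eq, tsum_mul_left] at h4
  calc _ ≤ k * (21 * K / k * ∑' l, w l) := mul_le_mul_of_nonneg_left h4 hk0.le
    _ = _ := by field_simp

/-- The single term estimator corrects the mean of level `0` to `0`. -/
lemma integral_inner_randomTerm (hi : IsLevelInput P u δ k s τ N)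
    (hu : IsSample P ν u) (h : NoiseModel ν σ R lam) (hγ : 0 < γ)
    (hγR : 0 < 2 - γ * R ^ 2) (hδ : 1 < δ) (hk : 2 ≤ k) (v w : Vec d)
    (hsum : Summable fun l : ℕ => (levelProb δ l)⁻¹ *
      ∫ ω, inner ℝ (levelDiff γ u v τ l ω) (hessOp ν (levelDiff γ u v τ l ω)) ∂P) :
    ∫ ω, inner ℝ w (randomTerm γ δ u v τ N ω) ∂P = -levelMean ν γ k s v 0 w := by
  have hprob : ∀ l, P.real (N ⁻¹' {l}) = levelProb δ l := fun l => hi.law_N l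
  have hpsum : Summable (levelProb δ) := by
    have h1 : ∀ n, ∑ l ∈ Finset.range n, levelProb δ l ≤ 1 := fun n => by
      have : ∀ l, levelProb δ l = P.real (N ⁻¹' {l}) := fun l => (hprob l).symm
      simp only [this]
      rw [← measureReal_biUnion_finset
        (fun i _ j _ hij => Disjoint.preimage N (by simpa using hij))
        (fun l _ => hi.meas_N (measurableSet_singleton l))]
      exact measureReal_le_one
    exact summable_of_sum_range_le (fun l => (levelProb_pos hδ l).le) h1
  have hLm : ∀ l, MemLp (levelDiff γ u v τ l) 2 P := fun l =>
    memLp_of_form h (hi.measurable_levelDiff hu v l) (hi.integral_form_levelDiff hu h hγ.le v l).1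
  have hLi : ∀ l, Integrable (fun ω => inner ℝ w (levelDiff γ u v τ l ω)) P := fun l =>
    ((hLm l).integrable (by norm_num)).const_inner w
  have hterm : ∀ (l : ℕ) (ω : Ω), inner ℝ w ((levelProb δ l)⁻¹ • levelDiff γ u v τ l ω)
      = (levelProb δ l)⁻¹ * inner ℝ w (levelDiff γ u v τ l ω) := fun l ω => inner_smul_right _ _ _
  have hcoef : ∀ l x, levelProb δ l * ((levelProb δ l)⁻¹ * x) = x :=
    fun l x => mul_inv_cancel_left₀ (levelProb_pos hδ l).ne' x
  -- Young's inequality with weight `p_l` splits the first moment into two terms that are summable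
  -- over `l`: the probabilities themselves, and the second moments already controlled.
  have habs : ∀ l, ∫ ω, |inner ℝ w (levelDiff γ u v τ l ω)| ∂P
      ≤ 1 / 2 * ‖w‖ ^ 2 * levelProb δ l + 1 / 2 * lam⁻¹ * ((levelProb δ l)⁻¹ *
        ∫ ω, inner ℝ (levelDiff γ u v τ l ω) (hessOp ν (levelDiff γ u v τ l ω)) ∂P) := fun l => by
    have hp := levelProb_pos hδ l
    have hlam := h.lam_pos
    have i1 := (hi.integral_form_levelDiff hu h hγ.le v l).1
    have h1 : ∫ ω, |inner ℝ w (levelDiff γ u v τ l ω)| ∂P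
        ≤ ∫ ω, (1 / 2 * ‖w‖ ^ 2 * levelProb δ l + 1 / 2 * lam⁻¹ * (levelProb δ l)⁻¹ *
          inner ℝ (levelDiff γ u v τ l ω) (hessOp ν (levelDiff γ u v τ l ω))) ∂P := by
      refine integral_mono (hLi l).abs ((integrable_const _).add (i1.const_mul _)) fun ω => ?_
      set Δ := levelDiff γ u v τ l ω
      have a1 : ‖Δ‖ ^ 2 ≤ lam⁻¹ * inner ℝ Δ (hessOp ν Δ) := by
        rw [← div_eq_inv_mul, le_div_iff₀ hlam, mul_comm, h.inner_hessOp_self]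
        exact h.lam_le _
      have a2 := abs_real_inner_le_norm w Δ
      have a3 : ‖w‖ * ‖Δ‖ ≤ 1 / 2 * ‖w‖ ^ 2 * levelProb δ l
          + 1 / 2 * ((levelProb δ l)⁻¹ * ‖Δ‖ ^ 2) := by
        have : 0 ≤ (levelProb δ l)⁻¹ * (levelProb δ l * ‖w‖ - ‖Δ‖) ^ 2 := by positivity
        have e : (levelProb δ l)⁻¹ * (levelProb δ l * ‖w‖ - ‖Δ‖) ^ 2
            = levelProb δ l * ‖w‖ ^ 2 - 2 * (‖w‖ * ‖Δ‖) + (levelProb δ l)⁻¹ * ‖Δ‖ ^ 2 := by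
          field_simp; ring
        linarith
      have a4 := mul_le_mul_of_nonneg_left a1 (inv_nonneg.2 hp.le)
      simp only
      nlinarith
    rw [integral_add (integrable_const _) (i1.const_mul _), integral_const, integral_const_mul] at h1
    simpa [mul_assoc] using h1
  have hmm := measurable_levelDiff_path (d := d) γ v
  obtain ⟨h1, h2⟩ := mixture_integral hi.indep_N hi.meas_N (hi.measurable_input hu)
    (g := fun l p => inner ℝ w ((levelProb δ l)⁻¹ •
        levelDiff γ (fun t (p : (ℤ → Vec d × ℝ) × (ℕ → ℕ)) => p.1 t) v (fun l p => p.2 l) l p))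
    (fun l => measurable_const.inner ((measurable_const_smul (levelProb δ l)⁻¹).comp (hmm l)))
    (fun l => ((hLi l).const_mul (levelProb δ l)⁻¹).congr
      (Eventually.of_forall fun ω => (hterm l ω).symm))
    (by
      refine Summable.of_nonneg_of_le
        (fun l => mul_nonneg measureReal_nonneg (integral_nonneg fun ω => abs_nonneg _)) (fun l => ?_)
        ((hpsum.mul_left (1 / 2 * ‖w‖ ^ 2)).add (hsum.mul_left (1 / 2 * lam⁻¹)))
      refine le_trans (le_of_eq ?_) (habs l)
      have e : ∫ ω, |inner ℝ w ((levelProb δ l)⁻¹ • levelDiff γ u v τ l ω)| ∂P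
          = (levelProb δ l)⁻¹ * ∫ ω, |inner ℝ w (levelDiff γ u v τ l ω)| ∂P := by
        rw [← integral_const_mul]
        simp only [hterm, abs_mul, abs_of_nonneg (inv_nonneg.2 (levelProb_pos hδ l).le)]
      rw [hprob]
      exact (congrArg (levelProb δ l * ·) e).trans (hcoef l _))
  have hmean : ∀ l, ∫ ω, inner ℝ w (levelDiff γ u v τ l ω) ∂P
      = levelMean ν γ k s v (l + 1) w - levelMean ν γ k s v l w := fun l => by
    obtain ⟨a1, a2⟩ := hi.integral_inner_start hu h hγ.le v w (l + 1)
    obtain ⟨b1, b2⟩ := hi.integral_inner_start hu h hγ.le v w l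
    simp only [levelDiff, inner_sub_right]
    rw [integral_sub a1 b1, a2, b2]; rfl
  have h3 : HasSum (fun l => levelMean ν γ k s v (l + 1) w - levelMean ν γ k s v l w)
      (∫ ω, inner ℝ w (randomTerm γ δ u v τ N ω) ∂P) := by
    have e : ∀ l, P.real (N ⁻¹' {l}) *
        ∫ ω, inner ℝ w ((levelProb δ l)⁻¹ • levelDiff γ u v τ l ω) ∂P
        = levelMean ν γ k s v (l + 1) w - levelMean ν γ k s v l w := fun l => by
      simp only [hterm]
      rw [integral_const_mul, hprob, hcoef, hmean]
    rw [← funext e]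
    exact h2
  have h4 := h3.tendsto_sum_nat
  simp only [Finset.sum_range_sub fun l => levelMean ν γ k s v l w] at h4
  have h5 := (h.tendsto_levelMean hγ hγR hk v w (s := s)).sub_const (levelMean ν γ k s v 0 w)
  rw [zero_sub] at h5
  -- The partial sums telescope, and the upper end vanishes in the limit.
  exact tendsto_nhds_unique h4 h5

end IsLevelInput

end Single

/-! ### Reduction of least squares to the centred model -/

section Reduction

variable {d : ℕ} {Ω₀ : Type*} [MeasurableSpace Ω₀] {P₀ : Measure Ω₀}
  {x : Ω₀ → Vec d} {y : Ω₀ → ℝ} {w : Ω₀ → ℝ} {θs : Vec d} {σ R γ : ℝ}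

lemma inner_eq_sum (u v : Vec d) : inner ℝ u v = ∑ i, u i * v i := by
  simp [PiLp.inner_apply, mul_comm]

lemma norm_sq_eq_sum (v : Vec d) : ‖v‖ ^ 2 = ∑ i, v i * v i := by
  rw [← real_inner_self_eq_norm_sq, inner_eq_sum]

lemma weighted_inner_sq_eq (a : ℝ) (u v : Vec d) :
    a * inner ℝ u v ^ 2 = ∑ i, ∑ j, v i * (a * (u i * u j)) * v j := by
  rw [sq, inner_eq_sum, Finset.sum_mul_sum, Finset.mul_sum]
  refine Finset.sum_congr rfl fun i _ => ?_
  rw [Finset.mul_sum]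
  exact Finset.sum_congr rfl fun j _ => by ring

lemma integral_weighted_inner_sq (h : ∀ i j, Integrable (fun ω => w ω * (x ω i * x ω j)) P₀)
    (v : Vec d) :
    Integrable (fun ω => w ω * inner ℝ (x ω) v ^ 2) P₀ ∧
    ∫ ω, w ω * inner ℝ (x ω) v ^ 2 ∂P₀
      = dotProduct (v : Fin d → ℝ) (Matrix.mulVec (weightedMoment P₀ w x) v) := by
  have hi : ∀ i j, Integrable (fun ω => v i * (w ω * (x ω i * x ω j)) * v j) P₀ := fun i j =>
    ((h i j).const_mul _).mul_const _
  simp only [weighted_inner_sq_eq]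
  refine ⟨integrable_finsetSum _ fun i _ => integrable_finsetSum _ fun j _ => hi i j, ?_⟩
  rw [integral_finsetSum _ fun i _ => integrable_finsetSum _ fun j _ => hi i j]
  simp only [dotProduct, Matrix.mulVec, Finset.mul_sum]
  refine Finset.sum_congr rfl fun i _ => ?_
  rw [integral_finsetSum _ fun j _ => hi i j]
  refine Finset.sum_congr rfl fun j _ => ?_
  rw [integral_mul_const, integral_const_mul, weightedMoment, Matrix.of_apply]
  ring

lemma integrable_coord_mul (hx : MemLp x 2 P₀) (i j : Fin d) :
    Integrable (fun ω => x ω i * x ω j) P₀ := by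
  have h : ∀ i, MemLp (fun ω => x ω i) 2 P₀ := fun i =>
    (EuclideanSpace.proj (𝕜 := ℝ) i).comp_memLp' hx
  exact (h i).integrable_mul (h j)

lemma integral_inner_sq_eq (hx : MemLp x 2 P₀) (v : Vec d) :
    ∫ ω, inner ℝ (x ω) v ^ 2 ∂P₀
      = dotProduct (v : Fin d → ℝ) (Matrix.mulVec (hessian P₀ x) v) := by
  have := (integral_weighted_inner_sq (w := fun _ => 1)
    (by simpa using integrable_coord_mul hx) v).2
  simpa [hessian] using this

lemma MomentBound.integral_le {b : ℝ} (h : MomentBound P₀ w x b) (hx : MemLp x 2 P₀) (v : Vec d) :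
    ∫ ω, w ω * inner ℝ (x ω) v ^ 2 ∂P₀ ≤ b * ∫ ω, inner ℝ (x ω) v ^ 2 ∂P₀ := by
  rw [(integral_weighted_inner_sq h.integrable v).2, integral_inner_sq_eq hx]
  have := h.le.dotProduct_mulVec_nonneg (v : Fin d → ℝ)
  rw [Matrix.sub_mulVec, Matrix.smul_mulVec, dotProduct_sub, dotProduct_smul] at this
  simpa using this

lemma MomentBound.integrable_mul_norm_sq {b : ℝ} (h : MomentBound P₀ w x b) :
    Integrable (fun ω => w ω * ‖x ω‖ ^ 2) P₀ := by
  simp only [norm_sq_eq_sum, Finset.mul_sum]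
  exact integrable_finsetSum _ fun i _ => h.integrable i i

lemma integral_residual_mul_inner (hx : MemLp x 2 P₀) (hy : MemLp y 2 P₀)
    (hθ : NormalEq P₀ x y θs) (v : Vec d) :
    ∫ ω, (y ω - inner ℝ (x ω) θs) * inner ℝ (x ω) v ∂P₀ = 0 := by
  have hc : ∀ i, MemLp (fun ω => x ω i) 2 P₀ := fun i =>
    (EuclideanSpace.proj (𝕜 := ℝ) i).comp_memLp' hx
  have hyx : ∀ i, Integrable (fun ω => y ω * x ω i) P₀ := fun i => hy.integrable_mul (hc i)
  have hxx := integrable_coord_mul hx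
  have e : ∀ ω, (y ω - inner ℝ (x ω) θs) * inner ℝ (x ω) v
      = ∑ i, (y ω * x ω i - ∑ j, (x ω i * x ω j) * θs j) * v i := fun ω => by
    rw [inner_eq_sum, inner_eq_sum, Finset.mul_sum]
    refine Finset.sum_congr rfl fun i _ => ?_
    simp only [mul_assoc, ← Finset.mul_sum]
    ring
  have hi2 : ∀ i, Integrable (fun ω => ∑ j, (x ω i * x ω j) * θs j) P₀ := fun i =>
    integrable_finsetSum _ fun j _ => (hxx i j).mul_const _
  have hi3 : ∀ i, Integrable (fun ω => (y ω * x ω i - ∑ j, (x ω i * x ω j) * θs j) * v i) P₀ :=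
    fun i => ((hyx i).sub (hi2 i)).mul_const _
  simp only [e]
  rw [integral_finsetSum _ fun i _ => hi3 i]
  refine Finset.sum_eq_zero fun i _ => ?_
  rw [integral_mul_const, integral_sub (hyx i) (hi2 i),
    integral_finsetSum _ fun j _ => (hxx i j).mul_const _]
  have h1 := congrFun hθ i
  simp only [Matrix.mulVec, dotProduct, hessian, weightedMoment, Matrix.of_apply, one_mul] at h1
  simp only [integral_mul_const]
  rw [h1, sub_self, zero_mul]

lemma spectrum_hessian_bddBelow {A : Matrix (Fin d) (Fin d) ℝ} (hA : A.IsHermitian) :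
    BddBelow (spectrum ℝ A) := by
  rw [hA.spectrum_real_eq_range_eigenvalues]
  exact (Set.finite_range _).bddBelow

lemma lambdaMin_pos {A : Matrix (Fin d) (Fin d) ℝ} (hd : 1 ≤ d) (hA : A.PosDef) :
    0 < lambdaMin A := by
  have : Nonempty (Fin d) := ⟨⟨0, hd⟩⟩
  rw [lambdaMin, hA.isHermitian.spectrum_real_eq_range_eigenvalues]
  obtain ⟨i, hi⟩ := (Set.range_nonempty hA.isHermitian.eigenvalues).csInf_mem (Set.finite_range _)
  rw [← hi]
  exact hA.eigenvalues_pos i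

/-- Shifting by the smallest eigenvalue moves the spectrum into the nonnegative reals, so the
shifted matrix is positive semidefinite. -/
lemma lambdaMin_mul_le {A : Matrix (Fin d) (Fin d) ℝ} (hA : A.IsHermitian) (v : Fin d → ℝ) :
    lambdaMin A * dotProduct v v ≤ dotProduct v (Matrix.mulVec A v) := by
  have h : (A - algebraMap ℝ _ (lambdaMin A)).PosSemidef := by
    rw [Matrix.posSemidef_iff_isHermitian_and_spectrum_nonneg]
    refine ⟨hA.sub ?_, ?_⟩
    · rw [Matrix.algebraMap_eq_diagonal]
      exact Matrix.isHermitian_diagonal _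
    · intro a ha
      rw [← spectrum.sub_singleton_eq] at ha
      obtain ⟨b, hb, c, hc, rfl⟩ := ha
      rw [Set.mem_singleton_iff] at hc
      subst hc
      exact sub_nonneg.2 (csInf_le (spectrum_hessian_bddBelow hA) hb)
  have := h.dotProduct_mulVec_nonneg v
  rw [Matrix.sub_mulVec, dotProduct_sub, Matrix.algebraMap_eq_diagonal] at this
  simp only [star_trivial] at this
  have e : dotProduct v (Matrix.mulVec (Matrix.diagonal fun _ : Fin d => lambdaMin A) v)
      = lambdaMin A * dotProduct v v := by
    simp only [dotProduct, Matrix.mulVec_diagonal, Finset.mul_sum]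
    exact Finset.sum_congr rfl fun i _ => by ring
  have e2 : (algebraMap ℝ (Fin d → ℝ)) (lambdaMin A) = fun _ => lambdaMin A := rfl
  rw [e2, e] at this
  linarith

/-- Subtracting the optimal prediction from the response. -/
noncomputable def residual (θs : Vec d) (z : Vec d × ℝ) : Vec d × ℝ :=
  (z.1, z.2 - inner ℝ z.1 θs)

lemma measurable_residual (θs : Vec d) : Measurable (residual θs) := by
  unfold residual; fun_prop

/-- The law of the regressor together with the residual. -/
noncomputable def residualLaw (P₀ : Measure Ω₀) (x : Ω₀ → Vec d) (y : Ω₀ → ℝ) (θs : Vec d) :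
    Measure (Vec d × ℝ) :=
  P₀.map fun ω => residual θs (x ω, y ω)

lemma noiseModel_residualLaw [IsProbabilityMeasure P₀] (hd : 1 ≤ d) (hx : MemLp x 2 P₀)
    (hy : MemLp y 2 P₀)
    (hH : (hessian P₀ x).PosDef) (hθ : NormalEq P₀ x y θs) (hA : MomentAssumption P₀ x y θs σ R) :
    NoiseModel (residualLaw P₀ x y θs) σ R (lambdaMin (hessian P₀ x)) := by
  have hm : AEMeasurable (fun ω => residual θs (x ω, y ω)) P₀ :=
    (measurable_residual θs).comp_aemeasurable
      (hx.1.aemeasurable.prodMk hy.1.aemeasurable)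
  have hint : ∀ {f : Vec d × ℝ → ℝ}, Continuous f →
      ∫ z, f z ∂(residualLaw P₀ x y θs) = ∫ ω, f (residual θs (x ω, y ω)) ∂P₀ := fun hf =>
    integral_map hm hf.aestronglyMeasurable
  have hinti : ∀ {f : Vec d × ℝ → ℝ}, Continuous f →
      Integrable (fun ω => f (residual θs (x ω, y ω))) P₀ →
      Integrable f (residualLaw P₀ x y θs) := fun hf hi =>
    (integrable_map_measure hf.aestronglyMeasurable hm).2 hi
  refine ⟨Measure.isProbabilityMeasure_map hm, ?_, ?_, fun v => ?_, fun v => ?_, fun v => ?_,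
    lambdaMin_pos hd hH, fun v => ?_, hA.R_pos⟩
  · refine hinti (by fun_prop) (hA.fourth.integrable_mul_norm_sq.congr
      (Filter.Eventually.of_forall fun ω => ?_))
    simp only [residual]; ring
  · exact hinti (by fun_prop) hA.noise.integrable_mul_norm_sq
  · rw [hint (by fun_prop), hint (by fun_prop)]
    exact hA.fourth.integral_le hx v
  · rw [hint (by fun_prop), hint (by fun_prop)]
    exact hA.noise.integral_le hx v
  · rw [hint (by fun_prop)]
    exact integral_residual_mul_inner hx hy hθ v
  · rw [hint (by fun_prop)]
    simp only [residual]
    rw [integral_inner_sq_eq hx, norm_sq_eq_sum]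
    exact lambdaMin_mul_le hH.isHermitian v

/-- Excess risk as half of the Hessian form. -/
lemma risk_eq [IsProbabilityMeasure P₀] (hx : MemLp x 2 P₀) (hy : MemLp y 2 P₀)
    (hθ : NormalEq P₀ x y θs) {lam : ℝ} (h : NoiseModel (residualLaw P₀ x y θs) σ R lam)
    (θ : Vec d) :
    risk P₀ x y θ = risk P₀ x y θs
      + 1 / 2 * inner ℝ (θ - θs) (hessOp (residualLaw P₀ x y θs) (θ - θs)) := by
  have hm : AEMeasurable (fun ω => residual θs (x ω, y ω)) P₀ :=
    (measurable_residual θs).comp_aemeasurable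
      (hx.1.aemeasurable.prodMk hy.1.aemeasurable)
  have e1 : inner ℝ (θ - θs) (hessOp (residualLaw P₀ x y θs) (θ - θs))
      = ∫ ω, inner ℝ (x ω) (θ - θs) ^ 2 ∂P₀ := by
    rw [h.inner_hessOp_self]
    exact integral_map hm (Continuous.aestronglyMeasurable (by fun_prop))
  have hxv : ∀ v, MemLp (fun ω => inner ℝ (x ω) v) 2 P₀ := fun v => by
    simpa [real_inner_comm, Function.comp_def] using (innerSL ℝ v).comp_memLp' hx
  have hr : MemLp (fun ω => y ω - inner ℝ (x ω) θs) 2 P₀ := hy.sub (hxv θs)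
  have e2 : ∀ ω, (y ω - inner ℝ (x ω) θ) ^ 2 = (y ω - inner ℝ (x ω) θs) ^ 2
      + (-2) * ((y ω - inner ℝ (x ω) θs) * inner ℝ (x ω) (θ - θs))
      + inner ℝ (x ω) (θ - θs) ^ 2 := fun ω => by
    rw [inner_sub_right]; ring
  have i2 : Integrable (fun ω => (-2) * ((y ω - inner ℝ (x ω) θs) * inner ℝ (x ω) (θ - θs))) P₀ :=
    (hr.integrable_mul (hxv _)).const_mul _
  simp only [risk, e2]
  rw [integral_add_three hr.integrable_sq i2 (hxv _).integrable_sq, integral_const_mul,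
    integral_residual_mul_inner hx hy hθ, e1]
  ring

/-- The recursion commutes with translation by `θ*` once the responses are replaced by residuals, so
all estimates may be made around `0`. -/
lemma sgdSteps_eq_residual (γ : ℝ) (θ₀ θs : Vec d) (x : ℤ → Vec d) (y : ℤ → ℝ) (m : ℤ) (n : ℕ) :
    sgdSteps γ θ₀ x y m n
      = sgdSteps γ (θ₀ - θs) x (fun t => y t - inner ℝ (x t) θs) m n + θs := by
  induction n with
  | zero => simp [sgdSteps]
  | succ n ih =>
    simp only [sgdSteps]
    rw [ih, inner_add_right, show ∀ a b c : ℝ, a + b - c = a - (c - b) by intros; ring]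
    abel

end Reduction

/-! ### Averages of independent centred vectors -/

section Independent

variable {d : ℕ} {Ω : Type*} [MeasurableSpace Ω] {P : Measure Ω} [IsProbabilityMeasure P]

lemma integral_inner_const_left {U : Ω → Vec d} (hU : MemLp U 2 P) (w : Vec d) :
    ∫ ω, inner ℝ w (U ω) ∂P = inner ℝ w (∫ ω, U ω ∂P) :=
  integral_inner (hU.integrable (by norm_num)) w

lemma integral_form_indep {U V : Ω → Vec d} (hUV : IndepFun U V P) (hU : MemLp U 2 P)
    (hV : MemLp V 2 P) (A : Vec d →L[ℝ] Vec d) :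
    ∫ ω, inner ℝ (U ω) (A (V ω)) ∂P = inner ℝ (∫ ω, U ω ∂P) (A (∫ ω, V ω ∂P)) := by
  let b := EuclideanSpace.basisFun (Fin d) ℝ
  have hAV : MemLp (fun ω => A (V ω)) 2 P := A.comp_memLp' hV
  have hAm : ∫ ω, A (V ω) ∂P = A (∫ ω, V ω ∂P) :=
    A.integral_comp_comm (hV.integrable (by norm_num))
  have hUi : ∀ i, MemLp (fun ω => inner ℝ (U ω) (b i)) 2 P := fun i => by
    simpa [real_inner_comm, Function.comp_def] using (innerSL ℝ (b i)).comp_memLp' hU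
  have hVi : ∀ i, MemLp (fun ω => inner ℝ (b i) (A (V ω))) 2 P := fun i => by
    simpa [Function.comp_def] using (innerSL ℝ (b i)).comp_memLp' hAV
  have ex : ∀ ω, inner ℝ (U ω) (A (V ω)) = ∑ i, inner ℝ (U ω) (b i) * inner ℝ (b i) (A (V ω)) :=
    fun ω => (b.sum_inner_mul_inner _ _).symm
  simp only [ex]
  have hp : ∀ i, Integrable (fun ω => inner ℝ (U ω) (b i) * inner ℝ (b i) (A (V ω))) P := fun i =>
    (hUi i).integrable_mul (hVi i)
  rw [← b.sum_inner_mul_inner (∫ ω, U ω ∂P), integral_finsetSum _ fun i _ => hp i]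
  refine Finset.sum_congr rfl fun i _ => ?_
  have h1 : ∫ ω, inner ℝ (U ω) (b i) * inner ℝ (b i) (A (V ω)) ∂P
      = (∫ ω, inner ℝ (U ω) (b i) ∂P) * ∫ ω, inner ℝ (b i) (A (V ω)) ∂P :=
    hUV.integral_fun_comp_mul_comp (f := fun u => inner ℝ u (b i))
      (g := fun v => inner ℝ (b i) (A v)) hU.1.aemeasurable hV.1.aemeasurable
      (Continuous.aestronglyMeasurable (by fun_prop))
      (Continuous.aestronglyMeasurable (by fun_prop))
  rw [h1, integral_inner_const_left hAV, hAm]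
  congr 1
  simp only [real_inner_comm (b i)]
  exact integral_inner_const_left hU _

/-- The average of `M` independent centred copies has `1 / M` of the second moment. -/
lemma integral_form_average {M : ℕ} (hM : M ≠ 0) {G : Fin M → Ω → Vec d} (hG : ∀ i, MemLp (G i) 2 P)
    (hind : iIndepFun G P) (h0 : ∀ i, ∫ ω, G i ω ∂P = 0) (A : Vec d →L[ℝ] Vec d) {e : ℝ}
    (he : ∀ i, ∫ ω, inner ℝ (G i ω) (A (G i ω)) ∂P = e) :
    Integrable (fun ω => inner ℝ ((M : ℝ)⁻¹ • ∑ i, G i ω) (A ((M : ℝ)⁻¹ • ∑ i, G i ω))) P ∧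
    ∫ ω, inner ℝ ((M : ℝ)⁻¹ • ∑ i, G i ω) (A ((M : ℝ)⁻¹ • ∑ i, G i ω)) ∂P = e / M := by
  have hM0 : (M : ℝ) ≠ 0 := by exact_mod_cast hM
  have ex : ∀ ω, inner ℝ ((M : ℝ)⁻¹ • ∑ i, G i ω) (A ((M : ℝ)⁻¹ • ∑ i, G i ω))
      = (M : ℝ)⁻¹ ^ 2 * ∑ i, ∑ j, inner ℝ (G i ω) (A (G j ω)) := fun ω => by
    rw [map_smul, inner_smul_left, inner_smul_right, map_sum, sum_inner]
    simp only [inner_sum, conj_trivial]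
    ring
  have hi : ∀ i j, Integrable (fun ω => inner ℝ (G i ω) (A (G j ω))) P := fun i j =>
    integrable_inner_clm A (hG i) (hG j)
  have hi1 : ∀ i, Integrable (fun ω => ∑ j, inner ℝ (G i ω) (A (G j ω))) P := fun i =>
    integrable_finsetSum _ fun j _ => hi i j
  simp only [ex]
  refine ⟨(integrable_finsetSum _ fun i _ => hi1 i).const_mul _, ?_⟩
  rw [integral_const_mul, integral_finsetSum _ fun i _ => hi1 i]
  have h1 : ∀ i, ∫ ω, ∑ j, inner ℝ (G i ω) (A (G j ω)) ∂P = e := fun i => by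
    rw [integral_finsetSum _ fun j _ => hi i j, Finset.sum_eq_single i, he]
    · intro j _ hji
      rw [integral_form_indep (hind.indepFun hji.symm) (hG i) (hG j), h0, inner_zero_left]
    · simp
  simp only [h1, Finset.sum_const, Finset.card_univ, Fintype.card_fin, nsmul_eq_mul]
  field_simp

end Independent

/-! ### Randomised bias correction -/

section Debias

variable {d : ℕ} {Ω : Type*} [MeasurableSpace Ω] {P : Measure Ω} [IsProbabilityMeasure P]

lemma integral_smul_indep {Q : Ω → ℕ} (hQ : Measurable Q) (f : ℕ → ℝ) {U : Ω → Vec d}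
    (hU : MemLp U 2 P) (hQU : IndepFun Q U P) (hi : Integrable (fun ω => f (Q ω) • U ω) P) :
    ∫ ω, f (Q ω) • U ω ∂P = (∫ ω, f (Q ω) ∂P) • ∫ ω, U ω ∂P := by
  refine ext_inner_left ℝ fun w => ?_
  rw [← integral_inner hi, inner_smul_right, ← integral_inner_const_left hU]
  simp only [inner_smul_right]
  exact hQU.integral_fun_comp_mul_comp (f := f) (g := fun u => inner ℝ w u) hQ.aemeasurable
    hU.1.aemeasurable (measurable_from_top.aestronglyMeasurable)
    (Continuous.aestronglyMeasurable (by fun_prop))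

/-- Moments of a biased estimator `T` corrected by `q⁻¹ Q Z`. -/
lemma debiased_moments {T Z : Ω → Vec d} {Q : Ω → ℕ} {q : ℝ} (hT : MemLp T 2 P) (hZ : MemLp Z 2 P)
    (hQ : Measurable Q) (hQ1 : P.real {ω | Q ω = 1} = q) (hQ0 : P.real {ω | Q ω = 0} = 1 - q)
    (hq : 0 < q) (hQT : IndepFun Q T P) (hZTQ : IndepFun Z (fun ω => (T ω, Q ω)) P)
    (hmean : ∫ ω, Z ω ∂P = -∫ ω, T ω ∂P) {A : Vec d →L[ℝ] Vec d}
    (hs : ∀ u v, inner ℝ u (A v) = inner ℝ v (A u)) (hA : ∀ v, 0 ≤ inner ℝ v (A v)) :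
    MemLp (fun ω => T ω + (q⁻¹ * (Q ω : ℝ)) • Z ω) 2 P ∧
    ∫ ω, (T ω + (q⁻¹ * (Q ω : ℝ)) • Z ω) ∂P = 0 ∧
    ∫ ω, inner ℝ (T ω + (q⁻¹ * (Q ω : ℝ)) • Z ω) (A (T ω + (q⁻¹ * (Q ω : ℝ)) • Z ω)) ∂P
      ≤ ∫ ω, inner ℝ (T ω) (A (T ω)) ∂P + q⁻¹ * ∫ ω, inner ℝ (Z ω) (A (Z ω)) ∂P := by
  have hm1 : MeasurableSet {ω | Q ω = 1} := hQ (measurableSet_singleton 1)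
  have hm0 : MeasurableSet {ω | Q ω = 0} := hQ (measurableSet_singleton 0)
  have hae : ∀ᵐ ω ∂P, Q ω = 0 ∨ Q ω = 1 := by
    have hu : P.real ({ω | Q ω = 0} ∪ {ω | Q ω = 1}) = 1 := by
      rw [measureReal_union (Set.disjoint_left.2 fun ω h0 h1 => by
        simp only [Set.mem_ofPred_eq] at h0 h1; omega) hm1, hQ0, hQ1]
      ring
    have hu' : P ({ω | Q ω = 0} ∪ {ω | Q ω = 1}) = 1 := by
      rw [measureReal_def] at hu
      rwa [← ENNReal.toReal_eq_one_iff]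
    exact (prob_compl_eq_zero_iff (hm0.union hm1)).2 hu'
  set f : ℕ → ℝ := fun n => q⁻¹ * (n : ℝ) with hf
  have hfm : Measurable fun ω => f (Q ω) := (measurable_from_top (f := f)).comp hQ
  have hfae : ∀ᵐ ω ∂P, ‖f (Q ω)‖ ≤ q⁻¹ := by
    filter_upwards [hae] with ω hω
    rcases hω with h | h <;> simp [hf, h, hq.le, abs_of_pos hq]
  -- As `Q² = Q` almost surely, the correction factor has mean `1` and second moment only `q⁻¹`.
  have hfsq : ∀ᵐ ω ∂P, f (Q ω) ^ 2 = q⁻¹ * f (Q ω) := by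
    filter_upwards [hae] with ω hω
    rcases hω with h | h <;> simp [hf, h, sq]
  have hfint : ∫ ω, f (Q ω) ∂P = 1 := by
    have : ∫ ω, f (Q ω) ∂P = ∫ ω, Set.indicator {ω | Q ω = 1} (fun _ => q⁻¹) ω ∂P := by
      refine integral_congr_ae ?_
      filter_upwards [hae] with ω hω
      rcases hω with h | h <;> simp [hf, h, Set.indicator]
    rw [this, integral_indicator hm1, setIntegral_const, hQ1, smul_eq_mul,
      mul_inv_cancel₀ hq.ne']
  have hLs : ∀ {U : Ω → Vec d}, MemLp U 2 P → MemLp (fun ω => f (Q ω) • U ω) 2 P := fun hU => by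
    refine hU.of_le_mul (c := q⁻¹) (hfm.aestronglyMeasurable.smul hU.1) ?_
    filter_upwards [hfae] with ω hω
    rw [norm_smul]
    exact mul_le_mul_of_nonneg_right hω (norm_nonneg _)
  have hQZ : IndepFun Q Z P := (hZTQ.comp (φ := id) (ψ := Prod.snd) measurable_id measurable_snd).symm
  have hfT := integral_smul_indep hQ f hT hQT ((hLs hT).integrable (by norm_num))
  have hfZ := integral_smul_indep hQ f hZ hQZ ((hLs hZ).integrable (by norm_num))
  rw [hfint, one_smul] at hfT hfZ
  have hTi := hT.integrable (by norm_num)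
  refine ⟨hT.add (hLs hZ), ?_, ?_⟩
  · rw [integral_add hTi ((hLs hZ).integrable (by norm_num)), hfZ, hmean, add_neg_cancel]
  have hind : IndepFun (fun ω => f (Q ω) • T ω) Z P := by
    have hg : Measurable fun p : Vec d × ℕ => f p.2 • p.1 :=
      Measurable.smul (f := fun p : Vec d × ℕ => f p.2) (g := Prod.fst)
        ((measurable_from_top (f := f)).comp measurable_snd) measurable_fst
    exact (hZTQ.comp (φ := id) measurable_id hg).symm
  -- By independence the cross term factors into the two means, which are opposite, so it equals
  -- `-⟨E T, A (E T)⟩ ≤ 0` and can be dropped.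
  have hcross := integral_form_indep hind (hLs hT) hZ A
  rw [hfT, hmean, map_neg, inner_neg_right] at hcross
  have hform : ∫ ω, f (Q ω) * inner ℝ (Z ω) (A (Z ω)) ∂P = ∫ ω, inner ℝ (Z ω) (A (Z ω)) ∂P := by
    have := hQZ.integral_fun_comp_mul_comp (f := f) (g := fun z => inner ℝ z (A z))
      hQ.aemeasurable hZ.1.aemeasurable measurable_from_top.aestronglyMeasurable
      (Continuous.aestronglyMeasurable (by fun_prop))
    rw [this, hfint, one_mul]
  have iT := integrable_inner_clm A hT hT
  have iC := integrable_inner_clm A (hLs hT) hZ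
  have iZ : Integrable (fun ω => q⁻¹ * (f (Q ω) * inner ℝ (Z ω) (A (Z ω)))) P := by
    have := integrable_inner_clm A (hLs hZ) hZ
    simp only [inner_smul_left, conj_trivial] at this
    exact this.const_mul _
  have hexp : ∫ ω, inner ℝ (T ω + f (Q ω) • Z ω) (A (T ω + f (Q ω) • Z ω)) ∂P
      = ∫ ω, (inner ℝ (T ω) (A (T ω)) + 2 * inner ℝ (f (Q ω) • T ω) (A (Z ω))
        + q⁻¹ * (f (Q ω) * inner ℝ (Z ω) (A (Z ω)))) ∂P := by
    refine integral_congr_ae ?_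
    filter_upwards [hfsq] with ω hω
    rw [← mul_assoc q⁻¹, ← hω]
    simp only [map_add, map_smul, inner_add_left, inner_add_right, inner_smul_left,
      inner_smul_right, conj_trivial]
    rw [hs (Z ω) (T ω)]
    ring
  change ∫ ω, inner ℝ (T ω + f (Q ω) • Z ω) (A (T ω + f (Q ω) • Z ω)) ∂P ≤ _
  rw [hexp, integral_add_three iT (iC.const_mul 2) iZ, integral_const_mul, integral_const_mul,
    hcross, hform]
  linarith [hA (∫ ω, T ω ∂P)]

end Debias

/-! ### The time average and the full estimator -/

section Main

variable {d : ℕ} {Ω : Type*} [MeasurableSpace Ω] {P : Measure Ω} [IsProbabilityMeasure P]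
  {ν : Measure (Vec d × ℝ)} {u : ℤ → Ω → Vec d × ℝ} {σ R lam γ δ : ℝ} {k s : ℕ}

/-- The time average of the centred chain. -/
noncomputable def chainAvg (γ : ℝ) (k s : ℕ) (u : ℤ → Ω → Vec d × ℝ) (v : Vec d) (ω : Ω) : Vec d :=
  ((k : ℝ) - (s : ℝ))⁻¹ • ∑ t ∈ Finset.Ico s k, chain γ u v 0 t ω

lemma IsSample.memLp_chainAvg (hu : IsSample P ν u) (h : NoiseModel ν σ R lam) (hγ : 0 ≤ γ)
    (v : Vec d) : MemLp (chainAvg γ k s u v) 2 P := by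
  have hsum : MemLp (fun ω => ∑ t ∈ Finset.Ico s k, chain γ u v 0 t ω) 2 P :=
    memLp_finsetSum _ fun t _ => (hu.pastL2_chain h hγ v 0 t).memLp
  exact hsum.const_smul ((k : ℝ) - (s : ℝ))⁻¹

/-- The mean of a state depends only on its number of steps, so averaging forward over `s, …, k-1`
gives the same mean as starting at the random time `-τ₀` and stopping at `0`. This is why the single
term removes exactly the bias of the time average. -/
lemma IsSample.integral_inner_chainAvg (hu : IsSample P ν u) (h : NoiseModel ν σ R lam)
    (hγ : 0 ≤ γ) (hs : s ≤ k) (v w : Vec d) :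
    ∫ ω, inner ℝ w (chainAvg γ k s u v ω) ∂P = levelMean ν γ k s v 0 w := by
  have hi : ∀ t : ℕ, Integrable (fun ω => inner ℝ w (chain γ u v 0 t ω)) P := fun t =>
    ((hu.pastL2_chain h hγ v 0 t).memLp.integrable (by norm_num)).const_inner w
  have hI : startFinset k s 0 = Finset.Ico s k := by simp [startFinset, startLo]
  simp only [chainAvg, inner_smul_right, inner_sum]
  rw [integral_const_mul, integral_finsetSum _ fun t _ => hi t, levelMean, hI, Nat.card_Ico,
    Nat.cast_sub hs]
  simp only [hu.integral_inner_chain h hγ]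

lemma IsSample.integral_form_chainAvg_le (hu : IsSample P ν u) (h : NoiseModel ν σ R lam)
    (hd : 1 ≤ d) (hγ : 0 < γ) (hγR : 0 < 2 - γ * R ^ 2) (hk : 2 ≤ k) (hs : s ≤ k)
    (hks : (k : ℝ) / 3 ≤ (k : ℝ) - s) (v : Vec d) :
    k * ∫ ω, inner ℝ (chainAvg γ k s u v ω) (hessOp ν (chainAvg γ k s u v ω)) ∂P
      ≤ 48 * ((‖v‖ ^ 2 + γ * σ ^ 2 / (2 - γ * R ^ 2) * d) / (γ * (2 - γ * R ^ 2))) := by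
  have hk0 : (0 : ℝ) < k := by exact_mod_cast (by omega : 0 < k)
  obtain ⟨n, rfl⟩ := Nat.exists_eq_add_of_le hs
  have hn : ((s + n : ℕ) : ℝ) - s = n := by push_cast; ring
  rw [hn] at hks
  have hn0 : (0 : ℝ) < n := by linarith
  set B := ‖v‖ ^ 2 + γ * σ ^ 2 / (2 - γ * R ^ 2) * d with hB
  have hB0 : 0 ≤ B := by positivity
  have h1 := hu.integral_form_sum_chain_le h hγ.le v
    (fun n => hu.integral_norm_chain_sq_le h hd hγ hγR h.lam_pos.le v 0 n) s n
  have e : ∀ ω, inner ℝ (chainAvg γ (s + n) s u v ω) (hessOp ν (chainAvg γ (s + n) s u v ω))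
      = (n : ℝ)⁻¹ ^ 2 * inner ℝ (∑ t ∈ Finset.Ico s (s + n), chain γ u v 0 t ω)
        (hessOp ν (∑ t ∈ Finset.Ico s (s + n), chain γ u v 0 t ω)) := fun ω => by
    rw [chainAvg, hn, map_smul, inner_smul_left, inner_smul_right, conj_trivial]; ring
  simp only [e]
  rw [integral_const_mul]
  set F := ∫ ω, inner ℝ (∑ t ∈ Finset.Ico s (s + n), chain γ u v 0 t ω)
        (hessOp ν (∑ t ∈ Finset.Ico s (s + n), chain γ u v 0 t ω)) ∂P
  have hF : F ≤ 8 * n * B / γ := by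
    rw [le_div_iff₀ hγ]; linarith
  have hκ : 2 - γ * R ^ 2 ≤ 2 := by
    have : 0 ≤ γ * R ^ 2 := by positivity
    linarith
  -- Here `k ≤ 3n`, and `F ≤ 8nB/γ` comes from `S = 2B`. The last step uses `2 - γR² ≤ 2`, which
  -- doubles `24` to `48`.
  calc ((s + n : ℕ) : ℝ) * ((n : ℝ)⁻¹ ^ 2 * F)
      ≤ (3 * n) * ((n : ℝ)⁻¹ ^ 2 * (8 * n * B / γ)) := by
        have hF0 : 0 ≤ F := integral_nonneg fun ω => h.hessOp_nonneg _
        refine mul_le_mul (by linarith) (mul_le_mul_of_nonneg_left hF (by positivity))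
          (by positivity) (by positivity)
    _ = 24 * B / γ := by field_simp; ring
    _ ≤ 48 * (B / (γ * (2 - γ * R ^ 2))) := by
        rw [← mul_div_assoc, div_le_div_iff₀ hγ (by positivity)]
        have : 0 ≤ B * γ := by positivity
        nlinarith

lemma constC_eq {θ₀ θs : Vec d} (hγ : 0 < γ) (hγR : 0 < 2 - γ * R ^ 2) :
    (‖θ₀ - θs‖ ^ 2 + γ * σ ^ 2 / (2 - γ * R ^ 2) * d) / (γ * (2 - γ * R ^ 2))
      = constC σ R γ θ₀ θs := by
  rw [constC]
  field_simp
  ring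

/-- Moments of the unbiased estimator. -/
lemma estimator_moments {Ω₀ : Type*} [MeasurableSpace Ω₀] {P₀ : Measure Ω₀}
    {x : Ω₀ → Vec d} {y : Ω₀ → ℝ} {θs θ₀ : Vec d} {q : ℝ}
    (h : NoiseModel (residualLaw P₀ x y θs) σ R lam) (hd : 1 ≤ d) (hγ : 0 < γ)
    (hγR : 0 < 2 - γ * R ^ 2) (hq : 0 < q) (hq' : q ≤ 1) (hδ : 1 < δ) (hk : 2 ≤ k) (hs : s ≤ k)
    (hks : (k : ℝ) / 3 ≤ (k : ℝ) - s)
    (hw : Summable fun l : ℕ =>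
      ((l : ℝ) + 1) ^ δ * (1 - γ * (2 - γ * R ^ 2) * lam) ^ startLo k s l)
    {F : Ω → Vec d} (hF : IsFHat P₀ x y P γ θ₀ δ q k s F) :
    MemLp (fun ω => F ω - θs) 2 P ∧ ∫ ω, (F ω - θs) ∂P = 0 ∧
    k * ∫ ω, inner ℝ (F ω - θs) (hessOp (residualLaw P₀ x y θs) (F ω - θs)) ∂P
      ≤ q⁻¹ * (48 * constC σ R γ θ₀ θs + 21 * constC σ R γ θ₀ θs *
        ∑' l : ℕ, ((l : ℝ) + 1) ^ δ * (1 - γ * (2 - γ * R ^ 2) * lam) ^ startLo k s l) := by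
  obtain ⟨xs, ys, τ, N, Q, Z', hin, hQm, hQ1, hQ0, hQT, hZm, hZid, hZTQ, rfl⟩ := hF
  set ν := residualLaw P₀ x y θs with hν
  set v := θ₀ - θs with hv
  set u : ℤ → Ω → Vec d × ℝ := fun t ω => residual θs (xs t ω, ys t ω) with hudef
  have hxym : ∀ t, Measurable fun ω => (xs t ω, ys t ω) := fun t =>
    (hin.meas_xs t).prodMk (hin.meas_ys t)
  have hu : IsSample P ν u := by
    refine ⟨fun t => (measurable_residual θs).comp (hxym t), fun t => ?_, ?_⟩
    · exact ((hin.copy t).comp (measurable_residual θs)).map_eq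
    · exact hin.indep_xy.comp (fun _ => residual θs) fun _ => measurable_residual θs
  have hres : Measurable fun (z : ℤ → Vec d × ℝ) t => residual θs (z t) :=
    measurable_pi_lambda _ fun t => (measurable_residual θs).comp (measurable_pi_apply t)
  have hL : IsLevelInput P u δ k s τ N := by
    refine ⟨hin.meas_τ, hin.meas_N, hin.law_τ, hin.law_N, hin.indep_τ, ?_, ?_⟩
    · exact hin.indep_xy_τ.comp (ψ := id) hres measurable_id
    · exact hin.indep_N.comp (φ := id) measurable_id
        ((hres.comp measurable_fst).prodMk measurable_snd)
  have hsteps : ∀ (m : ℤ) (n : ℕ) (ω : Ω),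
      sgdSteps γ θ₀ (fun t => xs t ω) (fun t => ys t ω) m n = chain γ u v m n ω + θs :=
    fun m n ω => sgdSteps_eq_residual γ θ₀ θs _ _ m n
  have hks0 : (0 : ℝ) < (k : ℝ) - s := by
    have : (0 : ℝ) < k := by exact_mod_cast (by omega : 0 < k)
    linarith
  have hTavg : ∀ ω, timeAvg γ θ₀ k s (fun t => xs t ω) (fun t => ys t ω)
      = chainAvg γ k s u v ω + θs := fun ω => by
    simp only [timeAvg, sgd, hsteps, chainAvg, sub_zero, Int.toNat_natCast,
      Finset.sum_add_distrib, Finset.sum_const, Nat.card_Ico, smul_add]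
    congr 1
    rw [← Nat.cast_smul_eq_nsmul ℝ, smul_smul, Nat.cast_sub hs, inv_mul_cancel₀ hks0.ne', one_smul]
  have hterm : (fun ω => singleTerm γ θ₀ δ (fun t => xs t ω) (fun t => ys t ω) (fun l => τ l ω)
      (N ω)) = randomTerm γ δ u v τ N := by
    ext1 ω
    simp only [singleTerm, sgd, hsteps, randomTerm, levelDiff, zero_sub, neg_neg,
      Int.toNat_natCast, add_sub_add_right_eq_sub]
  rw [hterm] at hZid
  simp only [hTavg] at hQT hZTQ ⊢
  have hT : MemLp (chainAvg γ k s u v) 2 P := hu.memLp_chainAvg h hγ.le v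
  have hsub : Measurable fun z : Vec d => z - θs := by fun_prop
  have hQT' : IndepFun Q (chainAvg γ k s u v) P := by
    have := hQT.comp (φ := id) measurable_id hsub
    simpa [Function.comp_def] using this
  have hZTQ' : IndepFun Z' (fun ω => (chainAvg γ k s u v ω, Q ω)) P := by
    have := hZTQ.comp (φ := id) measurable_id
      ((hsub.comp measurable_fst).prodMk (measurable_snd : Measurable (Prod.snd : Vec d × ℕ → ℕ)))
    simpa [Function.comp_def] using this
  obtain ⟨hsum, hZi, hZle⟩ := hL.integral_form_randomTerm_le hu h hd hγ hγR hδ hk hs hks v hw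
  have hZ₀ : MemLp (randomTerm γ δ u v τ N) 2 P :=
    IsLevelInput.memLp_of_form h (hL.measurable_randomTerm hu v) hZi
  have hZ : MemLp Z' 2 P := hZid.memLp_iff.2 hZ₀
  have hmean : ∫ ω, Z' ω ∂P = -∫ ω, chainAvg γ k s u v ω ∂P := by
    rw [hZid.integral_eq]
    refine ext_inner_left ℝ fun w => ?_
    rw [inner_neg_right, ← integral_inner_const_left hZ₀, ← integral_inner_const_left hT,
      hu.integral_inner_chainAvg h hγ.le hs,
      hL.integral_inner_randomTerm hu h hγ hγR hδ hk v w hsum]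
  have hform : ∫ ω, inner ℝ (Z' ω) (hessOp ν (Z' ω)) ∂P
      = ∫ ω, inner ℝ (randomTerm γ δ u v τ N ω) (hessOp ν (randomTerm γ δ u v τ N ω)) ∂P :=
    (hZid.comp (u := fun z => inner ℝ z (hessOp ν z))
      (Continuous.measurable (by fun_prop))).integral_eq
  obtain ⟨m1, m2, m3⟩ := debiased_moments hT hZ hQm hQ1 hQ0 hq hQT' hZTQ' hmean
    h.hessOp_symm h.hessOp_nonneg
  have e : ∀ ω, chainAvg γ k s u v ω + θs + (q⁻¹ * (Q ω : ℝ)) • Z' ω - θs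
      = chainAvg γ k s u v ω + (q⁻¹ * (Q ω : ℝ)) • Z' ω := fun ω => by abel
  simp only [e]
  refine ⟨m1, m2, ?_⟩
  have hT2 := hu.integral_form_chainAvg_le h hd hγ hγR hk hs hks v
  rw [constC_eq hγ hγR] at hT2 hZle
  rw [hform] at m3
  -- The time average term carries no factor `q⁻¹`; it is given one so that both contributions share
  -- it.
  have hq1 : 1 ≤ q⁻¹ := (one_le_inv₀ hq).2 hq'
  have hT0 : 0 ≤ ∫ ω, inner ℝ (chainAvg γ k s u v ω) (hessOp ν (chainAvg γ k s u v ω)) ∂P :=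
    integral_nonneg fun ω => h.hessOp_nonneg _
  have hk0 : (0 : ℝ) ≤ k := k.cast_nonneg
  calc _ ≤ k * (q⁻¹ * ∫ ω, inner ℝ (chainAvg γ k s u v ω) (hessOp ν (chainAvg γ k s u v ω)) ∂P
          + q⁻¹ * ∫ ω, inner ℝ (randomTerm γ δ u v τ N ω)
            (hessOp ν (randomTerm γ δ u v τ N ω)) ∂P) := by
        refine mul_le_mul_of_nonneg_left (m3.trans ?_) hk0
        have := mul_le_mul_of_nonneg_right hq1 hT0
        linarith
    _ = q⁻¹ * (k * ∫ ω, inner ℝ (chainAvg γ k s u v ω) (hessOp ν (chainAvg γ k s u v ω)) ∂P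
          + k * ∫ ω, inner ℝ (randomTerm γ δ u v τ N ω)
            (hessOp ν (randomTerm γ δ u v τ N ω)) ∂P) := by ring
    _ ≤ _ := by
        refine mul_le_mul_of_nonneg_left ?_ (by positivity)
        linarith

/-- Either rounding gives `2s < k + 2`, and over the integers this implies `3s ≤ 2k` once `k ≥ 2`;
equality occurs for `k = 3`, `s = 2`. -/
lemma burnIn_le {α : ℝ} (hα' : α ≤ 1 / 2) (hα : 0 < α) (hk : 2 ≤ k)
    (hs : s = ⌊α * (k : ℝ)⌋₊ ∨ s = ⌈α * (k : ℝ)⌉₊) : 3 * s ≤ 2 * k := by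
  have hk0 : (0 : ℝ) ≤ k := k.cast_nonneg
  have h1 : (s : ℝ) < α * k + 1 := by
    rcases hs with rfl | rfl
    · exact (Nat.floor_le (by positivity)).trans_lt (by linarith)
    · exact Nat.ceil_lt_add_one (by positivity)
  have h2 : α * k ≤ 1 / 2 * k := mul_le_mul_of_nonneg_right hα' hk0
  have h3 : (2 : ℝ) * s < k + 2 := by linarith
  have h4 : 2 * s < k + 2 := by exact_mod_cast h3
  omega

end Main

end UnbiasedSGD

/-! ### The main theorem -/

theorem mainTheorem10
    {d : ℕ} (hd : 1 ≤ d)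
    -- the random pair (x, y), its Hessian and the optimal solution
    {Ω₀ : Type*} [MeasurableSpace Ω₀] (P₀ : Measure Ω₀) [IsProbabilityMeasure P₀]
    (x : Ω₀ → UnbiasedSGD.Vec d) (y : Ω₀ → ℝ) (hx : MemLp x 2 P₀) (hy : MemLp y 2 P₀)
    (hH : (UnbiasedSGD.hessian P₀ x).PosDef)
    (θs : UnbiasedSGD.Vec d) (hθs : UnbiasedSGD.NormalEq P₀ x y θs)
    (σ R : ℝ) (hA : UnbiasedSGD.MomentAssumption P₀ x y θs σ R)
    -- the parameters
    (θ₀ : UnbiasedSGD.Vec d) (γ α q δ : ℝ) (hγ : 0 < γ) (hγR : γ < 2 / R ^ 2)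
    (hα : 0 < α) (hα' : α ≤ 1 / 2) (hq : 0 < q) (hq' : q ≤ 1) (hδ : 1 < δ)
    (k M : ℕ) (hk : 2 ≤ k) (hM : 2 ≤ M)
    -- the burn-in period αk, rounded either way to an integer
    (s : ℕ) (hs : s = ⌊α * (k : ℝ)⌋₊ ∨ s = ⌈α * (k : ℝ)⌉₊)
    -- the unbiased estimator
    {Ω : Type*} [MeasurableSpace Ω] (P : Measure Ω) [IsProbabilityMeasure P]
    (fhat : Ω → UnbiasedSGD.Vec d)
    (hfhat : UnbiasedSGD.IsFHat P₀ x y P γ θ₀ δ q k s fhat)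
    -- its M independent copies
    {Ω' : Type*} [MeasurableSpace Ω'] (P' : Measure Ω') [IsProbabilityMeasure P']
    (F : Fin M → Ω' → UnbiasedSGD.Vec d)
    (hFcopy : ∀ i, IdentDistrib (F i) fhat P' P) (hFindep : iIndepFun F P')
    (fbar : Ω' → UnbiasedSGD.Vec d) (hfbar : fbar = fun ω => (M : ℝ)⁻¹ • ∑ i, F i ω) :
    Integrable (fun ω => UnbiasedSGD.risk P₀ x y (fbar ω)) P' ∧
    (k : ℝ) * (M : ℝ) *
        ((∫ ω, UnbiasedSGD.risk P₀ x y (fbar ω) ∂P') - UnbiasedSGD.risk P₀ x y θs)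
      ≤ 1 / (2 * q) *
        (27 * UnbiasedSGD.constC σ R γ θ₀ θs / α
          + 6 * UnbiasedSGD.constC σ R γ θ₀ θs *
            (4 * Real.log ((4 * δ + 8) /
              (α * UnbiasedSGD.constXi R γ (UnbiasedSGD.lambdaMin (UnbiasedSGD.hessian P₀ x)))))
              ^ (δ + 1)) := by
  have hγR' : 0 < 2 - γ * R ^ 2 := by
    have := (lt_div_iff₀ (pow_pos hA.R_pos 2)).1 hγR
    linarith
  have h := UnbiasedSGD.noiseModel_residualLaw hd hx hy hH hθs hA
  set lam := UnbiasedSGD.lambdaMin (UnbiasedSGD.hessian P₀ x)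
  set c := UnbiasedSGD.constC σ R γ θ₀ θs with hc
  have h3s := UnbiasedSGD.burnIn_le hα' hα hk hs
  have hsk : s ≤ k := by omega
  have hks : (k : ℝ) / 3 ≤ (k : ℝ) - s := by
    have : (3 : ℝ) * s ≤ 2 * k := by exact_mod_cast h3s
    linarith
  have hlam := h.lam_pos
  have hξ : 0 < γ * (2 - γ * R ^ 2) * lam := by positivity
  have hξ1 := h.contraction_le_one hd hγ.le hγR'.le
  obtain ⟨hw, hw'⟩ := UnbiasedSGD.weight_sum hδ hα hα' hξ hξ1
    (e := UnbiasedSGD.startLo k s) fun l hl => UnbiasedSGD.le_startLo hk hl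
  obtain ⟨m1, m2, m3⟩ := UnbiasedSGD.estimator_moments h hd hγ
    hγR' hq hq' hδ hk hsk hks hw hfhat
  set H := UnbiasedSGD.hessOp (UnbiasedSGD.residualLaw P₀ x y θs) with hHdef
  have hsub : Measurable fun z : UnbiasedSGD.Vec d => z - θs := by fun_prop
  have hcopy : ∀ i, IdentDistrib (fun ω => F i ω - θs) (fun ω => fhat ω - θs) P' P := fun i =>
    (hFcopy i).comp hsub
  -- Unbiasedness is essential here: it removes the off-diagonal terms, so that the excess risk of
  -- the average is exactly `1/M` of that of a single copy.
  obtain ⟨a1, a2⟩ := UnbiasedSGD.integral_form_average (P := P') (M := M) (by omega)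
    (G := fun i ω => F i ω - θs) (fun i => (hcopy i).memLp_iff.2 m1)
    (hFindep.comp (fun _ z => z - θs) fun _ => hsub)
    (fun i => (hcopy i).integral_eq.trans m2) H
    (fun i => ((hcopy i).comp (u := fun z => inner ℝ z (H z))
      (Continuous.measurable (by fun_prop))).integral_eq)
  have hM0 : (0 : ℝ) < M := by exact_mod_cast (by omega : 0 < M)
  have e : ∀ ω, fbar ω - θs = (M : ℝ)⁻¹ • ∑ i, (F i ω - θs) := fun ω => by
    rw [hfbar]
    simp only [Finset.sum_sub_distrib, Finset.sum_const, Finset.card_univ, Fintype.card_fin,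
      smul_sub]
    rw [← Nat.cast_smul_eq_nsmul ℝ, smul_smul, inv_mul_cancel₀ hM0.ne', one_smul]
  have hrisk : ∀ ω, UnbiasedSGD.risk P₀ x y (fbar ω) = UnbiasedSGD.risk P₀ x y θs
      + 1 / 2 * inner ℝ ((M : ℝ)⁻¹ • ∑ i, (F i ω - θs)) (H ((M : ℝ)⁻¹ • ∑ i, (F i ω - θs))) :=
    fun ω => by rw [UnbiasedSGD.risk_eq hx hy hθs h, e]
  simp only [hrisk]
  refine ⟨(integrable_const _).add (a1.const_mul _), ?_⟩
  rw [integral_add (integrable_const _) (a1.const_mul _), integral_const, integral_const_mul, a2]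
  have hc0 : 0 ≤ c := by
    rw [hc, UnbiasedSGD.constC]; positivity
  have hfin := UnbiasedSGD.final_constant_bound hδ hα hα' hξ hξ1 hc0
  simp only [probReal_univ, one_smul, add_sub_cancel_left, UnbiasedSGD.constXi]
  set E := ∫ ω, inner ℝ (fhat ω - θs) (H (fhat ω - θs)) ∂P
  have h21 := mul_le_mul_of_nonneg_left hw' (show 0 ≤ 21 * c by positivity)
  calc (k : ℝ) * M * (1 / 2 * (E / M)) = 1 / 2 * (k * E) := by field_simp
    _ ≤ 1 / 2 * (q⁻¹ * (27 * c / α + 6 * c * (4 * Real.log ((4 * δ + 8) /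
          (α * (γ * (2 - γ * R ^ 2) * lam)))) ^ (δ + 1))) := by
        refine mul_le_mul_of_nonneg_left (m3.trans ?_) (by norm_num)
        exact mul_le_mul_of_nonneg_left (by linarith) (by positivity)
    _ = _ := by field_simp
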